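/- Let $n, d \ge 2$ be coprime integers and let $K$ be an algebraically closed field with $\operatorname{char} K \nmid n$. Let $\alpha_1, \dots, \alpha_d \in K$ be distinct and let $\mathcal C$ be the smooth projective model of the curve $$y^n = (x+\alpha_1)\cdots(x+\alpha_d).$$ It has a unique point at infinity, denoted $\infty$. Put $g = \tfrac12 (n-1)(d-1)$, the genus of $\mathcal C$. Let $\zeta \in K$ be a primitive $n$-th root of unity; write $\zeta$ also for the automorphism $(x,y) \mapsto (x, \zeta y)$ of $\mathcal C$ and for the induced action on divisors, $\zeta(\sum m_Q Q) = \sum m_Q\, \zeta(Q)$. For a nonzero rational function $f$ on $\mathcal C$ put $\operatorname{div} f = \sum_Q v_Q(f)\, Q$ and $\operatorname{div}_0 f = \sum_{v_Q(f) \ge 0} v_Q(f)\, Q$. The $\gcd$ of a family of divisors is the largest divisor that is $\le$ every member of the family, and $\sim$ denotes linear equivalence. Let $b \in K$ satisfy $b^n = \alpha_1 \cdots \alpha_d$, and let $P = (0,b) \in \mathcal C$. There exist $r_1, \dots, r_d \in K$ with $r_i^n = \alpha_i$ for all $i$ and $r_1 \cdots r_d = b$. For any such choice, let $s_m$ be the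 $m$-th elementary symmetric polynomial in $r_1, \dots, r_d$, with $s_m = 0$ for $m \notin [0,d]$, and for $\ell \in \mathbf Z$ put $$A_\ell(x) = \sum_{k \ge 0} (-1)^{(n-1)k} s_{\ell - nk}\, x^k \in K[x].$$ Let $A = (A_{d+i-j})_{1 \le i,j \le n}$, $Z = \operatorname{diag}(\zeta^0, \zeta^{-1}, \dots, \zeta^{-(n-1)})$, $M = A - yZ$ and $N = \operatorname{adj} M$, which are $n \times n$ matrices over $K[x,y]$. View the entries of $N$ as rational functions on $\mathcal C$. Then every $N_{i,j}$ is nonzero on $\mathcal C$, and $$D := \gcd_{1 \le j \le n} \operatorname{div}_0 N_{1,j}$$ is an effective divisor of degree $g$ such that $$(1-\zeta) D \sim P - \infty.$$ Moreover, there is an effective divisor $E$ of degree $g$ such that, for all $1 \le i, j \le n$, $$\operatorname{div}_0 N_{i,j} = \zeta^{i-1} D + \zeta^{j-1} E + \sum_{k=j-n}^{i-2} \zeta^k P,$$ $$\operatorname{div} N_{i,j} = \zeta^{i-1} D + \zeta^{j-1} E + \sum_{k=j-n}^{i-2} \zeta^k P - \bigl(2g + (i-1) + (n-j)\bigr)\infty.$$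 -/

import Mathlib

open Polynomial

noncomputable section

/-! ### Places of a function field, orders, divisors -/

/-- A closed point of the smooth projective model of a function field `F` in one variable over an
algebraically closed field `K`: a discrete valuation ring of `F` containing `K` (the local ring of
the model at that point). -/
structure Place (K F : Type*) [Field K] [Field F] [Algebra K F] where
  /-- the local ring at the point, as a subring of the function field -/
  localRing : ValuationSubring F
  algebraMap_mem : ∀ c : K, algebraMap K F c ∈ localRing
  isDVR : IsDiscreteValuationRing localRing

namespace Place

variable {K F : Type*} [Field K] [Field F] [Algebra K F]

instance (P : Place K F) : IsDiscreteValuationRing P.localRing := P.isDVR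

/-- The order of vanishing `v_P(f)` of a nonzero function `f` at the point `P`.
(The junk value at `f = 0` is `0`.) -/
def ord (P : Place K F) (f : F) : ℤ :=
  -WithZero.log ((IsDiscreteValuationRing.maximalIdeal P.localRing).valuation F f)

/-- If `φ` is the pullback `f ↦ f ∘ s` on functions along an automorphism `s` of the curve, then
`P.push φ` is the point `s(P)`: a function `f` is regular at `s(P)` iff `f ∘ s` is regular
at `P`. -/
def push (φ : F ≃ₐ[K] F) (P : Place K F) : Place K F where
  localRing := P.localRing.comap (φ : F →+* F)
  algebraMap_mem c := by
    rw [ValuationSubring.mem_comap]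
    simpa using P.algebraMap_mem c
  isDVR := by
    let e : P.localRing ≃+* P.localRing.comap (φ : F →+* F) :=
      { toFun := fun a => ⟨φ.symm a, by
          rw [ValuationSubring.mem_comap]; simp⟩
        invFun := fun a => ⟨φ a, a.2⟩
        left_inv := fun a => by ext; simp
        right_inv := fun a => by ext; simp
        map_mul' := fun a b => by ext; simp
        map_add' := fun a b => by ext; simp }
    exact IsDiscreteValuationRing.RingEquivClass.isDiscreteValuationRing e

end Place

/-- Divisors: finite formal `ℤ`-linear combinations of points, ordered pointwise. -/
abbrev CurveDivisor (K F : Type*) [Field K] [Field F] [Algebra K F] := Place K F →₀ ℤ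

namespace CurveDivisor

variable {K F : Type*} [Field K] [Field F] [Algebra K F]

/-- The degree `∑ m_P` of the divisor `∑ m_P P` (all residue fields are `K` when `K` is
algebraically closed). -/
def deg (X : CurveDivisor K F) : ℤ := X.sum fun _ m => m

/-- The divisor of a function, `P ↦ v_P(f)`. -/
def divisor (f : F) : Place K F → ℤ := fun P => P.ord f

/-- The effective portion `∑_{v_P(f) ≥ 0} v_P(f) P` of the divisor of a function. -/
def divisor₀ (f : F) : Place K F → ℤ := fun P => if 0 ≤ P.ord f then P.ord f else 0

/-- Linear equivalence: `X - Y` is the divisor of a nonzero function. -/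
def LinEquiv (X Y : CurveDivisor K F) : Prop :=
  ∃ f : F, f ≠ 0 ∧ ⇑(X - Y) = divisor f

/-- `D` is the gcd of the family `X`: the largest divisor that is `≤ X i` for all `i`. -/
def IsGCD {ι : Type*} (X : ι → Place K F → ℤ) (D : CurveDivisor K F) : Prop :=
  IsGreatest {B : CurveDivisor K F | ∀ i, ⇑B ≤ X i} D

/-- The push-forward of a divisor along the automorphism with pullback `φ`. -/
def push (φ : F ≃ₐ[K] F) (X : CurveDivisor K F) : CurveDivisor K F :=
  X.mapDomain (Place.push φ)

end CurveDivisor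

/-! ### Superelliptic curves -/

/-- The data of a superelliptic curve `y ^ n = ∏ (x + α i)` over `K`. -/
structure SuperellipticCurve (K : Type*) [Field K] where
  n : ℕ
  d : ℕ
  two_le_n : 2 ≤ n
  two_le_d : 2 ≤ d
  coprime : Nat.Coprime n d
  natCast_ne_zero : (n : K) ≠ 0
  α : Fin d → K
  α_injective : Function.Injective α

namespace SuperellipticCurve

variable {K : Type*} [Field K] (C : SuperellipticCurve K)

instance : NeZero C.n := ⟨by have := C.two_le_n; omega⟩

/-- The number `(n - 1) (d - 1) / 2`, the genus of the curve (the product is even, since `n` and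
`d` are coprime). -/
def genus : ℕ := (C.n - 1) * (C.d - 1) / 2

/-- The polynomial `∏ (x + α i)`. -/
def rhs : K[X] := ∏ i, (X + Polynomial.C (C.α i))

/-- The polynomial `y ^ n - ∏ (x + α i)` in `K[x, y]`; here `K[x, y]` is `K[X][X]`, with
`x = C X` and `y = X`. -/
def polynomial : K[X][X] := X ^ C.n - Polynomial.C C.rhs

/-- The affine coordinate ring `K[x, y] / (y ^ n - ∏ (x + α i))`. -/
abbrev CoordinateRing : Type _ := AdjoinRoot C.polynomial

theorem polynomial_irreducible : Irreducible C.polynomial := by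
  have hn := C.two_le_n
  have hd := C.two_le_d
  let i₀ : Fin C.d := ⟨0, by omega⟩
  have hdeg : C.polynomial.natDegree = C.n := natDegree_X_pow_sub_C
  have hmonic : C.polynomial.Monic := monic_X_pow_sub_C _ (by omega)
  have hpr : Prime (X + Polynomial.C (C.α i₀)) := by
    have := prime_X_sub_C (-(C.α i₀))
    simpa using this
  have hP : (Ideal.span {X + Polynomial.C (C.α i₀)}).IsPrime :=
    (Ideal.span_singleton_prime hpr.ne_zero).2 hpr
  have hsplit : C.rhs = (X + Polynomial.C (C.α i₀)) *
      ∏ i ∈ Finset.univ.erase i₀, (X + Polynomial.C (C.α i)) :=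
    (Finset.mul_prod_erase _ _ (Finset.mem_univ i₀)).symm
  have hE : C.polynomial.IsEisensteinAt (Ideal.span {X + Polynomial.C (C.α i₀)}) := by
    refine ⟨?_, ?_, ?_⟩
    · rw [hmonic.leadingCoeff]
      exact fun h => hP.ne_top ((Ideal.eq_top_iff_one _).2 h)
    · intro m hm
      rw [hdeg] at hm
      rw [polynomial, coeff_sub, coeff_X_pow, if_neg (by omega), coeff_C]
      split_ifs
      · rw [hsplit, zero_sub, neg_mem_iff]
        exact Ideal.mul_mem_right _ _ (Ideal.mem_span_singleton_self _)
      · simp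
    · rw [polynomial, coeff_sub, coeff_X_pow, if_neg (by omega), coeff_C_zero, zero_sub,
        neg_mem_iff, Ideal.span_singleton_pow, Ideal.mem_span_singleton, hsplit, pow_two]
      intro h
      have h1 := (mul_dvd_mul_iff_left hpr.ne_zero).1 h
      obtain ⟨j, hj, hdvd⟩ := (hpr.dvd_finsetProd_iff _).1 h1
      have h2 : eval (-(C.α i₀)) (X + Polynomial.C (C.α j)) = 0 := by
        apply eval_eq_zero_of_dvd_of_eval_eq_zero hdvd
        simp
      have h3 : C.α j = C.α i₀ := by
        simp at h2
        linear_combination h2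
      exact (Finset.mem_erase.1 hj).1 (C.α_injective h3)
  exact hE.irreducible hP hmonic.isPrimitive (by omega)

instance : IsDomain C.CoordinateRing :=
  AdjoinRoot.isDomain_of_prime C.polynomial_irreducible.prime

/-- The function field `K(𝒞)` of the curve. -/
abbrev FunctionField : Type _ := FractionRing C.CoordinateRing

/-- The points of the smooth projective model `𝒞`. -/
abbrev Point : Type _ := Place K C.FunctionField

/-- Divisors on `𝒞`. -/
abbrev Div : Type _ := CurveDivisor K C.FunctionField

/-- A polynomial in `x, y`, viewed as a rational function on the curve. -/
def toFunctionField : K[X][X] →+* C.FunctionField :=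
  (algebraMap C.CoordinateRing C.FunctionField).comp (AdjoinRoot.mk C.polynomial)

/-- The coordinate function `x`. -/
def x : C.FunctionField := C.toFunctionField (Polynomial.C X)

/-- The coordinate function `y`. -/
def y : C.FunctionField := C.toFunctionField X

variable {C} in
/-- `P` is a point at infinity: the function `x` is not regular at `P`. -/
def IsInfinite (P : C.Point) : Prop := C.x ∉ P.localRing

variable {C} in
/-- `P` is the point `(a, b)`: the functions `x - a` and `y - b` vanish at `P`. -/
def IsAffinePoint (P : C.Point) (a b : K) : Prop :=
  C.x - algebraMap K C.FunctionField a ∈ P.localRing.nonunits ∧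
    C.y - algebraMap K C.FunctionField b ∈ P.localRing.nonunits

theorem scaleHom_aux (c : K) (hc : c ^ C.n = 1) :
    C.polynomial.eval₂ (Algebra.ofId K[X] C.CoordinateRing : K[X] →+* C.CoordinateRing)
      (algebraMap K[X] C.CoordinateRing (Polynomial.C c) * AdjoinRoot.root C.polynomial) = 0 := by
  have h := AdjoinRoot.eval₂_root C.polynomial
  have key : ∀ (S : Type _) [CommRing S] (f : K[X] →+* S) (z : S),
      C.polynomial.eval₂ f z = z ^ C.n - f C.rhs := by
    intro S _ f z
    rw [polynomial, eval₂_sub, eval₂_X_pow, eval₂_C]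
  rw [key] at h ⊢
  rw [mul_pow, ← map_pow, ← Polynomial.C_pow, hc, Polynomial.C_1, map_one, one_mul]
  exact h

/-- The `K[x]`-algebra endomorphism `y ↦ c y` of the coordinate ring, where `c ^ n = 1`. -/
def scaleHom (c : K) (hc : c ^ C.n = 1) : C.CoordinateRing →ₐ[K[X]] C.CoordinateRing :=
  AdjoinRoot.liftAlgHom C.polynomial (Algebra.ofId K[X] C.CoordinateRing)
    (algebraMap K[X] C.CoordinateRing (Polynomial.C c) * AdjoinRoot.root C.polynomial)
    (C.scaleHom_aux c hc)

theorem scaleHom_root (c : K) (hc : c ^ C.n = 1) :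
    C.scaleHom c hc (AdjoinRoot.root C.polynomial) =
      algebraMap K[X] C.CoordinateRing (Polynomial.C c) * AdjoinRoot.root C.polynomial := by
  simp [scaleHom]

theorem scaleHom_comp (c c' : K) (hc : c ^ C.n = 1) (hc' : c' ^ C.n = 1) (h : c * c' = 1) :
    (C.scaleHom c hc).comp (C.scaleHom c' hc') = AlgHom.id _ _ := by
  apply AdjoinRoot.algHom_ext
  rw [AlgHom.comp_apply, scaleHom_root, map_mul, scaleHom_root, AlgHom.commutes, ← mul_assoc,
    ← map_mul, ← Polynomial.C_mul, mul_comm c' c, h, Polynomial.C_1, map_one, one_mul,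
    AlgHom.id_apply]

/-- The `K[x]`-algebra automorphism `y ↦ c y` of the coordinate ring, where `c ^ n = 1`. -/
def scaleEquiv (c : K) (hc : c ^ C.n = 1) : C.CoordinateRing ≃ₐ[K] C.CoordinateRing :=
  have hc' : c⁻¹ ^ C.n = 1 := by rw [inv_pow, hc, inv_one]
  have h0 : c ≠ 0 := by
    rintro rfl
    rw [zero_pow (NeZero.ne _)] at hc
    exact zero_ne_one hc
  (AlgEquiv.ofAlgHom (C.scaleHom c hc) (C.scaleHom c⁻¹ hc')
    (C.scaleHom_comp _ _ _ _ (mul_inv_cancel₀ h0))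
    (C.scaleHom_comp _ _ _ _ (inv_mul_cancel₀ h0))).restrictScalars K

/-- The pullback of functions along the automorphism `(x, y) ↦ (x, ζ y)` of the curve, i.e. the
automorphism of the function field fixing `x` and sending `y` to `ζ y`. -/
def zetaPullback (ζ : K) (hζ : ζ ^ C.n = 1) : C.FunctionField ≃ₐ[K] C.FunctionField :=
  IsFractionRing.fieldEquivOfAlgEquiv K C.FunctionField C.FunctionField (C.scaleEquiv ζ hζ)

variable {C} in
/-- The point `ζ ^ k P` for an integer `k`. -/
def zetaPoint (ζ : K) (hζ : ζ ^ C.n = 1) (k : ℤ) (P : C.Point) : C.Point :=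
  P.push (C.zetaPullback ζ hζ ^ k)

variable {C} in
/-- The divisor `ζ ^ k X` for an integer `k`. -/
def zetaDiv (ζ : K) (hζ : ζ ^ C.n = 1) (k : ℤ) (X : C.Div) : C.Div :=
  CurveDivisor.push (C.zetaPullback ζ hζ ^ k) X

/-! ### The matrices -/

section Matrices

variable (ζ : K) (r : Fin C.d → K)

/-- The elementary symmetric polynomial `s_m` of the `r i`, with `s_m = 0` for `m ∉ [0, d]`. -/
def s (m : ℤ) : K :=
  if 0 ≤ m then ∑ t ∈ Finset.powersetCard m.toNat Finset.univ, ∏ i ∈ t, r i else 0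

/-- `A_ℓ(x) = ∑_{k ≥ 0} (-1) ^ ((n - 1) k) s_{ℓ - n k} x ^ k`; the terms with `k > max ℓ 0`
vanish. -/
def polyA (l : ℤ) : K[X] :=
  ∑ k ∈ Finset.range (l.toNat + 1),
    Polynomial.C ((-1) ^ ((C.n - 1) * k) * C.s r (l - C.n * k)) * X ^ k

/-- The matrix `A`, with entries `A_{d + i - j}`. -/
def matrixA : Matrix (Fin C.n) (Fin C.n) K[X][X] :=
  Matrix.of fun i j => Polynomial.C (C.polyA r ((C.d : ℤ) + (i : ℕ) - (j : ℕ)))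

/-- The diagonal matrix `Z` with entries `ζ ^ 0, ζ ^ (-1), …, ζ ^ (-(n - 1))`. -/
def matrixZ : Matrix (Fin C.n) (Fin C.n) K[X][X] :=
  Matrix.diagonal fun i => Polynomial.C (Polynomial.C (ζ⁻¹ ^ (i : ℕ)))

/-- `M = A - y Z`. -/
def matrixM : Matrix (Fin C.n) (Fin C.n) K[X][X] :=
  C.matrixA r - (X : K[X][X]) • C.matrixZ ζ

/-- `N = adj M`. -/
def matrixN : Matrix (Fin C.n) (Fin C.n) K[X][X] := (C.matrixM ζ r).adjugate

/-- The entries of `N`, viewed as rational functions on the curve (rows and columns are indexed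
from `0`, so the entry `N_{i, j}` of the usual indexing is `entryN (i - 1) (j - 1)`). -/
def entryN (i j : Fin C.n) : C.FunctionField := C.toFunctionField (C.matrixN ζ r i j)

end Matrices

end SuperellipticCurve

end

/-! Let p(t) = ∏ (t + r_i) and let S be the twisted cyclic shift `shift`, for which S^n = (-1)^(n-1)
x. Then A = p(S) (`matrixA_eq`). Since Z⁻¹S = ζ⁻¹SZ⁻¹, the matrix B = Z⁻¹A satisfies B^n = ∏_l
p(ζ^(-l) S) = ∏_i (r_i^n - (-S)^n) = ∏ (x + α_i) (`matrixB_pow_n`). As y^n - ∏ (x + α_i) is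
irreducible, it is the characteristic polynomial of B. So det M is a nonzero constant times the
equation of the curve, and N is a constant times (∑ y^k B^(n-1-k)) Z⁻¹ (`matrixN_eq`). Indices below
start from 0, as in the code.

At infinity, x and y have poles of the coprime orders n and d, so the monomials x^a y^k with k < n
have distinct pole orders. The leading monomial of N_ij has pole order 2g + i + (n-1-j)
(`exists_isLeading_matrixN`).

At a finite point Q, the matrix N has rank one because det M = 0 on the curve, and N(Q) ≠ 0 because
the curve is smooth. Hence v_Q(N_ij) = row_i(Q) + col_j(Q), where both families have minimum 0
(`ord_entryN_eq_add`). As S commutes with polynomials in S, N_(i+1,j+1) at ζQ has the same order as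
N_ij at Q, up to a factor x when an index wraps around. It follows that row_(i+1)(ζQ) = row_i(Q) + ρ
and col_(j+1)(ζQ) + ρ = col_j(Q) with 0 ≤ ρ ≤ v_Q(x). At x = 0 the matrix M is triangular, which
gives ρ = 1 if ζQ = P and ρ = 0 otherwise (`rowOrd_colOrd_succ`); if b = 0 one instead goes once
around the cycle of rows. Iteration from the first row and the last column gives all the divisors.

For the degree, the relation N A = y N Z on the curve shows that the K[x]-span of the first row is
an ideal. Its n generators have pole orders 2g, …, 2g+n-1, so its elements have exactly the integers
≥ 2g as pole orders. Pole orders of polynomial functions form the symmetric semigroup generated by n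
and d, which has g elements below 2g. So the ideal has codimension g, and this is the degree of the
gcd (`exists_divisor_of_generators`). The last column is treated in the same way. Finally, the
quotient of the first two entries of the first column has divisor D - ζD - P + ∞. -/

open Polynomial

noncomputable section

/-! ### Orders at places and the action of automorphisms -/

namespace Place

open WithZero

variable {K F : Type*} [Field K] [Field F] [Algebra K F]

/-- The normalized valuation at a point, `v(f) = exp (-ord f)`. -/
def val (P : Place K F) : Valuation F ℤᵐ⁰ :=
  (IsDiscreteValuationRing.maximalIdeal P.localRing).valuation F

theorem val_eq_exp (P : Place K F) {f : F} (hf : f ≠ 0) : P.val f = exp (-P.ord f) := by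
  rw [ord, neg_neg, exp_log]
  · rfl
  · exact (Valuation.ne_zero_iff _).2 hf

theorem val_le_one_iff (P : Place K F) {f : F} : P.val f ≤ 1 ↔ f ∈ P.localRing := by
  constructor
  · intro h
    obtain ⟨a, rfl⟩ := IsDiscreteValuationRing.exists_lift_of_le_one h
    exact a.2
  · intro h
    exact IsDedekindDomain.HeightOneSpectrum.valuation_le_one
      (IsDiscreteValuationRing.maximalIdeal P.localRing) (⟨f, h⟩ : P.localRing)

theorem val_surjective (P : Place K F) : Function.Surjective P.val :=
  IsDedekindDomain.HeightOneSpectrum.valuation_surjective F _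

theorem ord_mul (P : Place K F) {f g : F} (hf : f ≠ 0) (hg : g ≠ 0) :
    P.ord (f * g) = P.ord f + P.ord g := by
  have h := P.val.map_mul f g
  rw [P.val_eq_exp hf, P.val_eq_exp hg, P.val_eq_exp (mul_ne_zero hf hg), ← exp_add, exp_inj] at h
  omega

@[simp] theorem ord_zero (P : Place K F) : P.ord 0 = 0 := by simp [ord]

@[simp] theorem ord_one (P : Place K F) : P.ord 1 = 0 := by simp [ord]

theorem ord_inv (P : Place K F) (f : F) : P.ord f⁻¹ = -P.ord f := by
  by_cases hf : f = 0
  · simp [hf]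
  have h := P.ord_mul hf (inv_ne_zero hf)
  rw [mul_inv_cancel₀ hf, ord_one] at h
  omega

theorem mem_localRing_iff (P : Place K F) {f : F} (hf : f ≠ 0) : f ∈ P.localRing ↔ 0 ≤ P.ord f := by
  rw [← val_le_one_iff, P.val_eq_exp hf, ← exp_zero, exp_le_exp]
  omega

theorem ord_nonneg (P : Place K F) {f : F} (hf : f ∈ P.localRing) : 0 ≤ P.ord f := by
  by_cases h : f = 0
  · simp [h]
  · exact (P.mem_localRing_iff h).1 hf

theorem val_lt_one_iff (P : Place K F) {f : F} : P.val f < 1 ↔ f ∈ P.localRing.nonunits := by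
  by_cases hf : f = 0
  · simp [hf]
  rw [ValuationSubring.mem_nonunits_iff, ← not_le, ← not_le, not_iff_not]
  have h : P.val f⁻¹ ≤ 1 ↔ f⁻¹ ∈ P.localRing := P.val_le_one_iff
  rw [map_inv₀, inv_le_one₀ (by simpa [zero_lt_iff] using hf)] at h
  rw [h, ← ValuationSubring.valuation_le_one_iff, map_inv₀,
    inv_le_one₀ (by simpa [zero_lt_iff] using hf)]

theorem mem_nonunits_iff_ord (P : Place K F) {f : F} (hf : f ≠ 0) :
    f ∈ P.localRing.nonunits ↔ 0 < P.ord f := by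
  rw [← val_lt_one_iff, P.val_eq_exp hf, ← exp_zero, exp_lt_exp]
  omega

theorem ext_localRing {P Q : Place K F} (h : P.localRing = Q.localRing) : P = Q := by
  cases P; cases Q; cases h; rfl

theorem localRing_ne_top (P : Place K F) : P.localRing ≠ ⊤ := by
  intro h
  obtain ⟨f, hf⟩ := P.val_surjective (exp 1)
  have : f ∈ P.localRing := h ▸ ValuationSubring.mem_top f
  rw [← val_le_one_iff, hf, ← exp_zero, exp_le_exp] at this
  omega

/-- A discrete valuation ring has Krull dimension one, so no valuation ring lies strictly between it
and the field. -/
theorem eq_of_localRing_le {P Q : Place K F} (h : P.localRing ≤ Q.localRing) : P = Q := by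
  have : Ring.KrullDimLE 1 P.localRing :=
    Ring.KrullDimLE.mk₁' (fun _ a _ ↦ IsPrime.to_maximal_ideal a)
  exact ext_localRing (ValuationSubring.eq_of_le_of_ne_top _ h Q.localRing_ne_top)

/-- The valuation ring determines the order relation between values, and surjectivity onto `ℤᵐ⁰`
removes the remaining freedom of scaling. This identifies `val` for places built from another
valuation. -/
theorem val_eq_of_surjective (P : Place K F) (w : Valuation F ℤᵐ⁰) (hw : Function.Surjective w)
    (h : ∀ f, w f ≤ 1 ↔ f ∈ P.localRing) : P.val = w := by
  have h1 : ∀ f, w f ≤ 1 ↔ P.val f ≤ 1 := fun f => (h f).trans P.val_le_one_iff.symm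
  have h2 : ∀ f g, w f ≤ w g ↔ P.val f ≤ P.val g := by
    intro f g
    by_cases hg : g = 0
    · simp [hg]
    have := h1 (f / g)
    rwa [map_div₀, map_div₀, div_le_one₀ (by simpa [zero_lt_iff] using hg),
      div_le_one₀ (by simpa [zero_lt_iff] using hg)] at this
  obtain ⟨p, hp⟩ := P.val_surjective (exp (-1))
  obtain ⟨q, hq⟩ := hw (exp (-1))
  have h3 : ∀ f g, w f < w g ↔ P.val f < P.val g := fun f g => by
    rw [← not_le, ← not_le, h2]
  have hp0 : p ≠ 0 := by rintro rfl; rw [map_zero] at hp; exact exp_ne_zero hp.symm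
  -- The element `q` is a nonunit, so its order at `P` is at least that of the uniformizer `p`;
  -- transferring this inequality to `w` bounds `w p` from below by `exp (-1)`.
  have hwp : w p = exp (-1) := by
    have hwp0 : w p ≠ 0 := (Valuation.ne_zero_iff _).2 hp0
    have a1 : w p < 1 := by
      rw [← map_one w, h3, map_one, hp, ← exp_zero, exp_lt_exp]; omega
    have a2 : P.val q ≤ P.val p := by
      have : P.val q < 1 := by
        rw [← map_one P.val, ← h3, map_one, hq, ← exp_zero, exp_lt_exp]; omega
      by_cases hq0 : q = 0
      · simp [hq0]
      rw [hp, P.val_eq_exp hq0, exp_le_exp]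
      rw [P.val_eq_exp hq0, ← exp_zero, exp_lt_exp] at this
      omega
    rw [← h2, hq] at a2
    rw [← exp_log hwp0] at a1 a2 ⊢
    rw [← exp_zero, exp_lt_exp] at a1
    rw [exp_le_exp] at a2
    congr 1; omega
  ext f
  by_cases hf : f = 0
  · simp [hf]
  have key : P.val (f / p ^ (P.ord f)) = 1 := by
    rw [map_div₀, map_zpow₀, hp, P.val_eq_exp hf, ← exp_zsmul, ← exp_sub]
    simp
  have key2 : w (f / p ^ (P.ord f)) = 1 := by
    apply le_antisymm
    · rw [h1, key]
    · rw [← map_one w, h2, key, map_one]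
  have hpz : w (p ^ (P.ord f)) ≠ 0 := (Valuation.ne_zero_iff _).2 (zpow_ne_zero _ hp0)
  rw [map_div₀, div_eq_one_iff_eq hpz, map_zpow₀, hwp, ← exp_zsmul] at key2
  rw [key2, P.val_eq_exp hf]
  simp

@[simp] theorem mem_push (φ : F ≃ₐ[K] F) (P : Place K F) (f : F) :
    f ∈ (P.push φ).localRing ↔ φ f ∈ P.localRing := Iff.rfl

theorem val_push (φ : F ≃ₐ[K] F) (P : Place K F) (f : F) : (P.push φ).val f = P.val (φ f) := by
  have := (P.push φ).val_eq_of_surjective (P.val.comap (φ : F →+* F)) ?_ ?_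
  · rw [this]; rfl
  · intro t
    obtain ⟨f, hf⟩ := P.val_surjective t
    exact ⟨φ.symm f, by simpa using hf⟩
  · intro f
    rw [mem_push, ← val_le_one_iff]; rfl

theorem ord_eq_log_val (P : Place K F) (f : F) : P.ord f = -log (P.val f) := rfl

theorem ord_push (φ : F ≃ₐ[K] F) (P : Place K F) (f : F) : (P.push φ).ord f = P.ord (φ f) := by
  rw [ord_eq_log_val, val_push, ord_eq_log_val]

theorem push_mul (φ ψ : F ≃ₐ[K] F) (P : Place K F) : P.push (φ * ψ) = (P.push φ).push ψ :=
  ext_localRing (by ext f; simp)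

@[simp] theorem push_one (P : Place K F) : P.push (1 : F ≃ₐ[K] F) = P :=
  ext_localRing (by ext f; simp)

theorem push_injective (φ : F ≃ₐ[K] F) : Function.Injective (Place.push (K := K) φ) := by
  intro P Q h
  have := congrArg (Place.push φ⁻¹) h
  rwa [← push_mul, ← push_mul, mul_inv_cancel, push_one, push_one] at this

theorem val_algebraMap_le_one (P : Place K F) (c : K) : P.val (algebraMap K F c) ≤ 1 :=
  P.val_le_one_iff.2 (P.algebraMap_mem c)

theorem ord_algebraMap (P : Place K F) (c : K) : P.ord (algebraMap K F c) = 0 := by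
  by_cases hc : c = 0
  · simp [hc]
  have h0 : algebraMap K F c ≠ 0 := by simpa using hc
  have h1 := P.ord_nonneg (P.algebraMap_mem c)
  have h2 := P.ord_nonneg (P.algebraMap_mem c⁻¹)
  rw [map_inv₀, ord_inv] at h2
  omega

theorem ord_ge_iff_val_le (P : Place K F) {f : F} (hf : f ≠ 0) (m : ℤ) :
    m ≤ P.ord f ↔ P.val f ≤ exp (-m) := by
  rw [P.val_eq_exp hf, exp_le_exp]; omega

end Place

namespace CurveDivisor

variable {K F : Type*} [Field K] [Field F] [Algebra K F]

theorem push_apply_push (φ : F ≃ₐ[K] F) (X : CurveDivisor K F) (P : Place K F) :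
    push φ X (P.push φ) = X P :=
  Finsupp.mapDomain_apply (Place.push_injective φ) X P

theorem push_apply (φ : F ≃ₐ[K] F) (X : CurveDivisor K F) (P : Place K F) :
    push φ X P = X (P.push φ⁻¹) := by
  conv_lhs => rw [← Place.push_one P, ← inv_mul_cancel φ, Place.push_mul]
  exact push_apply_push φ X _

theorem deg_push (φ : F ≃ₐ[K] F) (X : CurveDivisor K F) : deg (push φ X) = deg X := by
  rw [deg, push, Finsupp.sum_mapDomain_index (by simp) (by simp)]
  rfl

end CurveDivisor

/-! ### The affine curve: normal forms, smoothness and the Dedekind property -/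

namespace SuperellipticCurve

variable {K : Type*} [Field K] (C : SuperellipticCurve K)

theorem natDegree_polynomial : C.polynomial.natDegree = C.n := natDegree_X_pow_sub_C

theorem monic_polynomial : C.polynomial.Monic := monic_X_pow_sub_C _ (NeZero.ne _)

theorem separable_rhs : C.rhs.Separable := by
  have : C.rhs = ∏ i, (X - Polynomial.C (-C.α i)) := by simp [rhs]
  rw [this, separable_prod_X_sub_C_iff]
  exact neg_injective.comp C.α_injective

theorem derivative_rhs_eval_ne_zero {a : K} (h : C.rhs.eval a = 0) :
    C.rhs.derivative.eval a ≠ 0 := by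
  have := C.separable_rhs.eval₂_derivative_ne_zero (RingHom.id K) (x := a) (by simpa [eval₂_id] using h)
  simpa [eval₂_id] using this

theorem toFunctionField_eq (f : K[X][X]) :
    C.toFunctionField f =
      algebraMap C.CoordinateRing C.FunctionField (AdjoinRoot.mk C.polynomial f) := rfl

theorem toFunctionField_eq_zero_iff (f : K[X][X]) : C.toFunctionField f = 0 ↔ C.polynomial ∣ f := by
  rw [toFunctionField_eq, FaithfulSMul.algebraMap_eq_zero_iff, AdjoinRoot.mk_eq_zero]

theorem toFunctionField_ne_zero {f : K[X][X]} (hf : f ≠ 0) (hd : f.natDegree < C.n) :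
    C.toFunctionField f ≠ 0 := by
  rw [Ne, toFunctionField_eq_zero_iff]
  intro h
  have := natDegree_le_of_dvd h hf
  rw [natDegree_polynomial] at this
  omega

theorem toFunctionField_C_C (c : K) :
    C.toFunctionField (Polynomial.C (Polynomial.C c)) = algebraMap K C.FunctionField c := rfl

theorem mk_C_C (c : K) :
    AdjoinRoot.mk C.polynomial (Polynomial.C (Polynomial.C c)) = algebraMap K C.CoordinateRing c := rfl

theorem algebraMap_coordinateRing (c : K) :
    algebraMap C.CoordinateRing C.FunctionField (algebraMap K C.CoordinateRing c) =
      algebraMap K C.FunctionField c := rfl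

theorem y_pow : C.y ^ C.n = C.toFunctionField (Polynomial.C C.rhs) := by
  rw [y, ← map_pow, ← sub_eq_zero, ← map_sub, toFunctionField_eq_zero_iff]
  rfl

theorem toFunctionField_C (p : K[X]) : C.toFunctionField (Polynomial.C p) = aeval C.x p := by
  induction p using Polynomial.induction_on' with
  | add p q hp hq => simp [hp, hq]
  | monomial m a =>
    rw [← C_mul_X_pow_eq_monomial, C_mul, C_pow, map_mul, map_pow, toFunctionField_C_C, map_mul,
      map_pow, aeval_X, aeval_C]
    rfl

theorem toFunctionField_injective_C : Function.Injective fun p : K[X] =>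
    C.toFunctionField (Polynomial.C p) := by
  intro p q h
  by_contra hne
  refine C.toFunctionField_ne_zero (f := Polynomial.C (p - q)) ?_ ?_ ?_
  · simpa [sub_eq_zero] using hne
  · have := C.two_le_n
    rw [natDegree_C]; omega
  · rw [C_sub, map_sub, sub_eq_zero]; exact h

/-- Leading monomials at infinity are only meaningful for representatives of degree less than `n` in
y. -/
theorem exists_mk_eq (r : C.CoordinateRing) :
    ∃ f : K[X][X], f.natDegree < C.n ∧ AdjoinRoot.mk C.polynomial f = r := by
  obtain ⟨g, rfl⟩ := AdjoinRoot.mk_surjective r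
  refine ⟨g %ₘ C.polynomial, ?_, ?_⟩
  · rw [← natDegree_polynomial]
    refine natDegree_modByMonic_lt _ C.monic_polynomial fun h => ?_
    have := C.natDegree_polynomial
    rw [h, natDegree_one] at this
    exact NeZero.ne _ this.symm
  · rw [AdjoinRoot.mk_eq_mk, ← modByMonic_add_div g C.polynomial]
    simp only [modByMonic_add_div]
    rw [show g %ₘ C.polynomial - g = -(C.polynomial * (g /ₘ C.polynomial)) by
      rw [sub_eq_iff_eq_add]; nth_rw 3 [← modByMonic_add_div g C.polynomial]; ring]
    exact (dvd_mul_right _ _).neg_right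

theorem exists_div_eq (f : C.FunctionField) : ∃ p q : K[X][X], p.natDegree < C.n ∧
    q.natDegree < C.n ∧ C.toFunctionField q ≠ 0 ∧ f = C.toFunctionField p / C.toFunctionField q := by
  obtain ⟨a, b, hb, rfl⟩ := IsFractionRing.div_surjective C.CoordinateRing f
  obtain ⟨p, hp, rfl⟩ := C.exists_mk_eq a
  obtain ⟨q, hq, rfl⟩ := C.exists_mk_eq b
  refine ⟨p, q, hp, hq, ?_, rfl⟩
  rw [toFunctionField_eq]
  exact IsFractionRing.to_map_ne_zero_of_mem_nonZeroDivisors hb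

/-! ### Points of the affine curve -/

section AffinePoint

variable (a b : K)

/-- The ideal `(x - a, y - b)` of the coordinate ring. -/
def pointIdeal : Ideal C.CoordinateRing :=
  Ideal.span {AdjoinRoot.mk C.polynomial (Polynomial.C (X - Polynomial.C a)),
    AdjoinRoot.mk C.polynomial (X - Polynomial.C (Polynomial.C b))}

variable {a b} in
/-- Evaluation of polynomial functions at the point `(a, b)` of the curve. -/
def evalPoint (h : b ^ C.n = C.rhs.eval a) : C.CoordinateRing →+* K :=
  AdjoinRoot.lift (evalRingHom a) b (by simp [polynomial, h])

theorem evalPoint_mk (h : b ^ C.n = C.rhs.eval a) (f : K[X][X]) :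
    C.evalPoint h (AdjoinRoot.mk C.polynomial f) = f.evalEval a b := by
  rw [evalPoint, AdjoinRoot.lift_mk, evalEval, eval₂_evalRingHom]

theorem mk_sub_mem_pointIdeal (f : K[X][X]) :
    AdjoinRoot.mk C.polynomial f - algebraMap K _ (f.evalEval a b) ∈ C.pointIdeal a b := by
  obtain ⟨u, hu⟩ := X_sub_C_dvd_sub_C_eval (p := f) (a := Polynomial.C b)
  obtain ⟨v, hv⟩ := X_sub_C_dvd_sub_C_eval (p := f.eval (Polynomial.C b)) (a := a)
  have : f - Polynomial.C (Polynomial.C (f.evalEval a b)) =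
      Polynomial.C v * Polynomial.C (X - Polynomial.C a) +
        u * (X - Polynomial.C (Polynomial.C b)) := by
    rw [← C_mul, mul_comm v, ← hv, mul_comm u, ← hu, C_sub]
    simp [evalEval]
  rw [← mk_C_C, ← map_sub, this, map_add, map_mul, map_mul, pointIdeal, Ideal.mem_span_pair]
  exact ⟨_, _, rfl⟩

theorem ker_evalPoint (h : b ^ C.n = C.rhs.eval a) :
    RingHom.ker (C.evalPoint h) = C.pointIdeal a b := by
  apply le_antisymm
  · intro r hr
    obtain ⟨f, rfl⟩ := AdjoinRoot.mk_surjective r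
    have := C.mk_sub_mem_pointIdeal a b f
    rw [RingHom.mem_ker, evalPoint_mk] at hr
    simpa [hr] using this
  · rw [pointIdeal, Ideal.span_le]
    rintro r (rfl | rfl) <;> rw [SetLike.mem_coe, RingHom.mem_ker, evalPoint_mk] <;>
      simp [evalEval]

theorem evalPoint_surjective (h : b ^ C.n = C.rhs.eval a) :
    Function.Surjective (C.evalPoint h) := fun c =>
  ⟨algebraMap K _ c, by rw [← mk_C_C, evalPoint_mk]; simp [evalEval]⟩

theorem pointIdeal_isMaximal (h : b ^ C.n = C.rhs.eval a) : (C.pointIdeal a b).IsMaximal := by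
  rw [← C.ker_evalPoint a b h]
  exact RingHom.ker_isMaximal_of_surjective _ (C.evalPoint_surjective a b h)

theorem mk_mem_pointIdeal_iff (h : b ^ C.n = C.rhs.eval a) (f : K[X][X]) :
    AdjoinRoot.mk C.polynomial f ∈ C.pointIdeal a b ↔ f.evalEval a b = 0 := by
  rw [← C.ker_evalPoint a b h, RingHom.mem_ker, evalPoint_mk]

/-- The curve is smooth at `(a, b)`: `(y - b) G = (x - a) H` with `G` or `H` nonzero at
`(a, b)`. -/
theorem exists_smooth_relation (h : b ^ C.n = C.rhs.eval a) : ∃ G H : K[X][X],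
    AdjoinRoot.mk C.polynomial ((X - Polynomial.C (Polynomial.C b)) * G) =
      AdjoinRoot.mk C.polynomial (Polynomial.C (X - Polynomial.C a) * H) ∧
    (b ≠ 0 → G.evalEval a b ≠ 0) ∧ (b = 0 → H.evalEval a b ≠ 0) := by
  obtain ⟨v, hv⟩ := X_sub_C_dvd_sub_C_eval (p := C.rhs) (a := a)
  have hv' : C.rhs.derivative.eval a = v.eval a := by
    have := congrArg (fun p => (derivative p).eval a) hv
    simpa using this
  -- Both sides are y^n - b^n = rhs(x) - rhs(a), divided by y - b on one side and by x - a on the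
  -- other. At the point, G equals n b^(n-1) and H equals rhs'(a), which is nonzero at a root of the
  -- separable polynomial rhs.
  refine ⟨∑ i ∈ Finset.range C.n, X ^ i * Polynomial.C (Polynomial.C b) ^ (C.n - 1 - i),
    Polynomial.C v, ?_, ?_, ?_⟩
  · rw [mul_comm (X - _), (Commute.all _ _).geom_sum₂_mul, AdjoinRoot.mk_eq_mk, ← C_mul, ← hv,
      ← C_pow, ← C_pow, h, C_sub]
    rw [sub_sub_sub_cancel_right]
    rfl
  · intro hb
    rw [← coe_evalEvalRingHom, map_sum]
    simp only [map_mul, map_pow, coe_evalEvalRingHom, evalEval_X, evalEval_C, eval_C]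
    rw [Finset.sum_congr rfl (g := fun _ => b ^ (C.n - 1))]
    · rw [Finset.sum_const, Finset.card_range, nsmul_eq_mul]
      exact mul_ne_zero C.natCast_ne_zero (pow_ne_zero _ hb)
    · intro i hi
      rw [← pow_add]
      congr 1
      have := Finset.mem_range.1 hi
      omega
  · rintro rfl
    rw [evalEval_C, ← hv']
    apply C.derivative_rhs_eval_ne_zero
    rw [← h, zero_pow (NeZero.ne _)]

end AffinePoint

instance : IsNoetherianRing C.CoordinateRing := inferInstance

instance : Module.Finite K[X] C.CoordinateRing := C.monic_polynomial.finite_adjoinRoot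

instance : Ring.DimensionLEOne C.CoordinateRing :=
  Ring.DimensionLEOne.of_isIntegral K[X] C.CoordinateRing

/-- In the smooth relation (y - b) G = (x - a) H one of G, H is a unit of the local ring, so one of
the two generators of the maximal ideal divides the other: x - a is a uniformizer if b ≠ 0, and y -
b if b = 0. -/
theorem maximalIdeal_localization_isPrincipal {a b : K} (h : b ^ C.n = C.rhs.eval a)
    [(C.pointIdeal a b).IsPrime] :
    (IsLocalRing.maximalIdeal (Localization.AtPrime (C.pointIdeal a b))).IsPrincipal := by
  set L := Localization.AtPrime (C.pointIdeal a b)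
  let φ : K[X][X] →+* L := (algebraMap C.CoordinateRing L).comp (AdjoinRoot.mk C.polynomial)
  have hunit : ∀ f : K[X][X], f.evalEval a b ≠ 0 → IsUnit (φ f) := fun f hf =>
    IsLocalization.map_units L (⟨AdjoinRoot.mk C.polynomial f, fun hm =>
      hf ((C.mk_mem_pointIdeal_iff a b h f).1 hm)⟩ : (C.pointIdeal a b).primeCompl)
  have hmax : IsLocalRing.maximalIdeal L = Ideal.span {φ (Polynomial.C (X - Polynomial.C a)),
      φ (X - Polynomial.C (Polynomial.C b))} := by
    rw [← Localization.AtPrime.map_eq_maximalIdeal]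
    refine (Ideal.map_span _ _).trans ?_
    rw [Set.image_pair]
    rfl
  obtain ⟨G, H, hGH, hG, hH⟩ := C.exists_smooth_relation a b h
  have hrel : φ (X - Polynomial.C (Polynomial.C b)) * φ G =
      φ (Polynomial.C (X - Polynomial.C a)) * φ H := by
    rw [← map_mul, ← map_mul]
    exact congrArg (algebraMap C.CoordinateRing L) hGH
  rw [hmax]
  by_cases hb : b = 0
  · obtain ⟨u, hu⟩ := hunit H (hH hb)
    refine ⟨⟨φ (X - Polynomial.C (Polynomial.C b)), ?_⟩⟩
    rw [Ideal.submodule_span_eq, Ideal.span_pair_comm]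
    refine le_antisymm ?_ (Ideal.span_mono (by simp))
    rw [Ideal.span_le]
    rintro _ (rfl | rfl)
    · exact Ideal.mem_span_singleton_self _
    · rw [SetLike.mem_coe, Ideal.mem_span_singleton]
      exact ⟨φ G * ↑u⁻¹, by rw [← mul_assoc, hrel, ← hu, Units.mul_inv_cancel_right]⟩
  · obtain ⟨u, hu⟩ := hunit G (hG hb)
    refine ⟨⟨φ (Polynomial.C (X - Polynomial.C a)), ?_⟩⟩
    rw [Ideal.submodule_span_eq]
    refine le_antisymm ?_ (Ideal.span_mono (by simp))
    rw [Ideal.span_le]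
    rintro _ (rfl | rfl)
    · exact Ideal.mem_span_singleton_self _
    · rw [SetLike.mem_coe, Ideal.mem_span_singleton]
      exact ⟨φ H * ↑u⁻¹, by rw [← mul_assoc, ← hrel, ← hu, Units.mul_inv_cancel_right]⟩

section IsAlgClosed

variable [IsAlgClosed K]

/-- Nullstellensatz: the residue field is finite over the algebraically closed field K, hence equal
to K, and the residues of x and y are the coordinates. -/
theorem exists_eq_pointIdeal (Q : Ideal C.CoordinateRing) (hQ : Q.IsMaximal) :
    ∃ a b : K, b ^ C.n = C.rhs.eval a ∧ Q = C.pointIdeal a b := by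
  let _ : Field (C.CoordinateRing ⧸ Q) := Ideal.Quotient.field Q
  have : Algebra.FiniteType K C.CoordinateRing :=
    Algebra.FiniteType.trans (S := K[X]) inferInstance inferInstance
  have : Module.Finite K (C.CoordinateRing ⧸ Q) := finite_of_finite_type_of_isJacobsonRing _ _
  have hbij := IsAlgClosed.algebraMap_bijective_of_isIntegral (k := K) (K := C.CoordinateRing ⧸ Q)
  have hmem : ∀ r : C.CoordinateRing, ∃ c : K, r - algebraMap K _ c ∈ Q := by
    intro r
    obtain ⟨c, hc⟩ := hbij.2 (Ideal.Quotient.mk Q r)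
    exact ⟨c, (Ideal.Quotient.eq).1 hc.symm⟩
  obtain ⟨a, ha⟩ := hmem (AdjoinRoot.mk C.polynomial (Polynomial.C X))
  obtain ⟨b, hb⟩ := hmem (AdjoinRoot.mk C.polynomial X)
  have hle : C.pointIdeal a b ≤ Q := by
    rw [pointIdeal, Ideal.span_le]
    rintro r (rfl | rfl)
    · simpa [← mk_C_C] using ha
    · simpa [← mk_C_C] using hb
  have hab : b ^ C.n = C.rhs.eval a := by
    have h1 := hle (C.mk_sub_mem_pointIdeal a b C.polynomial)
    rw [AdjoinRoot.mk_self, zero_sub, neg_mem_iff, ← Ideal.Quotient.eq_zero_iff_mem] at h1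
    have h2 : algebraMap K (C.CoordinateRing ⧸ Q) (C.polynomial.evalEval a b) = 0 := h1
    rw [map_eq_zero] at h2
    simpa [polynomial, evalEval, sub_eq_zero] using h2
  exact ⟨a, b, hab, ((C.pointIdeal_isMaximal a b hab).eq_of_le hQ.ne_top hle).symm⟩

instance : IsDedekindDomain C.CoordinateRing := by
  have : IsDedekindDomainDvr C.CoordinateRing := by
    refine ⟨fun Q hQ0 hQ => ?_⟩
    obtain ⟨a, b, h, rfl⟩ := C.exists_eq_pointIdeal Q (Ring.DimensionLEOne.maximalOfPrime hQ0 hQ)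
    have hnf : ¬ IsField (Localization.AtPrime (C.pointIdeal a b)) :=
      IsLocalization.AtPrime.not_isField C.CoordinateRing hQ0 _
    exact ((IsDiscreteValuationRing.TFAE _ hnf).out 0 4).2
      (C.maximalIdeal_localization_isPrincipal h)
  infer_instance

end IsAlgClosed

end SuperellipticCurve

/-! ### Places where x is regular are the points of the affine curve -/

namespace SuperellipticCurve

open IsDedekindDomain WithZero

variable {K : Type*} [Field K] {C : SuperellipticCurve K}

theorem x_sub_eq (a : K) : C.x - algebraMap K C.FunctionField a =
    C.toFunctionField (Polynomial.C (X - Polynomial.C a)) := by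
  rw [C_sub, map_sub, toFunctionField_C_C]; rfl

theorem y_sub_eq (b : K) : C.y - algebraMap K C.FunctionField b =
    C.toFunctionField (X - Polynomial.C (Polynomial.C b)) := by
  rw [map_sub, toFunctionField_C_C]; rfl

theorem val_toFunctionField_C_le_one {P : C.Point} (hP : C.x ∈ P.localRing) (p : K[X]) :
    P.val (C.toFunctionField (Polynomial.C p)) ≤ 1 := by
  rw [P.val_le_one_iff, toFunctionField_C, aeval_eq_sum_range]
  refine sum_mem fun i _ => ?_
  rw [Algebra.smul_def]
  exact mul_mem (P.algebraMap_mem _) (pow_mem hP _)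

theorem val_toFunctionField_le_one {P : C.Point} (hP : C.x ∈ P.localRing) (f : K[X][X]) :
    P.val (C.toFunctionField f) ≤ 1 := by
  have hy : P.val C.y ≤ 1 := by
    have : P.val C.y ^ C.n ≤ 1 := by
      rw [← map_pow, y_pow]
      exact val_toFunctionField_C_le_one hP _
    exact (pow_le_one_iff_of_nonneg zero_le (NeZero.ne _)).1 this
  rw [f.as_sum_range_C_mul_X_pow, map_sum]
  refine Valuation.map_sum_le _ fun i _ => ?_
  rw [map_mul, map_mul, map_pow, map_pow]
  exact mul_le_one' (val_toFunctionField_C_le_one hP _) (pow_le_one' hy _)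

theorem IsAffinePoint.x_mem {P : C.Point} {a b : K} (h : IsAffinePoint P a b) :
    C.x ∈ P.localRing := by
  have := P.val_le_one_iff.1 (P.val_lt_one_iff.2 h.1).le
  simpa using add_mem this (P.algebraMap_mem a)

theorem val_coordinateRing_lt_one_of_mem {P : C.Point} {a b : K} (h : IsAffinePoint P a b)
    {r : C.CoordinateRing} (hr : r ∈ C.pointIdeal a b) :
    P.val (algebraMap C.CoordinateRing C.FunctionField r) < 1 := by
  have h1 := P.val_lt_one_iff.2 h.1
  have h2 := P.val_lt_one_iff.2 h.2
  rw [x_sub_eq] at h1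
  rw [y_sub_eq] at h2
  rw [pointIdeal, Ideal.mem_span_pair] at hr
  obtain ⟨u, v, rfl⟩ := hr
  obtain ⟨u, rfl⟩ := AdjoinRoot.mk_surjective u
  obtain ⟨v, rfl⟩ := AdjoinRoot.mk_surjective v
  rw [map_add, map_mul, map_mul]
  refine Valuation.map_add_lt _ ?_ ?_ <;> rw [map_mul]
  · exact mul_lt_of_le_one_of_lt (val_toFunctionField_le_one h.x_mem u) h1
  · exact mul_lt_of_le_one_of_lt (val_toFunctionField_le_one h.x_mem v) h2

theorem val_algebraMap_lt_one_iff (P : C.Point) (c : K) :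
    P.val (algebraMap K C.FunctionField c) < 1 ↔ c = 0 := by
  refine ⟨fun h => ?_, fun h => by simp [h]⟩
  by_contra hc
  have := P.val_eq_exp (f := algebraMap K C.FunctionField c) (by simpa using hc)
  rw [P.ord_algebraMap, neg_zero, exp_zero] at this
  exact h.ne this

theorem IsAffinePoint.val_lt_one_iff {P : C.Point} {a b : K} (h : IsAffinePoint P a b)
    (f : K[X][X]) : P.val (C.toFunctionField f) < 1 ↔ f.evalEval a b = 0 := by
  have h1 : P.val (C.toFunctionField f - algebraMap K C.FunctionField (f.evalEval a b)) < 1 := by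
    have := val_coordinateRing_lt_one_of_mem h (C.mk_sub_mem_pointIdeal a b f)
    rwa [map_sub] at this
  rw [← val_algebraMap_lt_one_iff P]
  constructor
  · intro h2
    have := Valuation.map_sub_lt _ h2 h1
    rwa [sub_sub_cancel] at this
  · intro h2
    have := Valuation.map_add_lt _ h2 h1
    rwa [add_sub_cancel] at this

theorem IsAffinePoint.val_eq_one_iff {P : C.Point} {a b : K} (h : IsAffinePoint P a b)
    (f : K[X][X]) : P.val (C.toFunctionField f) = 1 ↔ f.evalEval a b ≠ 0 := by
  rw [Ne, ← h.val_lt_one_iff, not_lt]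
  exact ⟨fun h => h.ge, (val_toFunctionField_le_one h.x_mem f).antisymm⟩

theorem IsAffinePoint.equation {P : C.Point} {a b : K} (h : IsAffinePoint P a b) :
    b ^ C.n = C.rhs.eval a := by
  have : C.polynomial.evalEval a b = 0 := by
    rw [← h.val_lt_one_iff, (C.toFunctionField_eq_zero_iff _).2 dvd_rfl]
    simp
  simpa [polynomial, evalEval, sub_eq_zero] using this

section IsAlgClosed

variable [IsAlgClosed K]

/-- The point of the smooth projective model given by a nonzero prime of the coordinate ring. -/
def finitePlace (v : HeightOneSpectrum C.CoordinateRing) : C.Point where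
  localRing := (v.valuation C.FunctionField).valuationSubring
  algebraMap_mem c := v.valuation_le_one (K := C.FunctionField) (algebraMap K C.CoordinateRing c)
  isDVR := by
    rw [← v.valuationSubringAtPrime_eq_valuationSubring]
    exact IsLocalization.AtPrime.isDiscreteValuationRing_of_dedekind_domain C.CoordinateRing v.ne_bot _

theorem val_finitePlace (v : HeightOneSpectrum C.CoordinateRing) :
    (finitePlace v).val = v.valuation C.FunctionField :=
  (finitePlace v).val_eq_of_surjective _ (v.valuation_surjective _) fun _ => Iff.rfl

theorem x_mem_finitePlace (v : HeightOneSpectrum C.CoordinateRing) :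
    C.x ∈ (finitePlace v).localRing :=
  v.valuation_le_one (K := C.FunctionField) _

/-- The functions of the coordinate ring that vanish at P form a prime ideal, the centre of P. It is
nonzero, since otherwise every function would be regular at P. The local ring at the centre is
contained in that of P, and both are discrete valuation rings. -/
theorem exists_eq_finitePlace {P : C.Point} (hP : C.x ∈ P.localRing) :
    ∃ v, P = finitePlace v := by
  have hR : ∀ r : C.CoordinateRing, P.val (algebraMap _ C.FunctionField r) ≤ 1 := fun r => by
    obtain ⟨f, rfl⟩ := AdjoinRoot.mk_surjective r
    exact val_toFunctionField_le_one hP f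
  let Q : Ideal C.CoordinateRing :=
    { carrier := {r | P.val (algebraMap _ C.FunctionField r) < 1}
      add_mem' := fun {a b} ha hb => by
        simp only [Set.mem_ofPred_eq, map_add] at *
        exact Valuation.map_add_lt _ ha hb
      zero_mem' := by simp
      smul_mem' := fun c r hr => by
        simp only [Set.mem_ofPred_eq, smul_eq_mul, map_mul] at *
        exact mul_lt_of_le_one_of_lt (hR c) hr }
  have hQ : ∀ r, r ∈ Q ↔ P.val (algebraMap _ C.FunctionField r) < 1 := fun r => Iff.rfl
  have hQ1 : ∀ r, r ∉ Q ↔ P.val (algebraMap _ C.FunctionField r) = 1 := fun r => by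
    rw [hQ, not_lt]
    exact ⟨fun h => le_antisymm (hR r) h, fun h => h.ge⟩
  have hprime : Q.IsPrime := by
    refine ⟨fun h => ?_, fun {r s} hrs => ?_⟩
    · have := (hQ 1).1 (h ▸ Submodule.mem_top)
      simp at this
    · by_contra! h
      rw [hQ1, hQ1] at h
      have : r * s ∉ Q := by rw [hQ1, map_mul, map_mul, h.1, h.2, one_mul]
      exact this hrs
  have hbot : Q ≠ ⊥ := by
    intro h
    apply P.localRing_ne_top
    rw [eq_top_iff]
    intro f _
    obtain ⟨r, s, hs, rfl⟩ := IsFractionRing.div_surjective C.CoordinateRing f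
    have : s ∉ Q := by rw [h]; simpa using nonZeroDivisors.ne_zero hs
    rw [← P.val_le_one_iff, map_div₀, (hQ1 s).1 this, div_one]
    exact hR r
  refine ⟨⟨Q, hprime, hbot⟩, (Place.eq_of_localRing_le ?_).symm⟩
  intro f hf
  obtain ⟨r, s, h⟩ := HeightOneSpectrum.exists_primeCompl_mul_eq_of_integer _ f hf
  rw [← P.val_le_one_iff]
  have hs := (hQ1 s).1 s.2
  have := hR r
  rwa [← h, map_mul, hs, mul_one] at this

theorem isAffinePoint_finitePlace {v : HeightOneSpectrum C.CoordinateRing} {a b : K}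
    (h : C.pointIdeal a b = v.asIdeal) : IsAffinePoint (finitePlace v) a b := by
  have key : ∀ r ∈ C.pointIdeal a b, algebraMap _ C.FunctionField r ∈ (finitePlace v).localRing.nonunits := by
    intro r hr
    rw [← Place.val_lt_one_iff, val_finitePlace, HeightOneSpectrum.valuation_lt_one_iff_mem, ← h]
    exact hr
  constructor
  · rw [x_sub_eq]
    exact key _ (Ideal.subset_span (by simp))
  · rw [y_sub_eq]
    exact key _ (Ideal.subset_span (by simp))

theorem IsAffinePoint.exists_eq {P : C.Point} {a b : K} (h : IsAffinePoint P a b) :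
    ∃ v, C.pointIdeal a b = v.asIdeal ∧ P = finitePlace v := by
  obtain ⟨v, rfl⟩ := exists_eq_finitePlace h.x_mem
  refine ⟨v, ?_, rfl⟩
  refine (C.pointIdeal_isMaximal a b h.equation).eq_of_le v.isPrime.ne_top fun r hr => ?_
  have := val_coordinateRing_lt_one_of_mem h hr
  rwa [val_finitePlace, HeightOneSpectrum.valuation_lt_one_iff_mem] at this

theorem exists_isAffinePoint {P : C.Point} (hP : C.x ∈ P.localRing) :
    ∃ a b, IsAffinePoint P a b := by
  obtain ⟨v, rfl⟩ := exists_eq_finitePlace hP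
  obtain ⟨a, b, -, h⟩ := C.exists_eq_pointIdeal v.asIdeal v.isMaximal
  exact ⟨a, b, isAffinePoint_finitePlace h.symm⟩

theorem IsAffinePoint.unique {P Q : C.Point} {a b : K} (hP : IsAffinePoint P a b)
    (hQ : IsAffinePoint Q a b) : P = Q := by
  obtain ⟨v, hv, rfl⟩ := hP.exists_eq
  obtain ⟨w, hw, rfl⟩ := hQ.exists_eq
  rw [HeightOneSpectrum.ext (hv.symm.trans hw)]

theorem existsUnique_isAffinePoint {a b : K} (h : b ^ C.n = C.rhs.eval a) :
    ∃! P : C.Point, IsAffinePoint P a b := by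
  have hmax := C.pointIdeal_isMaximal a b h
  have hbot : C.pointIdeal a b ≠ ⊥ := by
    intro h0
    have hx : AdjoinRoot.mk C.polynomial (Polynomial.C (X - Polynomial.C a)) ∈ C.pointIdeal a b :=
      Ideal.subset_span (by simp)
    rw [h0, Ideal.mem_bot, AdjoinRoot.mk_eq_zero] at hx
    have := natDegree_le_of_dvd hx (C_ne_zero.2 (X_sub_C_ne_zero a))
    rw [natDegree_polynomial, natDegree_C] at this
    have := C.two_le_n
    omega
  exact ⟨finitePlace ⟨_, hmax.isPrime, hbot⟩, isAffinePoint_finitePlace rfl,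
    fun Q hQ => hQ.unique (isAffinePoint_finitePlace rfl)⟩

/-- A uniformizer can be chosen in the ideal (x - a, y - b), so the two generators cannot both
vanish to order at least 2. -/
theorem IsAffinePoint.exists_val_eq {P : C.Point} {a b : K} (h : IsAffinePoint P a b) :
    P.val (C.x - algebraMap K _ a) = exp (-1) ∨ P.val (C.y - algebraMap K _ b) = exp (-1) := by
  have hx := P.val_lt_one_iff.2 h.1
  have hy := P.val_lt_one_iff.2 h.2
  obtain ⟨v, hv, rfl⟩ := h.exists_eq
  obtain ⟨π, hπ⟩ := v.intValuation_exists_uniformizer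
  have hmem : π ∈ C.pointIdeal a b := by
    rw [hv, ← v.intValuation_lt_one_iff_mem, hπ, ← exp_zero, exp_lt_exp]
    omega
  have hval : (finitePlace v).val (algebraMap _ C.FunctionField π) = exp (-1) := by
    rw [val_finitePlace, HeightOneSpectrum.valuation_of_algebraMap, hπ]
  rw [pointIdeal, Ideal.mem_span_pair] at hmem
  obtain ⟨r, s, rfl⟩ := hmem
  obtain ⟨r, rfl⟩ := AdjoinRoot.mk_surjective r
  obtain ⟨s, rfl⟩ := AdjoinRoot.mk_surjective s
  have hlt : ∀ t : ℤᵐ⁰, t < 1 → t ≠ exp (-1) → t < exp (-1) := by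
    intro t ht hne
    rcases eq_or_ne t 0 with rfl | h0
    · exact exp_pos
    rw [← exp_log h0] at ht hne ⊢
    rw [← exp_zero, exp_lt_exp] at ht
    rw [Ne, exp_inj] at hne
    rw [exp_lt_exp]; omega
  by_contra! hcon
  refine hval.not_lt ?_
  rw [map_add, map_mul, map_mul]
  refine Valuation.map_add_lt _ ?_ ?_ <;> rw [map_mul]
  · refine mul_lt_of_le_one_of_lt (val_toFunctionField_le_one h.x_mem r) ?_
    have := hlt _ hx hcon.1
    rwa [x_sub_eq] at this
  · refine mul_lt_of_le_one_of_lt (val_toFunctionField_le_one h.x_mem s) ?_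
    have := hlt _ hy hcon.2
    rwa [y_sub_eq] at this

/-- The smooth relation decides which generator is the uniformizer: if G is a unit then y - b
vanishes at least as much as x - a, and symmetrically for H. -/
theorem IsAffinePoint.val_relation {P : C.Point} {a b : K} (h : IsAffinePoint P a b) :
    (b ≠ 0 → P.val (C.x - algebraMap K _ a) = exp (-1)) ∧
    (b = 0 → P.val (C.y - algebraMap K _ b) = exp (-1)) := by
  have hx := P.val_lt_one_iff.2 h.1
  have hy := P.val_lt_one_iff.2 h.2
  obtain ⟨G, H, hGH, hG, hH⟩ := C.exists_smooth_relation a b h.equation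
  have hrel := congrArg (fun r => P.val (algebraMap _ C.FunctionField r)) hGH
  simp only [← toFunctionField_eq] at hrel
  rw [map_mul, map_mul, map_mul, map_mul, ← x_sub_eq, ← y_sub_eq] at hrel
  have hlt : ∀ s t : ℤᵐ⁰, s < 1 → s ≤ t → t < 1 → s = exp (-1) → t = exp (-1) := by
    rintro s t hs hst ht rfl
    have h0 : t ≠ 0 := by
      rintro rfl
      exact exp_ne_zero (le_antisymm hst zero_le)
    rw [← exp_log h0] at hst ht ⊢
    rw [← exp_zero, exp_lt_exp] at ht
    rw [exp_le_exp] at hst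
    congr 1; omega
  constructor
  · intro hb
    rw [(h.val_eq_one_iff G).2 (hG hb), mul_one] at hrel
    rcases h.exists_val_eq with h1 | h1
    · exact h1
    · refine hlt _ _ hy ?_ hx h1
      rw [hrel]
      exact mul_le_of_le_one_right' (val_toFunctionField_le_one h.x_mem H)
  · intro hb
    rw [(h.val_eq_one_iff H).2 (hH hb), mul_one] at hrel
    rcases h.exists_val_eq with h1 | h1
    · refine hlt _ _ hx ?_ hy h1
      rw [← hrel]
      exact mul_le_of_le_one_right' (val_toFunctionField_le_one h.x_mem G)
    · exact h1

end IsAlgClosed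

theorem x_ne_zero : C.x ≠ 0 := by
  have := C.toFunctionField_injective_C.ne (a₁ := X) (a₂ := 0) X_ne_zero
  rwa [Polynomial.C_0, map_zero] at this

theorem y_ne_zero : C.y ≠ 0 := by
  have := C.two_le_n
  exact C.toFunctionField_ne_zero X_ne_zero (by rw [natDegree_X]; omega)

theorem ord_x_of_ne_zero [IsAlgClosed K] {P : C.Point} {b : K} (h : IsAffinePoint P 0 b) (hb : b ≠ 0) :
    P.ord C.x = 1 := by
  have := h.val_relation.1 hb
  rw [map_zero, sub_zero, P.val_eq_exp x_ne_zero, exp_inj] at this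
  omega

/-- Here rhs = x v with v a unit at the point, so x v = y^n with y a uniformizer: the map to the
x-line is totally ramified. -/
theorem ord_x_of_eq_zero [IsAlgClosed K] {P : C.Point} (h : IsAffinePoint P 0 0) :
    P.ord C.x = C.n := by
  have h1 := h.val_relation.2 rfl
  rw [map_zero, sub_zero, P.val_eq_exp y_ne_zero, exp_inj] at h1
  have h0 : C.rhs.eval 0 = 0 := by rw [← h.equation, zero_pow (NeZero.ne _)]
  obtain ⟨v, hv⟩ := X_dvd_iff.2 ((coeff_zero_eq_eval_zero _).trans h0)
  have hv0 : v.eval 0 ≠ 0 := by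
    have := C.derivative_rhs_eval_ne_zero h0
    rw [hv] at this
    simpa using this
  have hval : P.val (C.toFunctionField (Polynomial.C v)) = 1 := by
    rw [h.val_eq_one_iff, evalEval_C]
    exact hv0
  have h2 := congrArg P.val C.y_pow
  rw [hv, C_mul, map_mul, map_mul, hval, mul_one, map_pow, P.val_eq_exp y_ne_zero] at h2
  change _ = P.val C.x at h2
  rw [P.val_eq_exp x_ne_zero, ← exp_nsmul, exp_inj, nsmul_eq_mul] at h2
  have h3 : P.ord C.y = 1 := by omega
  rw [h3] at h2
  linarith

end SuperellipticCurve

namespace SuperellipticCurve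

open WithZero

variable {K : Type*} [Field K] {C : SuperellipticCurve K}

/-! ### The point at infinity -/

/-- The weight modulo n determines k, since d is invertible modulo n. So distinct monomials of a
normal form have distinct weights, and leading terms at infinity never cancel. -/
theorem weight_inj {a a' k k' : ℕ} (hk : k < C.n) (hk' : k' < C.n)
    (h : C.n * a + C.d * k = C.n * a' + C.d * k') : a = a' ∧ k = k' := by
  have h1 : C.d * k ≡ C.d * k' [MOD C.n] := by
    have := congrArg (· % C.n) h
    simpa [Nat.ModEq, Nat.add_mod, Nat.mul_mod_right] using this
  have h2 := (Nat.ModEq.cancel_left_of_coprime C.coprime h1).eq_of_lt_of_lt hk hk'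
  subst h2
  refine ⟨?_, rfl⟩
  have : C.n * a = C.n * a' := by omega
  exact Nat.eq_of_mul_eq_mul_left (NeZero.pos _) this

variable (C) in
/-- `x ^ a y ^ k` is the monomial of `f` with the largest weight `n a + d k`. -/
structure IsLeading (f : K[X][X]) (a k : ℕ) : Prop where
  lt : k < C.n
  coeff_ne_zero : (f.coeff k).coeff a ≠ 0
  le : ∀ a' k', (f.coeff k').coeff a' ≠ 0 → C.n * a' + C.d * k' ≤ C.n * a + C.d * k

theorem eq_sum_monomials (f : K[X][X]) (hf : f.natDegree < C.n) : ∃ N : ℕ,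
    (∀ a k, (f.coeff k).coeff a ≠ 0 → (k, a) ∈ Finset.range C.n ×ˢ Finset.range N) ∧
    C.toFunctionField f = ∑ q ∈ Finset.range C.n ×ˢ Finset.range N,
      algebraMap K C.FunctionField ((f.coeff q.1).coeff q.2) * (C.x ^ q.2 * C.y ^ q.1) := by
  have hN : ∀ k, (f.coeff k).natDegree < (f.support.sup fun k => (f.coeff k).natDegree) + 1 := by
    intro k
    by_cases hk : k ∈ f.support
    · exact Nat.lt_succ_of_le (Finset.le_sup (f := fun k => (f.coeff k).natDegree) hk)
    · simp [notMem_support_iff.1 hk]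
  refine ⟨(f.support.sup fun k => (f.coeff k).natDegree) + 1, fun a k h => ?_, ?_⟩
  · rw [Finset.mem_product, Finset.mem_range, Finset.mem_range]
    refine ⟨lt_of_le_of_lt (le_natDegree_of_ne_zero fun h0 => h (by simp [h0])) hf,
      lt_of_le_of_lt (le_natDegree_of_ne_zero h) (hN k)⟩
  · conv_lhs => rw [f.as_sum_range' C.n hf]
    rw [map_sum, Finset.sum_product]
    refine Finset.sum_congr rfl fun k _ => ?_
    rw [← C_mul_X_pow_eq_monomial, map_mul, map_pow, toFunctionField_C]
    conv_lhs => rw [(f.coeff k).as_sum_range' _ (hN k)]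
    rw [map_sum, Finset.sum_mul]
    refine Finset.sum_congr rfl fun a _ => ?_
    rw [aeval_monomial, mul_assoc]
    rfl

theorem exists_isLeading {f : K[X][X]} (h0 : f ≠ 0) (hf : f.natDegree < C.n) :
    ∃ a k, C.IsLeading f a k := by
  classical
  obtain ⟨N, hN, -⟩ := C.eq_sum_monomials f hf
  let S := (Finset.range C.n ×ˢ Finset.range N).filter fun q => (f.coeff q.1).coeff q.2 ≠ 0
  have hS : S.Nonempty := by
    obtain ⟨k, hk⟩ := Polynomial.ext_iff.not.1 h0 |> not_forall.1
    obtain ⟨a, ha⟩ := Polynomial.ext_iff.not.1 hk |> not_forall.1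
    have ha' : (f.coeff k).coeff a ≠ 0 := by simpa using ha
    exact ⟨(k, a), Finset.mem_filter.2 ⟨hN _ _ ha', ha'⟩⟩
  obtain ⟨⟨k, a⟩, hq, hmax⟩ := S.exists_max_image (fun q => C.n * q.2 + C.d * q.1) hS
  rw [Finset.mem_filter, Finset.mem_product, Finset.mem_range] at hq
  exact ⟨a, k, hq.1.1, hq.2, fun a' k' h => hmax (k', a') (Finset.mem_filter.2 ⟨hN _ _ h, h⟩)⟩

section Valuation

variable {Γ : Type*} [LinearOrderedCommGroupWithZero Γ] (w : Valuation C.FunctionField Γ)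
  (hK : ∀ c : K, w (algebraMap K C.FunctionField c) ≤ 1) (hx : 1 < w C.x)

include hK

theorem valuation_algebraMap_eq_one {c : K} (hc : c ≠ 0) :
    w (algebraMap K C.FunctionField c) = 1 := by
  refine le_antisymm (hK c) ?_
  have := hK c⁻¹
  rw [map_inv₀, map_inv₀] at this
  have h0 : 0 < w (algebraMap K C.FunctionField c) := by
    rw [zero_lt_iff, Valuation.ne_zero_iff]; simpa using hc
  exact (inv_le_one₀ h0).1 this

include hx

/-- Each factor x + α_i has the value of x. The value group is left arbitrary because these facts
are also applied to the valuation ring from which the point at infinity is built, before it is known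
to be discrete. -/
theorem valuation_y_pow : w C.y ^ C.n = w C.x ^ C.d := by
  rw [← map_pow, y_pow, toFunctionField_C, rhs, map_prod, map_prod]
  rw [Finset.prod_congr rfl (g := fun _ => w C.x)]
  · simp
  · intro i _
    rw [map_add, aeval_X, aeval_C]
    exact Valuation.map_add_eq_of_lt_left _ ((hK _).trans_lt hx)

theorem valuation_monomial_pow (a k : ℕ) :
    w (C.x ^ a * C.y ^ k) ^ C.n = w C.x ^ (C.n * a + C.d * k) := by
  rw [map_mul, map_pow, map_pow, mul_pow, ← pow_mul, ← pow_mul, mul_comm k, pow_mul (w C.y),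
    C.valuation_y_pow w hK hx, ← pow_mul, ← pow_add, mul_comm a]

theorem IsLeading.valuation_sub_lt {f : K[X][X]} (hf : f.natDegree < C.n) {a k : ℕ}
    (h : C.IsLeading f a k) :
    w (C.toFunctionField f - algebraMap K _ ((f.coeff k).coeff a) * (C.x ^ a * C.y ^ k)) <
      w (C.x ^ a * C.y ^ k) := by
  classical
  obtain ⟨N, hN, hsum⟩ := C.eq_sum_monomials f hf
  rw [hsum, ← Finset.add_sum_erase _ _ (hN _ _ h.coeff_ne_zero), add_sub_cancel_left]
  have hpos : 0 < w (C.x ^ a * C.y ^ k) := by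
    rw [zero_lt_iff, Valuation.ne_zero_iff]
    exact mul_ne_zero (pow_ne_zero _ x_ne_zero) (pow_ne_zero _ y_ne_zero)
  refine Valuation.map_sum_lt' _ hpos ?_
  rintro ⟨k', a'⟩ hq
  rw [Finset.mem_erase, Finset.mem_product, Finset.mem_range] at hq
  by_cases hc : (f.coeff k').coeff a' = 0
  · simpa [hc] using hpos
  · rw [map_mul, C.valuation_algebraMap_eq_one w hK hc, one_mul]
    -- The n-th powers of the values of monomials are powers of `w C.x`, with the weights as
    -- exponents; this avoids dividing values by n.
    refine lt_of_pow_lt_pow_left₀ C.n zero_le ?_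
    rw [valuation_monomial_pow w hK hx, valuation_monomial_pow w hK hx]
    refine pow_lt_pow_right₀ hx (lt_of_le_of_ne (h.le _ _ hc) fun he => hq.1 ?_)
    obtain ⟨rfl, rfl⟩ := C.weight_inj hq.2.1 h.lt he
    rfl

theorem IsLeading.valuation_eq {f : K[X][X]} (hf : f.natDegree < C.n) {a k : ℕ}
    (h : C.IsLeading f a k) : w (C.toFunctionField f) = w (C.x ^ a * C.y ^ k) := by
  have h1 := h.valuation_sub_lt w hK hx hf
  have h2 : w (algebraMap K _ ((f.coeff k).coeff a) * (C.x ^ a * C.y ^ k)) =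
      w (C.x ^ a * C.y ^ k) := by
    rw [map_mul, C.valuation_algebraMap_eq_one w hK h.coeff_ne_zero, one_mul]
  rw [← h2] at h1
  rw [← h2]
  exact Valuation.map_eq_of_sub_lt _ h1

theorem IsLeading.valuation_pow {f : K[X][X]} (hf : f.natDegree < C.n) {a k : ℕ}
    (h : C.IsLeading f a k) : w (C.toFunctionField f) ^ C.n = w C.x ^ (C.n * a + C.d * k) := by
  rw [h.valuation_eq w hK hx hf, valuation_monomial_pow w hK hx]

end Valuation

theorem IsInfinite.one_lt {I : C.Point} (h : IsInfinite I) : 1 < I.val C.x := by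
  rw [← not_le, I.val_le_one_iff]
  exact h

theorem IsLeading.ord_mul {I : C.Point} (hI : IsInfinite I) {f : K[X][X]} (hf : f.natDegree < C.n)
    {a k : ℕ} (h : C.IsLeading f a k) :
    C.n * I.ord (C.toFunctionField f) = (C.n * a + C.d * k : ℕ) * I.ord C.x := by
  have := h.valuation_pow I.val I.val_algebraMap_le_one hI.one_lt hf
  have hf0 : C.toFunctionField f ≠ 0 := by
    refine C.toFunctionField_ne_zero ?_ hf
    rintro rfl
    simpa using h.coeff_ne_zero
  rw [I.val_eq_exp hf0, I.val_eq_exp x_ne_zero, ← exp_nsmul, ← exp_nsmul, exp_inj, nsmul_eq_mul,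
    nsmul_eq_mul] at this
  linarith

theorem isLeading_monomial (a k : ℕ) (hk : k < C.n) :
    C.IsLeading (Polynomial.C (X ^ a) * X ^ k) a k := by
  refine ⟨hk, by rw [coeff_C_mul, coeff_X_pow_self, mul_one, coeff_X_pow_self]; exact one_ne_zero, fun a' k' h => ?_⟩
  rw [coeff_C_mul, coeff_X_pow] at h
  split_ifs at h with hk'
  · rw [mul_one, coeff_X_pow] at h
    split_ifs at h with ha'
    · rw [ha', hk']
    · simp at h
  · simp at h

/-- From n v(y) = d v(x) and coprimality, v(x) = n e. Then e divides the order of every polynomial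
function, hence of every function. As some function has order -1, e is ±1, and the pole of x gives
the sign. -/
theorem IsInfinite.ord_x {I : C.Point} (hI : IsInfinite I) : I.ord C.x = -C.n := by
  have hn := C.two_le_n
  have hneg : I.ord C.x < 0 := by
    by_contra! h
    exact hI ((I.mem_localRing_iff x_ne_zero).2 h)
  have hy : C.n * I.ord C.y = C.d * I.ord C.x := by
    have := (C.isLeading_monomial 0 1 (by omega)).ord_mul hI
      (lt_of_le_of_lt (natDegree_C_mul_X_pow_le _ _) (by omega))
    simpa [y] using this
  obtain ⟨e, he⟩ : (C.n : ℤ) ∣ I.ord C.x :=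
    (Nat.isCoprime_iff_coprime.2 C.coprime).dvd_of_dvd_mul_left ⟨_, hy.symm⟩
  have hn0 : (C.n : ℤ) ≠ 0 := by omega
  have hdvd : ∀ f : K[X][X], f.natDegree < C.n → C.toFunctionField f ≠ 0 →
      e ∣ I.ord (C.toFunctionField f) := by
    intro f hf hf0
    obtain ⟨a, k, h⟩ := C.exists_isLeading (f := f) (by rintro rfl; simp at hf0) hf
    have := h.ord_mul hI hf
    rw [he] at this
    refine ⟨(C.n * a + C.d * k : ℕ), mul_left_cancel₀ hn0 ?_⟩
    rw [this]; ring
  obtain ⟨t, ht⟩ := I.val_surjective (exp 1)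
  have ht0 : t ≠ 0 := by
    rintro rfl
    rw [map_zero] at ht
    exact exp_ne_zero ht.symm
  have h1 : I.ord t = -1 := by
    rw [I.val_eq_exp ht0, exp_inj] at ht
    omega
  have h2 : e ∣ I.ord t := by
    obtain ⟨p, q, hp, hq, hq0, rfl⟩ := C.exists_div_eq t
    have hp0 : C.toFunctionField p ≠ 0 := fun h => ht0 (by rw [h, zero_div])
    rw [div_eq_mul_inv, I.ord_mul hp0 (inv_ne_zero hq0), I.ord_inv]
    exact (hdvd p hp hp0).add (hdvd q hq hq0).neg_right
  rw [h1, Int.dvd_neg] at h2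
  rcases Int.isUnit_iff.1 (isUnit_of_dvd_one h2) with rfl | rfl
  · rw [he] at hneg; omega
  · rw [he]; ring

theorem IsLeading.ord_eq {I : C.Point} (hI : IsInfinite I) {f : K[X][X]} (hf : f.natDegree < C.n)
    {a k : ℕ} (h : C.IsLeading f a k) :
    I.ord (C.toFunctionField f) = -(C.n * a + C.d * k : ℕ) := by
  have := h.ord_mul hI hf
  rw [hI.ord_x] at this
  have hn0 : (C.n : ℤ) ≠ 0 := by have := C.two_le_n; omega
  refine mul_left_cancel₀ hn0 ?_
  rw [this]; ring

/-- The order of a function at a point at infinity depends only on the leading monomials of its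
numerator and denominator. -/
theorem IsInfinite.unique {I J : C.Point} (hI : IsInfinite I) (hJ : IsInfinite J) : I = J := by
  have h1 : ∀ f : K[X][X], f.natDegree < C.n → C.toFunctionField f ≠ 0 →
      I.ord (C.toFunctionField f) = J.ord (C.toFunctionField f) := by
    intro f hf hf0
    obtain ⟨a, k, h⟩ := C.exists_isLeading (f := f) (by rintro rfl; simp at hf0) hf
    rw [h.ord_eq hI hf, h.ord_eq hJ hf]
  apply Place.ext_localRing
  ext t
  by_cases ht : t = 0
  · simp [ht, zero_mem]
  rw [I.mem_localRing_iff ht, J.mem_localRing_iff ht]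
  obtain ⟨p, q, hp, hq, hq0, rfl⟩ := C.exists_div_eq t
  have hp0 : C.toFunctionField p ≠ 0 := fun h => ht (by rw [h, zero_div])
  rw [div_eq_mul_inv, I.ord_mul hp0 (inv_ne_zero hq0), I.ord_inv, J.ord_mul hp0 (inv_ne_zero hq0),
    J.ord_inv, h1 p hp hp0, h1 q hq hq0]

/-- Equal pole orders force equal leading monomials, so subtracting the multiple by the quotient of
the leading coefficients lowers the pole order. -/
theorem exists_val_sub_lt {I : C.Point} (hI : IsInfinite I) {r s : C.CoordinateRing} (hr : r ≠ 0)
    (hs : s ≠ 0) (h : I.ord (algebraMap _ C.FunctionField r) = I.ord (algebraMap _ C.FunctionField s)) :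
    ∃ c : K, I.val (algebraMap _ C.FunctionField (r - algebraMap K _ c * s)) <
      I.val (algebraMap _ C.FunctionField s) := by
  obtain ⟨f, hf, rfl⟩ := C.exists_mk_eq r
  obtain ⟨g, hg, rfl⟩ := C.exists_mk_eq s
  obtain ⟨a, k, hak⟩ := C.exists_isLeading (f := f) (by rintro rfl; simp at hr) hf
  obtain ⟨a', k', hak'⟩ := C.exists_isLeading (f := g) (by rintro rfl; simp at hs) hg
  simp only [← toFunctionField_eq, map_sub, map_mul, algebraMap_coordinateRing] at h ⊢
  rw [hak.ord_eq hI hf, hak'.ord_eq hI hg, neg_inj, Nat.cast_inj] at h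
  obtain ⟨rfl, rfl⟩ := C.weight_inj hak.lt hak'.lt h
  have h1 := hak.valuation_sub_lt I.val I.val_algebraMap_le_one hI.one_lt hf
  have h2 := hak'.valuation_sub_lt I.val I.val_algebraMap_le_one hI.one_lt hg
  rw [hak'.valuation_eq I.val I.val_algebraMap_le_one hI.one_lt hg]
  set cf := (f.coeff k).coeff a
  set cg := (g.coeff k).coeff a
  refine ⟨cf / cg, ?_⟩
  have hcg : algebraMap K C.FunctionField cg ≠ 0 := by simpa using hak'.coeff_ne_zero
  have : C.toFunctionField f - algebraMap K C.FunctionField (cf / cg) * C.toFunctionField g =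
      (C.toFunctionField f - algebraMap K _ cf * (C.x ^ a * C.y ^ k)) -
        algebraMap K C.FunctionField (cf / cg) *
          (C.toFunctionField g - algebraMap K _ cg * (C.x ^ a * C.y ^ k)) := by
    rw [map_div₀]
    field_simp
    ring
  rw [this]
  refine Valuation.map_sub_lt _ h1 ?_
  rw [map_mul]
  exact mul_lt_of_le_one_of_lt (I.val_algebraMap_le_one _) h2

/-! ### Existence of the point at infinity -/

/-- Chevalley's extension theorem for the ideal (1/x) of K[1/x], which is proper because x is
transcendental over K. -/
theorem exists_valuationSubring : ∃ B : ValuationSubring C.FunctionField,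
    (∀ c : K, algebraMap K _ c ∈ B) ∧ C.x ∉ B := by
  let φ : K[X] →ₐ[K] C.FunctionField := aeval C.x⁻¹
  let A : Subring C.FunctionField := φ.toRingHom.range
  let t : A := ⟨C.x⁻¹, X, by simp [φ]⟩
  have htop : Ideal.span {t} ≠ ⊤ := by
    rw [Ne, Ideal.span_singleton_eq_top]
    intro hu
    obtain ⟨⟨_, p, rfl⟩, hp⟩ := hu.exists_right_inv
    have hp' : C.x⁻¹ * aeval C.x⁻¹ p = 1 := congrArg Subtype.val hp
    have h1 : aeval C.x⁻¹ (X * p - 1) = 0 := by simp [hp']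
    have hne : X * p - 1 ≠ 0 := fun h => by
      have := congrArg (eval 0) h
      simp at this
    have halg : IsAlgebraic K C.x⁻¹ := ⟨_, hne, h1⟩
    obtain ⟨q, hq, hq0⟩ := inv_inv C.x ▸ halg.inv
    rw [← toFunctionField_C] at hq0
    exact hq (C.toFunctionField_injective_C (by simpa using hq0))
  obtain ⟨B, hAB, hB⟩ := Ideal.image_subset_nonunits_valuationSubring _ htop
  refine ⟨B, fun c => hAB ⟨Polynomial.C c, by simp [φ]⟩, fun hx => ?_⟩
  have h1 : C.x⁻¹ ∈ B.nonunits := hB ⟨t, Ideal.mem_span_singleton_self _, rfl⟩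
  rw [ValuationSubring.mem_nonunits_iff, map_inv₀] at h1
  have h2 := (B.valuation_le_one_iff _).2 hx
  have h0 : 0 < B.valuation C.x := by rw [zero_lt_iff, Valuation.ne_zero_iff]; exact x_ne_zero
  exact absurd h2 (not_le.2 ((inv_lt_one₀ h0).1 h1))

/-- The valuation ring just obtained is discrete: the value of every function is a power of the
value of one element τ. -/
theorem exists_isInfinite : ∃ I : C.Point, IsInfinite I := by
  obtain ⟨B, hBK, hBx⟩ := C.exists_valuationSubring
  set w := B.valuation
  have hK : ∀ c : K, w (algebraMap K C.FunctionField c) ≤ 1 := fun c =>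
    (B.valuation_le_one_iff _).2 (hBK c)
  have hx : 1 < w C.x := by rwa [← not_le, B.valuation_le_one_iff]
  have hn : C.n ≠ 0 := NeZero.ne _
  obtain ⟨p, q, hpq⟩ : IsCoprime (C.n : ℤ) (C.d : ℤ) := Nat.isCoprime_iff_coprime.2 C.coprime
  -- With p n + q d = 1, the n-th power of the value of τ is the inverse of the value of x, because
  -- y has n-th power value equal to that of x^d.
  set τ : C.FunctionField := C.x ^ (-p) * C.y ^ (-q) with hτ
  have hτ0 : τ ≠ 0 := mul_ne_zero (zpow_ne_zero _ x_ne_zero) (zpow_ne_zero _ y_ne_zero)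
  have hwx0 : w C.x ≠ 0 := (Valuation.ne_zero_iff _).2 x_ne_zero
  have hwτ0 : w τ ≠ 0 := (Valuation.ne_zero_iff _).2 hτ0
  have hwτ : w τ ^ (C.n : ℤ) = (w C.x)⁻¹ := by
    have hy := C.valuation_y_pow w hK hx
    rw [hτ, map_mul, map_zpow₀, map_zpow₀, mul_zpow, ← zpow_mul, ← zpow_mul, mul_comm (-q),
      zpow_mul (w C.y), zpow_natCast, hy, ← zpow_natCast, ← zpow_mul, ← zpow_add₀ hwx0,
      ← zpow_neg_one]
    congr 1
    linear_combination -hpq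
  have hτ1 : w τ < 1 := by
    by_contra! h
    have := one_le_pow₀ h (n := C.n)
    rw [← zpow_natCast, hwτ] at this
    exact absurd (inv_lt_one_of_one_lt₀ hx) (not_lt.2 this)
  have hval : ∀ f : C.FunctionField, f ≠ 0 → ∃ m : ℤ, w f = w τ ^ m := by
    have h1 : ∀ f : K[X][X], f.natDegree < C.n → C.toFunctionField f ≠ 0 →
        ∃ m : ℤ, w (C.toFunctionField f) = w τ ^ m := by
      intro f hf hf0
      obtain ⟨a, k, h⟩ := C.exists_isLeading (f := f) (by rintro rfl; simp at hf0) hf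
      have h2 := h.valuation_pow w hK hx hf
      refine ⟨-(C.n * a + C.d * k : ℕ), (pow_left_inj₀ zero_le zero_le hn).1 ?_⟩
      rw [h2, ← zpow_natCast (w τ ^ _), zpow_comm, hwτ, inv_zpow, zpow_neg, inv_inv,
        zpow_natCast]
    intro f hf
    obtain ⟨p, q, hp, hq, hq0, rfl⟩ := C.exists_div_eq f
    have hp0 : C.toFunctionField p ≠ 0 := fun h => hf (by rw [h, zero_div])
    obtain ⟨i, hi⟩ := h1 p hp hp0
    obtain ⟨j, hj⟩ := h1 q hq hq0
    exact ⟨i - j, by rw [map_div₀, hi, hj, zpow_sub₀ hwτ0]⟩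
  have hnonneg : ∀ m : ℤ, w τ ^ m ≤ 1 → 0 ≤ m := by
    intro m hm
    by_contra! hneg
    have : 1 < w τ ^ m := one_lt_zpow_of_neg₀ (zero_lt_iff.2 hwτ0) hτ1 hneg
    exact absurd hm (not_le.2 this)
  have hunit : ∀ u : B, w u = 1 → IsUnit u := fun u hu => (B.valuation_eq_one_iff u).2 hu
  have hτB : τ ∈ B := (B.valuation_le_one_iff _).1 hτ1.le
  have hdvr : IsDiscreteValuationRing B := by
    apply IsDiscreteValuationRing.ofHasUnitMulPowIrreducibleFactorization
    refine ⟨⟨τ, hτB⟩, ⟨fun hu => ?_, fun u v huv => ?_⟩, fun {u} hu => ?_⟩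
    · exact hτ1.ne ((B.valuation_eq_one_iff _).1 hu)
    · have huv' : τ = u * v := congrArg Subtype.val huv
      have hu0 : (u : C.FunctionField) ≠ 0 := fun h => hτ0 (by rw [huv', h, zero_mul])
      have hv0 : (v : C.FunctionField) ≠ 0 := fun h => hτ0 (by rw [huv', h, mul_zero])
      obtain ⟨i, hi⟩ := hval u hu0
      obtain ⟨j, hj⟩ := hval v hv0
      have hi0 := hnonneg i (hi ▸ B.valuation_le_one u)
      have hj0 := hnonneg j (hj ▸ B.valuation_le_one v)
      have hij : w τ ^ (i + j) = w τ ^ (1 : ℤ) := by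
        rw [zpow_add₀ hwτ0, ← hi, ← hj, ← map_mul, ← huv', zpow_one]
      have hij' : i + j = 1 := zpow_right_injective₀ (zero_lt_iff.2 hwτ0) hτ1.ne hij
      rcases (by omega : i = 0 ∨ j = 0) with rfl | rfl
      · exact Or.inl (hunit u (by rw [hi, zpow_zero]))
      · exact Or.inr (hunit v (by rw [hj, zpow_zero]))
    · have hu0 : (u : C.FunctionField) ≠ 0 := fun h => hu (Subtype.ext h)
      obtain ⟨i, hi⟩ := hval u hu0
      obtain ⟨m, rfl⟩ := Int.eq_ofNat_of_zero_le (hnonneg i (hi ▸ B.valuation_le_one u))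
      have hone : w (u / τ ^ m) = 1 := by
        rw [map_div₀, hi, map_pow, zpow_natCast, div_self (pow_ne_zero _ hwτ0)]
      refine ⟨m, (hunit ⟨u / τ ^ m, (B.valuation_le_one_iff _).1 hone.le⟩ hone).unit, ?_⟩
      refine Subtype.ext ?_
      change τ ^ m * (u / τ ^ m) = u
      field_simp
  exact ⟨⟨B, hBK, hdvr⟩, hBx⟩

end SuperellipticCurve

/-- If `W` is generated by `U` and one more vector then `U` has one more codimension than `W`. -/
theorem Submodule.finrank_quotient_eq_add_one {K V : Type*} [Field K] [AddCommGroup V] [Module K V]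
    {U W : Submodule K V} {c : V} (hW : W = U ⊔ Submodule.span K {c}) (hc : c ∉ U)
    [Module.Finite K (V ⧸ W)] :
    Module.Finite K (V ⧸ U) ∧ Module.finrank K (V ⧸ U) = Module.finrank K (V ⧸ W) + 1 := by
  have hUW : U ≤ W := hW ▸ le_sup_left
  let N : Submodule K (V ⧸ U) := Submodule.span K {U.mkQ c}
  have hN : W.map U.mkQ = N := by
    rw [hW, Submodule.map_sup, Submodule.map_span, Set.image_singleton]
    simp [N]
  have e : ((V ⧸ U) ⧸ N) ≃ₗ[K] V ⧸ W :=
    (Submodule.quotEquivOfEq _ _ hN.symm).trans (Submodule.quotientQuotientEquivQuotient U W hUW)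
  have hfin : Module.Finite K ((V ⧸ U) ⧸ N) := Module.Finite.equiv e.symm
  have hfinN : Module.Finite K N := inferInstance
  have hfinU : Module.Finite K (V ⧸ U) := Module.Finite.of_submodule_quotient N
  refine ⟨hfinU, ?_⟩
  have h1 := N.finrank_quotient_add_finrank
  rw [e.finrank_eq, finrank_span_singleton] at h1
  · exact h1.symm
  · simpa using hc

namespace SuperellipticCurve

open IsDedekindDomain WithZero

variable {K : Type*} [Field K] {C : SuperellipticCurve K}

section IsAlgClosed

variable [IsAlgClosed K]

/-! ### Ideals and divisors -/

theorem finitePlace_injective : Function.Injective (finitePlace (C := C)) := by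
  intro v w h
  apply HeightOneSpectrum.eq_of_valuation_isEquiv_valuation (K := C.FunctionField)
  rw [← val_finitePlace, ← val_finitePlace, h]
  exact Valuation.IsEquiv.refl

/-- No ideal lies strictly between QJ and J, so J = QJ + (c) for any c in J outside QJ. Since
scalars modulo Q reduce to K, the vector c already generates J over QJ as a K-space. -/
theorem finrank_quotient_mul {Q J : Ideal C.CoordinateRing} (hQ : Q.IsMaximal) (hJ : J ≠ ⊥)
    (hfin : Module.Finite K (C.CoordinateRing ⧸ J)) :
    Module.Finite K (C.CoordinateRing ⧸ (Q * J)) ∧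
      Module.finrank K (C.CoordinateRing ⧸ (Q * J)) = Module.finrank K (C.CoordinateRing ⧸ J) + 1 := by
  have hlt : Q * J < J := by
    refine lt_of_le_of_ne Ideal.mul_le_right fun h => hQ.ne_top ?_
    rw [← Ideal.one_eq_top]
    exact mul_right_cancel₀ hJ (h.trans (one_mul J).symm)
  obtain ⟨c, hcJ, hc⟩ := SetLike.exists_of_lt hlt
  have hsup : Q * J ⊔ Ideal.span {c} = J := by
    have hle : Q * J ⊔ Ideal.span {c} ≤ J :=
      sup_le hlt.le ((Ideal.span_singleton_le_iff_mem _).2 hcJ)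
    obtain ⟨H, hH⟩ := Ideal.dvd_iff_le.2 hle
    have hQH : Q ≤ H := by
      rw [← Ideal.dvd_iff_le]
      have : J * H ∣ J * Q := by
        rw [← hH, mul_comm J, Ideal.dvd_iff_le]; exact le_sup_left
      exact (mul_dvd_mul_iff_left hJ).1 this
    rcases (Ideal.isMaximal_def.1 hQ).le_iff.1 hQH with h | h
    · rw [hH, h, Ideal.mul_top]
    · refine absurd ?_ hc
      rw [mul_comm, ← h, ← hH]
      exact Ideal.mem_sup_right (Ideal.mem_span_singleton_self c)
  have key : J.restrictScalars K = (Q * J).restrictScalars K ⊔ Submodule.span K {c} := by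
    apply le_antisymm
    · intro r hr
      rw [Submodule.restrictScalars_mem, ← hsup, Submodule.mem_sup] at hr
      obtain ⟨u, hu, t, ht, rfl⟩ := hr
      obtain ⟨s, rfl⟩ := Ideal.mem_span_singleton'.1 ht
      obtain ⟨a, b, hab, rfl⟩ := C.exists_eq_pointIdeal Q hQ
      obtain ⟨f, rfl⟩ := AdjoinRoot.mk_surjective s
      have := C.mk_sub_mem_pointIdeal a b f
      rw [Submodule.mem_sup]
      refine ⟨u + (AdjoinRoot.mk C.polynomial f - algebraMap K _ (f.evalEval a b)) * c,
        Ideal.add_mem _ hu (Ideal.mul_mem_mul this hcJ), f.evalEval a b • c,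
        Submodule.smul_mem _ _ (Submodule.mem_span_singleton_self _), ?_⟩
      rw [Algebra.smul_def]
      ring
    · rw [sup_le_iff, Submodule.span_singleton_le_iff_mem]
      exact ⟨hlt.le, hcJ⟩
  have e1 := Submodule.Quotient.restrictScalarsEquiv K J
  have e2 := Submodule.Quotient.restrictScalarsEquiv K (Q * J)
  have : Module.Finite K (C.CoordinateRing ⧸ J.restrictScalars K) := Module.Finite.equiv e1.symm
  obtain ⟨h1, h2⟩ := Submodule.finrank_quotient_eq_add_one key hc
  exact ⟨Module.Finite.equiv e2, by rw [← e1.finrank_eq, ← e2.finrank_eq, h2]⟩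

/-- Induction on the prime factorization: each prime factor adds one point to the divisor and one
dimension to the quotient. -/
theorem exists_divisor_of_ideal (J : Ideal C.CoordinateRing) (hJ : J ≠ ⊥) :
    Module.Finite K (C.CoordinateRing ⧸ J) ∧ ∃ D : C.Div, 0 ≤ D ∧
      CurveDivisor.deg D = Module.finrank K (C.CoordinateRing ⧸ J) ∧
      (∀ I : C.Point, IsInfinite I → D I = 0) ∧
      ∀ (v : HeightOneSpectrum C.CoordinateRing) (m : ℕ),
        (m : ℤ) ≤ D (finitePlace v) ↔ J ≤ v.asIdeal ^ m := by
  classical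
  induction J using UniqueFactorizationMonoid.induction_on_prime with
  | h₁ => exact absurd rfl hJ
  | h₂ J hu =>
    obtain rfl := Ideal.isUnit_iff.1 hu
    have : Subsingleton (C.CoordinateRing ⧸ (⊤ : Ideal C.CoordinateRing)) :=
      Ideal.Quotient.subsingleton_iff.2 rfl
    refine ⟨inferInstance, 0, le_rfl, ?_, fun _ _ => rfl, fun v m => ?_⟩
    · rw [Module.finrank_zero_of_subsingleton]; rfl
    · rw [Finsupp.zero_apply, top_le_iff, ← Ideal.one_eq_top]
      constructor
      · intro h
        obtain rfl : m = 0 := by omega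
        exact pow_zero _
      · intro h
        rw [Ideal.one_eq_top, Ideal.pow_eq_top_iff] at h
        rcases h with h | rfl
        · exact absurd h v.isPrime.ne_top
        · simp
  | h₃ J Q hJ0 hQ ih =>
    obtain ⟨hfin, D, hD0, hdeg, hinf, hD⟩ := ih hJ0
    have hQ0 : Q ≠ ⊥ := hQ.ne_zero
    have hQp : Q.IsPrime := Ideal.isPrime_of_prime hQ
    have hQm : Q.IsMaximal := hQp.isMaximal hQ0
    obtain ⟨hfin', hrank⟩ := C.finrank_quotient_mul hQm hJ0 hfin
    let q : HeightOneSpectrum C.CoordinateRing := ⟨Q, hQp, hQ0⟩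
    refine ⟨hfin', D + Finsupp.single (finitePlace q) 1, ?_, ?_, fun I hI => ?_, fun v m => ?_⟩
    · exact add_nonneg hD0 (Finsupp.single_nonneg.2 zero_le_one)
    · rw [hrank, CurveDivisor.deg, Finsupp.sum_add_index' (by simp) (by simp),
        Finsupp.sum_single_index rfl, Nat.cast_add, ← hdeg]
      rfl
    · rw [Finsupp.add_apply, hinf I hI, Finsupp.single_apply, if_neg, zero_add]
      rintro rfl
      exact hI (x_mem_finitePlace _)
    · rw [Finsupp.add_apply, Finsupp.single_apply]
      have hDv : 0 ≤ D (finitePlace v) := hD0 _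
      split_ifs with hqv
      · obtain rfl := finitePlace_injective hqv
        cases m with
        | zero => simp; omega
        | succ m =>
          rw [← Ideal.dvd_iff_le, pow_succ', show q.asIdeal = Q from rfl,
            mul_dvd_mul_iff_left hQ.ne_zero, Ideal.dvd_iff_le, ← hD q m]
          push_cast; omega
      · rw [add_zero, hD v m, ← Ideal.dvd_iff_le, ← Ideal.dvd_iff_le]
        refine ⟨fun h => h.mul_left _, fun h => ?_⟩
        refine (v.prime).pow_dvd_of_dvd_mul_left m (fun hdvd => hqv ?_) h
        congr 1
        apply HeightOneSpectrum.ext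
        exact hQm.eq_of_le v.isPrime.ne_top (Ideal.dvd_iff_le.1 hdvd)

end IsAlgClosed

/-! ### Counting pole orders at infinity -/

variable (C) in
theorem two_mul_genus : 2 * C.genus = (C.n - 1) * (C.d - 1) := by
  rw [genus]
  refine Nat.mul_div_cancel' ?_
  by_contra h
  rw [Nat.prime_two.dvd_mul] at h
  push Not at h
  have h1 := C.coprime
  have h2 := C.two_le_n
  have h3 := C.two_le_d
  have : 2 ∣ Nat.gcd C.n C.d := Nat.dvd_gcd (by omega) (by omega)
  rw [h1] at this
  omega

variable (C) in
/-- `s` is the order of the pole at infinity of some polynomial function. -/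
def IsPoleOrder (s : ℕ) : Prop := ∃ a k, k < C.n ∧ C.n * a + C.d * k = s

/-- The numerical semigroup generated by n and d is symmetric. If both numbers were represented,
adding the representations would give n u + d v = n d with u, v ≥ 1; then n divides v, hence d v ≥ n
d, which is absurd. -/
theorem isPoleOrder_symm {s : ℕ} (hs : s < 2 * C.genus) :
    C.IsPoleOrder s ↔ ¬ C.IsPoleOrder (2 * C.genus - 1 - s) := by
  have hn := C.two_le_n
  have hd := C.two_le_d
  have hg : (2 * C.genus : ℤ) = (C.n - 1) * (C.d - 1) := by
    have := congrArg (Nat.cast (R := ℤ)) C.two_mul_genus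
    rw [Nat.cast_mul, Nat.cast_mul, Nat.cast_sub (by omega), Nat.cast_sub (by omega)] at this
    exact_mod_cast this
  constructor
  · rintro ⟨a, k, hk, h⟩ ⟨a', k', hk', h'⟩
    have hz : (C.n * (a + a' + 1) + C.d * (k + k' + 1) : ℤ) = C.n * C.d := by
      have h1 : ((C.n * a + C.d * k + (C.n * a' + C.d * k') : ℕ) : ℤ) = 2 * C.genus - 1 := by
        rw [h, h']; omega
      rw [hg] at h1
      push_cast at h1
      linarith
    have hdvd : (C.n : ℤ) ∣ C.d * (k + k' + 1) := ⟨C.d - (a + a' + 1), by linarith⟩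
    obtain ⟨t, ht⟩ := (Nat.isCoprime_iff_coprime.2 C.coprime).dvd_of_dvd_mul_left hdvd
    have ht1 : t = 1 := by
      have h1 : 0 < t := by
        by_contra! h0
        nlinarith
      have h2 : t < 2 := by
        by_contra! h0
        nlinarith
      omega
    rw [ht, ht1] at hz
    nlinarith
  · intro h
    by_contra hs'
    -- The only possible exponent of y is the k < n with d k ≡ s modulo n. If d k ≤ s then s is
    -- represented; otherwise d k = s + n t with t ≥ 1, and 2g - 1 - s = n (t - 1) + d (n - 1 - k).
    obtain ⟨k, hk, hmod⟩ : ∃ k < C.n, C.d * k ≡ s [MOD C.n] := by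
      obtain ⟨m, -, hm⟩ := Nat.exists_mul_mod_eq_one_of_coprime C.coprime.symm (by omega)
      refine ⟨(m * s) % C.n, Nat.mod_lt _ (by omega), ?_⟩
      have h1 : C.d * m ≡ 1 [MOD C.n] := by
        rw [Nat.ModEq, hm, Nat.mod_eq_of_lt (by omega)]
      calc C.d * (m * s % C.n) ≡ C.d * (m * s) [MOD C.n] := (Nat.mod_modEq _ _).mul_left _
        _ = (C.d * m) * s := by ring
        _ ≡ 1 * s [MOD C.n] := h1.mul_right _
        _ = s := one_mul s
    rcases le_or_gt (C.d * k) s with hle | hgt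
    · obtain ⟨a, ha⟩ := (Nat.modEq_iff_dvd' hle).1 hmod
      exact hs' ⟨a, k, hk, by omega⟩
    · obtain ⟨t, ht⟩ := (Nat.modEq_iff_dvd' hgt.le).1 hmod.symm
      have ht0 : t ≠ 0 := by rintro rfl; omega
      refine h ⟨t - 1, C.n - 1 - k, by omega, ?_⟩
      zify [show 1 ≤ t by omega, show k ≤ C.n - 1 by omega, show 1 ≤ C.n by omega,
        show s ≤ 2 * C.genus - 1 by omega, show 1 ≤ 2 * C.genus by omega]
      have ht' : (C.d * k - s : ℤ) = C.n * t := by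
        zify [hgt.le] at ht
        exact ht
      rw [hg]
      linarith

variable (C) in
open Classical in
/-- The pole orders at infinity of polynomial functions that are less than `2 g`. -/
def smallPoleOrders : Finset ℕ := (Finset.range (2 * C.genus)).filter C.IsPoleOrder

variable (C) in
theorem card_smallPoleOrders : C.smallPoleOrders.card = C.genus := by
  classical
  have h1 : C.smallPoleOrders.card =
      ((Finset.range (2 * C.genus)).filter fun s => ¬ C.IsPoleOrder s).card := by
    refine Finset.card_nbij' (fun s => 2 * C.genus - 1 - s) (fun s => 2 * C.genus - 1 - s)
      ?_ ?_ ?_ ?_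
    · intro s hs
      simp only [smallPoleOrders, Finset.coe_filter, Finset.mem_range, Set.mem_ofPred_eq] at hs ⊢
      exact ⟨by omega, (isPoleOrder_symm hs.1).1 hs.2⟩
    · intro s hs
      simp only [smallPoleOrders, Finset.coe_filter, Finset.mem_range, Set.mem_ofPred_eq] at hs ⊢
      exact ⟨by omega, not_not.1 fun h => hs.2 ((isPoleOrder_symm hs.1).2 h)⟩
    · intro s hs
      simp only [smallPoleOrders, Finset.coe_filter, Finset.mem_range, Set.mem_ofPred_eq] at hs
      dsimp only; omega
    · intro s hs
      simp only [Finset.coe_filter, Finset.mem_range, Set.mem_ofPred_eq] at hs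
      dsimp only; omega
  have h2 := Finset.card_filter_add_card_filter_not (s := Finset.range (2 * C.genus)) C.IsPoleOrder
  rw [Finset.card_range] at h2
  change C.smallPoleOrders.card + _ = _ at h2
  omega

end SuperellipticCurve

/-! ### Codimension of ideals from pole orders, and gcds of generators -/

namespace SuperellipticCurve

open IsDedekindDomain WithZero

variable {K : Type*} [Field K] {C : SuperellipticCurve K}

theorem algebraMap_functionField_eq_zero_iff (r : C.CoordinateRing) :
    algebraMap C.CoordinateRing C.FunctionField r = 0 ↔ r = 0 :=
  FaithfulSMul.algebraMap_eq_zero_iff _ _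

theorem exists_ord_eq_of_isPoleOrder {I : C.Point} (hI : IsInfinite I) {s : ℕ}
    (hs : C.IsPoleOrder s) : ∃ r : C.CoordinateRing, r ≠ 0 ∧
      I.ord (algebraMap _ C.FunctionField r) = -s := by
  obtain ⟨a, k, hk, rfl⟩ := hs
  have hd : (Polynomial.C (X ^ a) * X ^ k : K[X][X]).natDegree < C.n :=
    lt_of_le_of_lt (natDegree_C_mul_X_pow_le _ _) hk
  refine ⟨AdjoinRoot.mk C.polynomial (Polynomial.C (X ^ a) * X ^ k), fun h => ?_,
    (C.isLeading_monomial a k hk).ord_eq hI hd⟩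
  refine C.toFunctionField_ne_zero ?_ hd (by rw [toFunctionField_eq, h, map_zero])
  exact mul_ne_zero (C_ne_zero.2 (pow_ne_zero _ X_ne_zero)) (pow_ne_zero _ X_ne_zero)

theorem exists_isPoleOrder {I : C.Point} (hI : IsInfinite I) {r : C.CoordinateRing} (hr : r ≠ 0) :
    ∃ s, C.IsPoleOrder s ∧ I.ord (algebraMap _ C.FunctionField r) = -s := by
  obtain ⟨f, hf, rfl⟩ := C.exists_mk_eq r
  obtain ⟨a, k, h⟩ := C.exists_isLeading (f := f) (by rintro rfl; simp at hr) hf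
  exact ⟨_, ⟨a, k, h.lt, rfl⟩, h.ord_eq hI hf⟩

theorem val_eq_exp_of_ord {P : C.Point} {r : C.CoordinateRing} (hr : r ≠ 0) {s : ℤ}
    (h : P.ord (algebraMap _ C.FunctionField r) = -s) :
    P.val (algebraMap _ C.FunctionField r) = exp s := by
  rw [P.val_eq_exp ((C.algebraMap_functionField_eq_zero_iff r).not.2 hr), h, neg_neg]

/-- An ideal whose elements have as pole orders at infinity exactly the integers `≥ 2 g` has
codimension `g`. -/
theorem finrank_quotient_eq_genus {I : C.Point} (hI : IsInfinite I) (J : Ideal C.CoordinateRing)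
    (hge : ∀ r ∈ J, r ≠ 0 → I.ord (algebraMap _ C.FunctionField r) ≤ -(2 * C.genus : ℕ))
    (hex : ∀ s, 2 * C.genus ≤ s → ∃ r ∈ J, r ≠ 0 ∧ I.ord (algebraMap _ C.FunctionField r) = -s) :
    Module.finrank K (C.CoordinateRing ⧸ J) = C.genus := by
  classical
  have hmem : ∀ s : C.smallPoleOrders, s.1 < 2 * C.genus ∧ C.IsPoleOrder s.1 := by
    rintro ⟨s, hs⟩
    simpa [smallPoleOrders] using hs
  choose u hu0 hu using fun s : C.smallPoleOrders => exists_ord_eq_of_isPoleOrder hI (hmem s).2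
  have huv := fun s => val_eq_exp_of_ord (hu0 s) (hu s)
  let π := (Ideal.Quotient.mkₐ K J).toLinearMap
  have hπ : ∀ r, π r = 0 ↔ r ∈ J := fun r => Ideal.Quotient.eq_zero_iff_mem
  -- The terms of a combination have distinct pole orders, so a nontrivial combination has a pole of
  -- order less than 2g and cannot lie in J.
  have hli : LinearIndependent K (π ∘ u) := by
    rw [Fintype.linearIndependent_iff]
    intro c hc
    by_contra! hne
    obtain ⟨i, hi⟩ := hne
    let S := Finset.univ.filter fun s => c s ≠ 0
    obtain ⟨m, hmS, hmax⟩ := S.exists_max_image (fun s => s.1) ⟨i, by simpa [S] using hi⟩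
    have hmc : c m ≠ 0 := by simpa [S] using hmS
    set r := ∑ s, c s • u s with hr
    have hrJ : r ∈ J := by
      rw [← hπ, hr, map_sum, ← hc]
      simp
    have hval : I.val (algebraMap _ C.FunctionField r) = exp (m.1 : ℤ) := by
      have hterm : ∀ s, c s ≠ 0 → I.val (algebraMap _ C.FunctionField (c s • u s)) = exp (s.1 : ℤ) := by
        intro s hs
        rw [Algebra.smul_def, map_mul, algebraMap_coordinateRing, map_mul, huv,
          C.valuation_algebraMap_eq_one I.val I.val_algebraMap_le_one hs, one_mul]
      rw [hr, map_sum, ← hterm m hmc]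
      refine Valuation.map_sum_eq_of_lt _ (Finset.mem_univ m) fun s hs => ?_
      rw [Finset.mem_sdiff, Finset.mem_singleton] at hs
      rw [hterm m hmc]
      by_cases h0 : c s = 0
      · rw [h0, zero_smul, map_zero, map_zero]; exact exp_pos
      · rw [hterm s h0, exp_lt_exp]
        have := hmax s (by simpa [S] using h0)
        have hne : s.1 ≠ m.1 := fun h => hs.2 (Subtype.ext h)
        omega
    have hr0 : r ≠ 0 := by
      intro h0
      rw [h0, map_zero, map_zero] at hval
      exact exp_ne_zero hval.symm
    have h1 := hge r hrJ hr0
    rw [I.val_eq_exp ((C.algebraMap_functionField_eq_zero_iff r).not.2 hr0), exp_inj] at hval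
    have := (hmem m).1
    omega
  -- Induction on the pole order: the leading term is removed by a chosen `u s` if the order is
  -- below 2g, and by an element of J otherwise.
  have hspan : ∀ N : ℕ, ∀ r, I.val (algebraMap _ C.FunctionField r) < exp (N : ℤ) →
      π r ∈ Submodule.span K (Set.range (π ∘ u)) := by
    intro N
    induction N with
    | zero =>
      intro r hr
      by_cases hr0 : r = 0
      · simp [hr0]
      · obtain ⟨s, -, hs⟩ := exists_isPoleOrder hI hr0
        rw [val_eq_exp_of_ord hr0 hs, exp_lt_exp] at hr
        omega
    | succ N ih =>
      intro r hr
      by_cases hlt : I.val (algebraMap _ C.FunctionField r) < exp (N : ℤ)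
      · exact ih r hlt
      have hr0 : r ≠ 0 := by
        rintro rfl
        rw [map_zero, map_zero] at hlt
        exact hlt exp_pos
      obtain ⟨s, hs, hsr⟩ := exists_isPoleOrder hI hr0
      have hsN : s = N := by
        rw [val_eq_exp_of_ord hr0 hsr, exp_lt_exp] at hr hlt
        omega
      subst hsN
      obtain ⟨e, he0, he, heπ⟩ : ∃ e : C.CoordinateRing, e ≠ 0 ∧
          I.ord (algebraMap _ C.FunctionField e) = -s ∧
          π e ∈ Submodule.span K (Set.range (π ∘ u)) := by
        rcases lt_or_ge s (2 * C.genus) with hlt' | hge'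
        · have hsmem : s ∈ C.smallPoleOrders := by simp [smallPoleOrders, hlt', hs]
          exact ⟨u ⟨s, hsmem⟩, hu0 _, hu ⟨s, hsmem⟩, Submodule.subset_span ⟨⟨s, hsmem⟩, rfl⟩⟩
        · obtain ⟨e, heJ, he0, he⟩ := hex s hge'
          refine ⟨e, he0, he, ?_⟩
          rw [(hπ e).2 heJ]
          exact zero_mem _
      obtain ⟨c, hc⟩ := exists_val_sub_lt hI hr0 he0 (hsr.trans he.symm)
      rw [val_eq_exp_of_ord he0 he] at hc
      have h1 := ih _ hc
      have h2 : r = (r - algebraMap K _ c * e) + c • e := by rw [Algebra.smul_def]; ring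
      rw [h2, map_add, map_smul]
      exact add_mem h1 (Submodule.smul_mem _ _ heπ)
  have htop : ⊤ ≤ Submodule.span K (Set.range (π ∘ u)) := by
    intro q _
    obtain ⟨r, rfl⟩ := Ideal.Quotient.mk_surjective q
    by_cases hr0 : r = 0
    · rw [hr0, map_zero]; exact zero_mem _
    obtain ⟨s, -, hs⟩ := exists_isPoleOrder hI hr0
    refine hspan (s + 1) r ?_
    rw [val_eq_exp_of_ord hr0 hs, exp_lt_exp]
    push_cast; omega
  rw [Module.finrank_eq_card_basis (Module.Basis.mk hli htop), Fintype.card_coe,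
    card_smallPoleOrders]

/-- A `K[x]`-submodule of the coordinate ring that is stable under `y` is an ideal. -/
def idealOfSubmodule (W : Submodule K[X] C.CoordinateRing)
    (hW : ∀ r ∈ W, AdjoinRoot.root C.polynomial * r ∈ W) : Ideal C.CoordinateRing where
  carrier := W
  add_mem' := W.add_mem
  zero_mem' := W.zero_mem
  smul_mem' s r hr := by
    obtain ⟨f, rfl⟩ := AdjoinRoot.mk_surjective s
    induction f using Polynomial.induction_on' with
    | add p q hp hq =>
      rw [map_add, add_smul]
      exact W.add_mem hp hq
    | monomial k p =>
      have hpow : ∀ k : ℕ, AdjoinRoot.root C.polynomial ^ k * r ∈ W := by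
        intro k
        induction k with
        | zero => simpa using hr
        | succ k ih => rw [pow_succ', mul_assoc]; exact hW _ ih
      rw [← C_mul_X_pow_eq_monomial, map_mul, map_pow, AdjoinRoot.mk_X, smul_eq_mul, mul_assoc]
      have := W.smul_mem p (hpow k)
      rwa [Algebra.smul_def] at this

theorem ord_toFunctionField_C {I : C.Point} (hI : IsInfinite I) {p : K[X]} (hp : p ≠ 0) :
    I.ord (C.toFunctionField (Polynomial.C p)) = -(C.n * p.natDegree : ℕ) := by
  have hlead : C.IsLeading (Polynomial.C p) p.natDegree 0 := by
    refine ⟨NeZero.pos _, by simpa using hp, fun a k h => ?_⟩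
    rw [coeff_C] at h
    split_ifs at h with hk
    · rw [hk]
      have := le_natDegree_of_ne_zero h
      gcongr
    · simp at h
  rw [hlead.ord_eq hI (by rw [natDegree_C]; exact NeZero.pos _)]
  simp

/-- The greatest common divisor of `n` functions that generate an ideal over `K[x]` and have poles
of orders `2 g, …, 2 g + n - 1` at infinity is of degree `g`. -/
theorem exists_divisor_of_generators [IsAlgClosed K] {I : C.Point} (hI : IsInfinite I)
    (h : Fin C.n → C.CoordinateRing) (τ : Equiv.Perm (Fin C.n)) (hne : ∀ j, h j ≠ 0)
    (hord : ∀ j, I.ord (algebraMap _ C.FunctionField (h j)) = -(2 * C.genus + (τ j : ℕ) : ℕ))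
    (hy : ∀ j, AdjoinRoot.root C.polynomial * h j ∈ Submodule.span K[X] (Set.range h)) :
    ∃ D : C.Div, 0 ≤ D ∧ CurveDivisor.deg D = C.genus ∧ D I = 0 ∧
      ∀ P : C.Point, C.x ∈ P.localRing →
        (∀ j, D P ≤ P.ord (algebraMap _ C.FunctionField (h j))) ∧
          ∃ j, D P = P.ord (algebraMap _ C.FunctionField (h j)) := by
  classical
  let J : Ideal C.CoordinateRing := idealOfSubmodule (Submodule.span K[X] (Set.range h)) (by
    intro r hr
    induction hr using Submodule.span_induction with
    | mem r hr =>
      obtain ⟨j, rfl⟩ := hr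
      exact hy j
    | zero => simp
    | add r s _ _ hr hs => rw [mul_add]; exact add_mem hr hs
    | smul p r _ hr => rw [mul_smul_comm]; exact Submodule.smul_mem _ _ hr)
  have hJ : ∀ r, r ∈ J ↔ ∃ p : Fin C.n → K[X], ∑ j, p j • h j = r := fun r =>
    Submodule.mem_span_range_iff_exists_fun _
  have hhJ : ∀ j, h j ∈ J := fun j => Submodule.subset_span (Set.mem_range_self j)
  have hterm : ∀ (p : K[X]) j, p ≠ 0 → p • h j ≠ 0 ∧
      I.ord (algebraMap _ C.FunctionField (p • h j)) =
        -(2 * C.genus + (C.n * p.natDegree + (τ j : ℕ)) : ℕ) := by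
    intro p j hp
    have hp0 : C.toFunctionField (Polynomial.C p) ≠ 0 := fun h0 =>
      hp (C.toFunctionField_injective_C (by simpa using h0))
    have hj0 := (C.algebraMap_functionField_eq_zero_iff (h j)).not.2 (hne j)
    have hmul : algebraMap _ C.FunctionField (p • h j) =
        C.toFunctionField (Polynomial.C p) * algebraMap _ C.FunctionField (h j) := by
      rw [Algebra.smul_def, map_mul]; rfl
    constructor
    · rw [Ne, ← C.algebraMap_functionField_eq_zero_iff, hmul]
      exact mul_ne_zero hp0 hj0
    · rw [hmul, I.ord_mul hp0 hj0, ord_toFunctionField_C hI hp, hord]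
      push_cast; ring
  have hge : ∀ r ∈ J, r ≠ 0 → I.ord (algebraMap _ C.FunctionField r) ≤ -(2 * C.genus : ℕ) := by
    intro r hr hr0
    obtain ⟨p, rfl⟩ := (hJ r).1 hr
    let S := Finset.univ.filter fun j => p j ≠ 0
    have hS : S.Nonempty := by
      by_contra hS
      rw [Finset.not_nonempty_iff_eq_empty, Finset.filter_eq_empty_iff] at hS
      refine hr0 (Finset.sum_eq_zero fun j _ => ?_)
      rw [not_not.1 (hS (Finset.mem_univ j)), zero_smul]
    obtain ⟨m, hmS, hmax⟩ := S.exists_max_image (fun j => C.n * (p j).natDegree + (τ j : ℕ)) hS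
    have hm : p m ≠ 0 := by simpa [S] using hmS
    have hval : I.val (algebraMap _ C.FunctionField (∑ j, p j • h j)) =
        exp ((2 * C.genus + (C.n * (p m).natDegree + (τ m : ℕ)) : ℕ) : ℤ) := by
      rw [map_sum, ← val_eq_exp_of_ord (hterm _ m hm).1 (hterm _ m hm).2]
      refine Valuation.map_sum_eq_of_lt _ (Finset.mem_univ m) fun j hj => ?_
      rw [Finset.mem_sdiff, Finset.mem_singleton] at hj
      rw [val_eq_exp_of_ord (hterm _ m hm).1 (hterm _ m hm).2]
      by_cases h0 : p j = 0
      · rw [h0, zero_smul, map_zero, map_zero]; exact exp_pos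
      · rw [val_eq_exp_of_ord (hterm _ j h0).1 (hterm _ j h0).2, exp_lt_exp]
        have h1 := hmax j (by simpa [S] using h0)
        -- Multiplication by p(x) changes the pole order by a multiple of n, so pole orders of terms
        -- with different j differ modulo n and no cancellation occurs.
        have h2 : C.n * (p j).natDegree + (τ j : ℕ) ≠ C.n * (p m).natDegree + (τ m : ℕ) := by
          intro he
          have h3 := congrArg (· % C.n) he
          simp only [Nat.mul_add_mod, Nat.mod_eq_of_lt (τ j).2, Nat.mod_eq_of_lt (τ m).2] at h3
          exact hj.2 (τ.injective (Fin.ext h3))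
        omega
    rw [I.val_eq_exp ((C.algebraMap_functionField_eq_zero_iff _).not.2 hr0), exp_inj] at hval
    omega
  -- Divide s - 2g by n: the remainder selects the generator and the quotient is the exponent of x.
  have hex : ∀ s, 2 * C.genus ≤ s → ∃ r ∈ J, r ≠ 0 ∧
      I.ord (algebraMap _ C.FunctionField r) = -s := by
    intro s hs
    let j := τ.symm ⟨(s - 2 * C.genus) % C.n, Nat.mod_lt _ (NeZero.pos _)⟩
    have hX : (X ^ ((s - 2 * C.genus) / C.n) : K[X]) ≠ 0 := pow_ne_zero _ X_ne_zero
    refine ⟨_, (hJ _).2 ⟨Pi.single j (X ^ ((s - 2 * C.genus) / C.n)), ?_⟩, (hterm _ j hX).1, ?_⟩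
    · rw [Finset.sum_eq_single j (fun i _ hi => by rw [Pi.single_eq_of_ne hi, zero_smul])
        (fun h0 => absurd (Finset.mem_univ j) h0), Pi.single_eq_same]
    rw [(hterm _ j hX).2, natDegree_X_pow, show τ j = _ from τ.apply_symm_apply _,
      Nat.div_add_mod]
    congr 2
    omega
  have hJ0 : J ≠ ⊥ := fun h0 => by
    have := hhJ 0
    rw [h0] at this
    exact hne 0 this
  obtain ⟨-, D, hD0, hdeg, hinf, hD⟩ := C.exists_divisor_of_ideal J hJ0
  refine ⟨D, hD0, by rw [hdeg, finrank_quotient_eq_genus hI J hge hex], hinf I hI, ?_⟩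
  intro P hP
  obtain ⟨v, rfl⟩ := exists_eq_finitePlace hP
  -- Membership of J in a power of v can be tested on the generators, so the multiplicity of D at v
  -- is the minimum of their orders.
  have hiff : ∀ m : ℕ, (m : ℤ) ≤ D (finitePlace v) ↔
      ∀ j, (m : ℤ) ≤ (finitePlace v).ord (algebraMap _ C.FunctionField (h j)) := by
    intro m
    have hj : ∀ j, (m : ℤ) ≤ (finitePlace v).ord (algebraMap _ C.FunctionField (h j)) ↔
        h j ∈ v.asIdeal ^ m := by
      intro j
      rw [Place.ord_ge_iff_val_le _ ((C.algebraMap_functionField_eq_zero_iff _).not.2 (hne j)),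
        val_finitePlace, HeightOneSpectrum.valuation_of_algebraMap, v.intValuation_le_pow_iff_mem]
    simp only [hj, hD v m]
    refine ⟨fun hle j => hle (hhJ j), fun hle r hr => ?_⟩
    obtain ⟨p, rfl⟩ := (hJ r).1 hr
    refine sum_mem fun j _ => ?_
    rw [Algebra.smul_def]
    exact Ideal.mul_mem_left _ _ (hle j)
  obtain ⟨m, hm⟩ := Int.eq_ofNat_of_zero_le (hD0 (finitePlace v))
  have hle := (hiff m).1 hm.ge
  refine ⟨fun j => hm.trans_le (hle j), ?_⟩
  by_contra! hcon
  have : ((m + 1 : ℕ) : ℤ) ≤ D (finitePlace v) := (hiff (m + 1)).2 fun j => by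
    have := hle j
    have := hcon j
    push_cast
    omega
  push_cast at this
  omega

end SuperellipticCurve

/-! ### Singular matrices over a polynomial ring -/

namespace Matrix

theorem eq_of_mul_eq_mul_of_det_ne_zero {R m : Type*} [CommRing R] [IsDomain R] [Fintype m]
    [DecidableEq m] {M U V : Matrix m m R} (hM : M.det ≠ 0) (h : M * U = M * V) : U = V := by
  have h1 := congrArg (M.adjugate * ·) h
  simp only [← Matrix.mul_assoc, adjugate_mul, smul_mul, Matrix.one_mul] at h1
  ext i j
  exact mul_left_cancel₀ hM (congrFun (congrFun h1 i) j)

/-- If `M * N = G • 1`, `N` vanishes at `t` and `M` is singular at `t` then `G` vanishes to second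
order at `t`. -/
theorem derivative_eval_eq_zero_of_mul_eq_smul_one {K m : Type*} [Field K] [Fintype m]
    [DecidableEq m] {M N : Matrix m m K[X]} {G : K[X]} {t : K} (h : M * N = G • 1)
    (hM : eval t M.det = 0) (hN : ∀ i j, eval t (N i j) = 0) : eval t (derivative G) = 0 := by
  have hdet : (M.map (eval t)).det = 0 := by
    rw [← coe_evalRingHom, ← RingHom.mapMatrix_apply, ← RingHom.map_det]
    exact hM
  -- Take a left null vector v of M(t). Then w = v M vanishes at t, as does N, while w N = G v; by
  -- the product rule the derivative of v_i G vanishes at t.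
  obtain ⟨v, hv0, hv⟩ := exists_vecMul_eq_zero_iff.2 hdet
  obtain ⟨i, hi⟩ := Function.ne_iff.1 hv0
  let w : m → K[X] := fun l => ∑ k, Polynomial.C (v k) * M k l
  have hw : ∀ l, eval t (w l) = 0 := fun l => by
    have := congrFun hv l
    simpa [w, eval_finsetSum, Matrix.vecMul, dotProduct] using this
  have hsum : ∑ l, w l * N l i = Polynomial.C (v i) * G := by
    have h1 : ∀ k, ∑ l, M k l * N l i = if k = i then G else 0 := fun k => by
      rw [← Matrix.mul_apply, h, smul_apply, one_apply, smul_eq_mul, mul_ite, mul_one, mul_zero]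
    simp only [w, Finset.sum_mul]
    rw [Finset.sum_comm]
    simp only [mul_assoc, ← Finset.mul_sum, h1, mul_ite, mul_zero]
    simp
  have h2 := congrArg (fun q => eval t (derivative q)) hsum
  simp only [derivative_sum, eval_finsetSum, derivative_mul, eval_add, eval_mul, hw, hN,
    derivative_C, eval_C, zero_mul, mul_zero, add_zero, zero_add,
    Finset.sum_const_zero] at h2
  exact (mul_eq_zero.1 h2.symm).resolve_left hi

end Matrix

namespace SuperellipticCurve

variable {K : Type*} [Field K] (C : SuperellipticCurve K)

/-! ### The twisted cyclic shift -/

/-- The twisted shift matrix `T`, with `T ^ n = (-1) ^ (n - 1) x`. -/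
def shift : Matrix (Fin C.n) (Fin C.n) K[X] := Matrix.of fun i j =>
  if (j : ℕ) = i + 1 then 1 else
    if (j : ℕ) = 0 ∧ (i : ℕ) + 1 = C.n then Polynomial.C ((-1) ^ (C.n - 1)) * X else 0

variable {C}

theorem shift_apply_of_eq {i j : Fin C.n} (h : (j : ℕ) = i + 1) : C.shift i j = 1 := by
  simp [shift, h]

theorem shift_apply_corner {i j : Fin C.n} (hj : (j : ℕ) = 0) (hi : (i : ℕ) + 1 = C.n) :
    C.shift i j = Polynomial.C ((-1) ^ (C.n - 1)) * X := by
  rw [shift, Matrix.of_apply, if_neg (by omega), if_pos ⟨hj, hi⟩]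

theorem shift_apply_of_ne {i j : Fin C.n} (h : (j : ℕ) ≠ i + 1)
    (h' : ¬ ((j : ℕ) = 0 ∧ (i : ℕ) + 1 = C.n)) : C.shift i j = 0 := by
  simp only [shift, Matrix.of_apply, if_neg h, if_neg h']

section MulShift

variable {S : Type*} [CommRing S] (φ : K[X] →+* S) (G : Matrix (Fin C.n) (Fin C.n) S)

theorem mul_shift_apply_succ (i : Fin C.n) {j j' : Fin C.n} (h : (j : ℕ) = j' + 1) :
    (G * C.shift.map φ) i j = G i j' := by
  rw [Matrix.mul_apply, Finset.sum_eq_single j']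
  · rw [Matrix.map_apply, shift_apply_of_eq h, map_one, mul_one]
  · intro k _ hk
    rw [Matrix.map_apply, shift_apply_of_ne, map_zero, mul_zero]
    · intro h1; exact hk (Fin.ext (by omega))
    · omega
  · simp

theorem mul_shift_apply_zero (i : Fin C.n) {j j' : Fin C.n} (h : (j : ℕ) = 0)
    (h' : (j' : ℕ) + 1 = C.n) :
    (G * C.shift.map φ) i j = G i j' * φ (Polynomial.C ((-1) ^ (C.n - 1)) * X) := by
  rw [Matrix.mul_apply, Finset.sum_eq_single j']
  · rw [Matrix.map_apply, shift_apply_corner h h']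
  · intro k _ hk
    rw [Matrix.map_apply, shift_apply_of_ne, map_zero, mul_zero]
    · omega
    · intro h1; exact hk (Fin.ext (by omega))
  · simp

theorem shift_mul_apply_succ {i i' : Fin C.n} (j : Fin C.n) (h : (i' : ℕ) = i + 1) :
    (C.shift.map φ * G) i j = G i' j := by
  rw [Matrix.mul_apply, Finset.sum_eq_single i']
  · rw [Matrix.map_apply, shift_apply_of_eq h, map_one, one_mul]
  · intro k _ hk
    rw [Matrix.map_apply, shift_apply_of_ne, map_zero, zero_mul]
    · intro h1; exact hk (Fin.ext (by omega))
    · omega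
  · simp

theorem shift_mul_apply_last {i i' : Fin C.n} (j : Fin C.n) (h : (i : ℕ) + 1 = C.n)
    (h' : (i' : ℕ) = 0) :
    (C.shift.map φ * G) i j = φ (Polynomial.C ((-1) ^ (C.n - 1)) * X) * G i' j := by
  rw [Matrix.mul_apply, Finset.sum_eq_single i']
  · rw [Matrix.map_apply, shift_apply_corner h' h]
  · intro k _ hk
    rw [Matrix.map_apply, shift_apply_of_ne, map_zero, zero_mul]
    · omega
    · intro h1; exact hk (Fin.ext (by omega))
  · simp

end MulShift

/-- The entry (i, j) of q(S) collects the coefficients of q whose index is congruent to j - i modulo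
n, and each passage through the corner contributes (-1)^(n-1) x. The condition i ≤ n e + j guards
the truncated subtraction. Induction by multiplication by S. -/
theorem coeff_aeval_shift (q : K[X]) (i j : Fin C.n) (e : ℕ) :
    ((aeval C.shift q) i j).coeff e =
      if (i : ℕ) ≤ C.n * e + j then ((-1) ^ (C.n - 1)) ^ e * q.coeff (C.n * e + j - i) else 0 := by
  induction q using Polynomial.induction_on generalizing i j e with
  | C a =>
    rw [aeval_C, Algebra.algebraMap_eq_smul_one, Matrix.smul_apply, Matrix.one_apply, coeff_smul,
      coeff_C]
    by_cases hij : i = j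
    · subst hij
      rw [if_pos rfl, if_pos (Nat.le_add_left (i : ℕ) _), add_tsub_cancel_right, coeff_one]
      by_cases he : e = 0
      · simp [he]
      · rw [if_neg he, if_neg (mul_ne_zero (NeZero.ne _) he)]
        simp
    · rw [if_neg hij, coeff_zero, smul_zero]
      split_ifs with h1 h2
      · exfalso
        rcases Nat.eq_zero_or_pos e with rfl | he
        · exact hij (Fin.ext (by omega))
        · have : C.n * 1 ≤ C.n * e := Nat.mul_le_mul_left _ he
          omega
      · simp
      · rfl
  | add p q hp hq =>
    rw [map_add, Matrix.add_apply, coeff_add, hp, hq, coeff_add]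
    split_ifs <;> ring
  | monomial m a ih =>
    have hn := C.two_le_n
    rw [pow_succ, ← mul_assoc, map_mul (aeval _) _ X, aeval_X]
    set q := Polynomial.C a * X ^ m
    have hid : C.shift = C.shift.map (RingHom.id K[X]) := by ext1; rfl
    rcases Nat.eq_zero_or_pos (j : ℕ) with hj | hj
    · have h1 := mul_shift_apply_zero (RingHom.id K[X]) (aeval C.shift q) i (j := j)
        (j' := ⟨C.n - 1, by omega⟩) hj (by simp; omega)
      rw [← hid, RingHom.id_apply, mul_comm, mul_assoc] at h1
      rw [h1, coeff_C_mul]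
      cases e with
      | zero =>
        rw [mul_comm X, coeff_mul_X_zero, mul_zero]
        split_ifs with h2
        · rw [show C.n * 0 + (j : ℕ) - i = 0 by omega, coeff_mul_X_zero, mul_zero]
        · rfl
      | succ e =>
        rw [mul_comm X, coeff_mul_X, ih, if_pos (by dsimp only; omega),
          if_pos (by rw [mul_add]; omega),
          show C.n * (e + 1) + (j : ℕ) - i = (C.n * e + (C.n - 1) - i) + 1 by rw [mul_add]; omega,
          coeff_mul_X, pow_succ']
        ring
    · have h1 := mul_shift_apply_succ (RingHom.id K[X]) (aeval C.shift q) i (j := j)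
        (j' := ⟨j - 1, by omega⟩) (by dsimp only; omega)
      rw [← hid] at h1
      rw [h1, ih]
      dsimp only
      by_cases h2 : (i : ℕ) ≤ C.n * e + (j - 1)
      · rw [if_pos h2, if_pos (by omega),
          show C.n * e + (j : ℕ) - i = (C.n * e + (j - 1) - i) + 1 by omega, coeff_mul_X]
      · rw [if_neg h2]
        split_ifs
        · rw [show C.n * e + (j : ℕ) - i = 0 by omega, coeff_mul_X_zero, mul_zero]
        · rfl

theorem shift_pow : C.shift ^ C.n = (Polynomial.C ((-1) ^ (C.n - 1)) * X : K[X]) • 1 := by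
  have hn := C.two_le_n
  ext i j e
  have h := coeff_aeval_shift (X ^ C.n) i j e
  rw [map_pow, aeval_X] at h
  rw [h, Matrix.smul_apply, Matrix.one_apply, coeff_X_pow, smul_eq_mul, mul_ite, mul_one, mul_zero,
    mul_ite, mul_one, mul_zero, apply_ite (fun q : K[X] => q.coeff e), coeff_C_mul, coeff_X, coeff_zero]
  rcases e with _ | _ | e
  · rw [if_neg (show ¬ C.n * 0 + (j : ℕ) - i = C.n by omega)]
    simp
  · by_cases hij : i = j
    · subst hij
      simp
    · rw [if_neg hij, if_pos (by omega), if_neg]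
      intro h1
      exact hij (Fin.ext (by omega))
  · have h1 : C.n * (e + 1 + 1) = C.n * e + C.n + C.n := by ring
    rw [if_neg (show ¬ C.n * (e + 1 + 1) + (j : ℕ) - i = C.n by omega)]
    simp

/-! ### The matrix `A` as a polynomial in the shift -/

section Matrices

variable (C) (ζ : K) (r : Fin C.d → K)

/-- The polynomial `∏ (t + r i)`. -/
def rootPoly : K[X] := ∏ i, (X + Polynomial.C (r i))

theorem monic_rootPoly : (C.rootPoly r).Monic := monic_prod_of_monic _ _ fun _ _ => monic_X_add_C _

theorem natDegree_rootPoly : (C.rootPoly r).natDegree = C.d := by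
  rw [rootPoly, natDegree_prod_of_monic _ _ fun _ _ => monic_X_add_C _]
  simp

theorem coeff_rootPoly (m : ℕ) : (C.rootPoly r).coeff m = C.s r (C.d - m) := by
  rcases le_or_gt m C.d with h | h
  · rw [rootPoly, Finset.prod_X_add_C_coeff _ _ (by simpa using h), s, if_pos (by omega)]
    rw [Finset.card_univ, Fintype.card_fin, show ((C.d : ℤ) - m).toNat = C.d - m by omega]
  · rw [coeff_eq_zero_of_natDegree_lt (by rwa [natDegree_rootPoly]), s, if_neg (by omega)]

theorem s_eq_zero {m : ℤ} (h : C.d < m) : C.s r m = 0 := by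
  rw [s]
  split_ifs
  · rw [Finset.powersetCard_eq_empty.2 (by simp; omega), Finset.sum_empty]
  · rfl

theorem coeff_polyA (l : ℤ) (e : ℕ) :
    (C.polyA r l).coeff e = ((-1) ^ (C.n - 1)) ^ e * C.s r (l - C.n * e) := by
  rw [polyA, finsetSum_coeff]
  simp only [coeff_C_mul, coeff_X_pow, mul_ite, mul_one, mul_zero]
  rw [Finset.sum_ite_eq (Finset.range (l.toNat + 1))]
  split_ifs with h
  · rw [pow_mul]
  · rw [Finset.mem_range, not_lt] at h
    have hn := C.two_le_n
    have : (1 * e : ℤ) ≤ C.n * e := by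
      apply mul_le_mul_of_nonneg_right <;> omega
    rw [s, if_neg (by omega), mul_zero]

theorem matrixA_eq : C.matrixA r = (aeval C.shift (C.rootPoly r)).map Polynomial.C := by
  ext1 i j
  rw [matrixA, Matrix.of_apply, Matrix.map_apply]
  congr 1
  ext e
  rw [coeff_polyA, coeff_aeval_shift]
  split_ifs with h
  · rw [coeff_rootPoly]
    congr 2
    push_cast [Nat.cast_sub h]
    ring
  -- When n e + j < i, the index d + i - j - n e exceeds d, so the symmetric polynomial is 0 by
  -- convention.
  · rw [s_eq_zero, mul_zero]
    have : (C.n * e : ℤ) + j < i := by exact_mod_cast not_le.1 h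
    omega

end Matrices

end SuperellipticCurve

/-! ### The matrix B = Z⁻¹ A and its characteristic polynomial -/

namespace SuperellipticCurve

variable {K : Type*} [Field K] (C : SuperellipticCurve K)

section Matrices

variable (ζ : K) (r : Fin C.d → K)

/-- The inverse of the matrix `Z`, over `K[x]`. -/
def matrixZInv : Matrix (Fin C.n) (Fin C.n) K[X] :=
  Matrix.diagonal fun i => Polynomial.C (ζ ^ (i : ℕ))

/-- The matrix `B = Z⁻¹ A`, whose characteristic polynomial is the equation of the curve. -/
def matrixB : Matrix (Fin C.n) (Fin C.n) K[X] :=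
  C.matrixZInv ζ * aeval C.shift (C.rootPoly r)

/-- The polynomial `∏_{l = 1}^m p (ζ ^ (-l) t)` with `p = ∏ (t + r i)`. -/
def twistedRootPoly (m : ℕ) : K[X] :=
  ∏ l ∈ Finset.range m, (C.rootPoly r).comp (Polynomial.C (ζ⁻¹ ^ (l + 1)) * X)

variable {C ζ r}

theorem twistedRootPoly_succ (m : ℕ) : C.twistedRootPoly ζ r (m + 1) =
    ((C.rootPoly r) * C.twistedRootPoly ζ r m).comp (Polynomial.C ζ⁻¹ * X) := by
  rw [twistedRootPoly, Finset.prod_range_succ', mul_comp, twistedRootPoly, prod_comp, mul_comm]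
  congr 1
  · simp
  · refine Finset.prod_congr rfl fun l _ => ?_
    rw [comp_assoc]
    congr 1
    simp only [mul_comp, C_comp, X_comp]
    rw [← mul_assoc, ← C_mul, ← pow_succ]

theorem natDegree_twistedRootPoly (hζ : ζ ≠ 0) (m : ℕ) :
    (C.twistedRootPoly ζ r m).natDegree = C.d * m := by
  induction m with
  | zero => simp [twistedRootPoly]
  | succ m ih =>
    have h1 : C.twistedRootPoly ζ r m ≠ 0 := by
      refine Finset.prod_ne_zero_iff.2 fun l _ => ?_
      intro h
      have h2 := congrArg natDegree h
      rw [natDegree_comp, natDegree_rootPoly, natDegree_C_mul_X _ (pow_ne_zero _ (inv_ne_zero hζ)),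
        natDegree_zero] at h2
      have := C.two_le_d
      omega
    rw [twistedRootPoly_succ, natDegree_comp, natDegree_C_mul_X _ (inv_ne_zero hζ), mul_one,
      natDegree_mul (C.monic_rootPoly r).ne_zero h1, natDegree_rootPoly, ih]
    ring

theorem twistedRootPoly_ne_zero (hζ : ζ ≠ 0) (m : ℕ) : C.twistedRootPoly ζ r m ≠ 0 := by
  cases m with
  | zero => simp [twistedRootPoly]
  | succ m =>
    intro h
    have h1 := C.natDegree_twistedRootPoly (r := r) hζ (m + 1)
    rw [h, natDegree_zero] at h1
    have := C.two_le_d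
    have : 0 < C.d * (m + 1) := by positivity
    omega

/-- The shift raises the index by one, which changes the diagonal entry by a factor ζ; the corner
follows the same rule because ζ^n = 1. -/
theorem matrixZInv_mul_shift (hζ : IsPrimitiveRoot ζ C.n) :
    C.matrixZInv ζ * C.shift = (Polynomial.C ζ⁻¹ • C.shift) * C.matrixZInv ζ := by
  have h0 : ζ ≠ 0 := hζ.ne_zero (NeZero.ne _)
  ext1 i j
  rw [matrixZInv, Matrix.diagonal_mul, Matrix.mul_diagonal, Matrix.smul_apply, smul_eq_mul,
    mul_right_comm, ← C_mul, mul_comm]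
  rw [mul_comm _ (C.shift i j)]
  by_cases h : (j : ℕ) = i + 1
  · rw [h, pow_succ', inv_mul_cancel_left₀ h0]
  by_cases h' : (j : ℕ) = 0 ∧ (i : ℕ) + 1 = C.n
  · have h1 : ζ ^ (i : ℕ) = ζ⁻¹ := by
      apply eq_inv_of_mul_eq_one_left
      rw [← pow_succ, h'.2, hζ.pow_eq_one]
    rw [h'.1, h1, pow_zero, mul_one]
  · rw [shift_apply_of_ne h h']
    simp

theorem matrixZInv_mul_aeval_shift (hζ : IsPrimitiveRoot ζ C.n) (q : K[X]) :
    C.matrixZInv ζ * aeval C.shift q =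
      aeval C.shift (q.comp (Polynomial.C ζ⁻¹ * X)) * C.matrixZInv ζ := by
  rw [aeval_comp, map_mul, aeval_X, aeval_C]
  have h1 : (algebraMap K (Matrix (Fin C.n) (Fin C.n) K[X]) ζ⁻¹) * C.shift =
      Polynomial.C ζ⁻¹ • C.shift := by
    rw [← Algebra.smul_def]
    ext1 i j
    rw [Matrix.smul_apply, Matrix.smul_apply, smul_eq_mul, smul_eq_C_mul]
  rw [h1]
  induction q using Polynomial.induction_on' with
  | add p q hp hq => rw [map_add, map_add, mul_add, add_mul, hp, hq]
  | monomial m a =>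
    have hs : SemiconjBy (C.matrixZInv ζ) C.shift (Polynomial.C ζ⁻¹ • C.shift) :=
      C.matrixZInv_mul_shift hζ
    rw [aeval_monomial, aeval_monomial, ← mul_assoc, ← Algebra.commutes, mul_assoc,
      (hs.pow_right m).eq, mul_assoc]

/-- Moving every Z⁻¹ to the right past polynomials in S replaces S by ζ⁻¹ S each time. -/
theorem matrixB_pow (hζ : IsPrimitiveRoot ζ C.n) (m : ℕ) :
    C.matrixB ζ r ^ m = aeval C.shift (C.twistedRootPoly ζ r m) * C.matrixZInv ζ ^ m := by
  induction m with
  | zero => simp [twistedRootPoly]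
  | succ m ih =>
    rw [pow_succ', ih, matrixB, mul_assoc, ← mul_assoc (aeval _ _), ← map_mul, ← mul_assoc,
      matrixZInv_mul_aeval_shift hζ, ← twistedRootPoly_succ, mul_assoc, ← pow_succ']

/-- For each i the n factors r_i + ζ^(-l) t run over all n-th roots of unity, and their product is
r_i^n - (-t)^n. -/
theorem twistedRootPoly_n (hζ : IsPrimitiveRoot ζ C.n) : C.twistedRootPoly ζ r C.n =
    ∏ i, (Polynomial.C (r i ^ C.n) - (-X) ^ C.n) := by
  simp only [twistedRootPoly, rootPoly, prod_comp]
  rw [Finset.prod_comm]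
  refine Finset.prod_congr rfl fun i _ => ?_
  have hη : IsPrimitiveRoot (Polynomial.C ζ⁻¹) C.n := hζ.inv.map_of_injective C_injective
  have hpow : (-(Polynomial.C ζ⁻¹ * X : K[X])) ^ C.n = (-X) ^ C.n := by
    rw [← mul_neg, mul_pow, hη.pow_eq_one, one_mul]
  have h := congrArg (eval (Polynomial.C (r i))) (X_pow_sub_C_eq_prod hη (NeZero.pos _) hpow)
  rw [eval_sub, eval_pow, eval_X, eval_C, eval_prod] at h
  rw [C_pow, h]
  refine Finset.prod_congr rfl fun l _ => ?_
  rw [add_comp, X_comp, C_comp, eval_sub, eval_X, eval_C, mul_neg, ← mul_assoc, ← C_pow, ← C_mul,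
    ← pow_succ]
  ring

theorem matrixZInv_pow_n (hζ : IsPrimitiveRoot ζ C.n) : C.matrixZInv ζ ^ C.n = 1 := by
  rw [matrixZInv, Matrix.diagonal_pow, ← Matrix.diagonal_one]
  congr 1
  ext1 i
  rw [Pi.pow_apply, ← C_pow, ← pow_mul, mul_comm, pow_mul, hζ.pow_eq_one, one_pow, C_1]

theorem matrixB_pow_n (hζ : IsPrimitiveRoot ζ C.n) (hr : ∀ i, r i ^ C.n = C.α i) :
    C.matrixB ζ r ^ C.n = C.rhs • 1 := by
  rw [matrixB_pow hζ, matrixZInv_pow_n hζ, mul_one, twistedRootPoly_n hζ]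
  -- This is (-S)^n = -x, the reason for the sign in the corner of the shift.
  have hsign : (-1) ^ C.n * (Polynomial.C ((-1) ^ (C.n - 1)) * X : K[X]) = -X := by
    rw [C_pow, C_neg, C_1, ← mul_assoc, ← pow_add, show C.n + (C.n - 1) = 2 * (C.n - 1) + 1 by
      have := C.two_le_n; omega, pow_succ, pow_mul]
    simp
  have hterm : ∀ i, aeval C.shift (Polynomial.C (r i ^ C.n) - (-X) ^ C.n) =
      algebraMap K[X] (Matrix (Fin C.n) (Fin C.n) K[X]) (X + Polynomial.C (C.α i)) := by
    intro i
    have h1 : (-1 : Matrix (Fin C.n) (Fin C.n) K[X]) ^ C.n =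
        algebraMap K[X] (Matrix (Fin C.n) (Fin C.n) K[X]) ((-1) ^ C.n) := by
      rw [map_pow, map_neg, map_one]
    rw [map_sub, aeval_C, hr, map_pow, map_neg, aeval_X, neg_pow, shift_pow,
      ← Algebra.algebraMap_eq_smul_one, h1, ← map_mul, hsign, map_neg, sub_neg_eq_add, map_add,
      add_comm]
    rfl
  have hprod : ∀ s : Finset (Fin C.d), aeval C.shift (∏ i ∈ s, (Polynomial.C (r i ^ C.n) -
      (-X) ^ C.n)) = algebraMap K[X] (Matrix (Fin C.n) (Fin C.n) K[X])
        (∏ i ∈ s, (X + Polynomial.C (C.α i))) := by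
    intro s
    induction s using Finset.induction_on with
    | empty => simp
    | insert i s hi ih =>
      rw [Finset.prod_insert hi, Finset.prod_insert hi, map_mul, map_mul, hterm, ih]
  rw [hprod, rhs, Algebra.algebraMap_eq_smul_one]

/-- By Gauss's lemma y^n - rhs is irreducible over K(x). It annihilates B, so it is the minimal
polynomial; the characteristic polynomial is a monic multiple of the same degree n. -/
theorem charpoly_matrixB (hζ : IsPrimitiveRoot ζ C.n) (hr : ∀ i, r i ^ C.n = C.α i) :
    (C.matrixB ζ r).charpoly = C.polynomial := by
  let L := FractionRing K[X]
  let φ := algebraMap K[X] L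
  have hφ : Function.Injective φ := IsFractionRing.injective _ _
  apply Polynomial.map_injective φ hφ
  rw [← Matrix.charpoly_map]
  set B' := (C.matrixB ζ r).map φ with hB'
  have hirr : Irreducible (C.polynomial.map φ) :=
    C.monic_polynomial.irreducible_iff_irreducible_map_fraction_map.1 C.polynomial_irreducible
  have hzero : aeval B' (C.polynomial.map φ) = 0 := by
    have h1 : B' ^ C.n = φ C.rhs • (1 : Matrix (Fin C.n) (Fin C.n) L) := by
      have h2 := congrArg φ.mapMatrix (C.matrixB_pow_n hζ hr)
      rw [map_pow] at h2
      rw [hB', ← RingHom.mapMatrix_apply, h2]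
      ext i j
      simp [Matrix.one_apply, apply_ite φ]
    rw [polynomial, Polynomial.map_sub, Polynomial.map_pow, map_X, map_C, map_sub, map_pow, aeval_X,
      aeval_C, h1, sub_eq_zero]
    exact (Algebra.algebraMap_eq_smul_one (A := Matrix (Fin C.n) (Fin C.n) L) (φ C.rhs)).symm
  have hmin := minpoly.eq_of_irreducible_of_monic hirr hzero (C.monic_polynomial.map φ)
  refine (eq_of_monic_of_dvd_of_natDegree_le (C.monic_polynomial.map φ)
    (Matrix.charpoly_monic _) (hmin ▸ Matrix.minpoly_dvd_charpoly B') ?_)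
  rw [Matrix.charpoly_natDegree_eq_dim, C.monic_polynomial.natDegree_map, natDegree_polynomial,
    Fintype.card_fin]

/-! ### The matrices `M` and `N` -/

theorem matrixZ_mul_matrixZInv (hζ : ζ ≠ 0) :
    C.matrixZ ζ * (C.matrixZInv ζ).map Polynomial.C = 1 := by
  rw [matrixZ, matrixZInv, Matrix.diagonal_map (map_zero _), Matrix.diagonal_mul_diagonal,
    ← Matrix.diagonal_one]
  congr 1
  ext1 i
  rw [← C_mul, ← C_mul, ← mul_pow, inv_mul_cancel₀ hζ, one_pow, C_1, C_1]

theorem matrixM_eq (hζ : ζ ≠ 0) :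
    C.matrixM ζ r = -(C.matrixZ ζ * (C.matrixB ζ r).charmatrix) := by
  rw [Matrix.charmatrix, mul_sub, matrixB, map_mul, RingHom.mapMatrix_apply,
    RingHom.mapMatrix_apply, ← mul_assoc, matrixZ_mul_matrixZInv hζ, one_mul, neg_sub, ← matrixA_eq,
    matrixM, Matrix.scalar_apply, ← Matrix.smul_one_eq_diagonal, mul_smul_comm, mul_one]

variable (C ζ) in
/-- The determinant of `M`, up to the factor `y ^ n - ∏ (x + α i)`. -/
def detConst : K := (-1) ^ C.n * ∏ i : Fin C.n, ζ⁻¹ ^ (i : ℕ)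

theorem detConst_ne_zero (hζ : ζ ≠ 0) : C.detConst ζ ≠ 0 :=
  mul_ne_zero (pow_ne_zero _ (neg_ne_zero.2 one_ne_zero))
    (Finset.prod_ne_zero_iff.2 fun _ _ => pow_ne_zero _ (inv_ne_zero hζ))

theorem det_matrixM (hζ : IsPrimitiveRoot ζ C.n) (hr : ∀ i, r i ^ C.n = C.α i) :
    (C.matrixM ζ r).det = Polynomial.C (Polynomial.C (C.detConst ζ)) * C.polynomial := by
  rw [matrixM_eq (hζ.ne_zero (NeZero.ne _)), Matrix.det_neg, Matrix.det_mul, ← Matrix.charpoly,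
    charpoly_matrixB hζ hr, matrixZ, Matrix.det_diagonal, Fintype.card_fin, detConst]
  simp only [C_mul, C_pow, C_neg, C_1, map_prod]
  ring

theorem det_matrixM_ne_zero (hζ : IsPrimitiveRoot ζ C.n) (hr : ∀ i, r i ^ C.n = C.α i) :
    (C.matrixM ζ r).det ≠ 0 := by
  rw [det_matrixM hζ hr]
  exact mul_ne_zero (C_ne_zero.2 (C_ne_zero.2 (detConst_ne_zero (hζ.ne_zero (NeZero.ne _)))))
    C.monic_polynomial.ne_zero

/-- From M = -Z (y - B) and (y - B) ∑ y^k B^(n-1-k) = y^n - B^n = y^n - rhs one reads off a matrix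
with the same product with M as the adjugate, and det M ≠ 0 in K[x, y] allows cancellation. -/
theorem matrixN_eq (hζ : IsPrimitiveRoot ζ C.n) (hr : ∀ i, r i ^ C.n = C.α i) :
    C.matrixN ζ r = -(Polynomial.C (Polynomial.C (C.detConst ζ)) •
      ((∑ k ∈ Finset.range C.n, (X : K[X][X]) ^ k • (C.matrixB ζ r ^ (C.n - 1 - k)).map Polynomial.C) *
        (C.matrixZInv ζ).map Polynomial.C)) := by
  have hζ0 := hζ.ne_zero (NeZero.ne C.n)
  refine Matrix.eq_of_mul_eq_mul_of_det_ne_zero (det_matrixM_ne_zero hζ hr) ?_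
  rw [matrixN, Matrix.mul_adjugate, det_matrixM hζ hr, matrixM_eq hζ0, Matrix.neg_mul, Matrix.mul_neg,
    neg_neg, mul_smul_comm,
    mul_smul, mul_assoc, ← mul_assoc (C.matrixB ζ r).charmatrix]
  congr 1
  have h1 : (C.matrixB ζ r).charmatrix * (∑ k ∈ Finset.range C.n,
      (X : K[X][X]) ^ k • (C.matrixB ζ r ^ (C.n - 1 - k)).map Polynomial.C) = C.polynomial • 1 := by
    have hcomm : Commute (Matrix.scalar (Fin C.n) (X : K[X][X]))
        (Polynomial.C.mapMatrix (C.matrixB ζ r)) := Matrix.scalar_commute _ (Commute.all _) _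
    have h2 := hcomm.mul_geom_sum₂ C.n
    rw [← map_pow, ← map_pow, matrixB_pow_n hζ hr] at h2
    rw [Matrix.charmatrix]
    refine Eq.trans ?_ (h2.trans ?_)
    · congr 1
      refine Finset.sum_congr rfl fun k _ => ?_
      rw [← map_pow, ← map_pow, Matrix.scalar_apply, ← Matrix.smul_eq_diagonal_mul]
      rfl
    · ext1 i j
      simp only [Matrix.sub_apply, Matrix.scalar_apply, Matrix.diagonal_apply,
        RingHom.mapMatrix_apply, Matrix.map_apply, Matrix.smul_apply, Matrix.one_apply, polynomial,
        smul_eq_mul, mul_ite, mul_one, mul_zero]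
      split_ifs <;> simp
  rw [h1, smul_mul_assoc, one_mul, mul_smul_comm, matrixZ_mul_matrixZInv hζ0]

end Matrices

end SuperellipticCurve

namespace SuperellipticCurve

variable {K : Type*} [Field K] {C : SuperellipticCurve K} {ζ : K} {r : Fin C.d → K}

/-! ### Entries of `N` at infinity -/

variable (C ζ) in
/-- The constant factor in the coefficient of `y ^ k` in the `j`-th column of `N`. -/
def coeffConst (j : Fin C.n) (k : ℕ) : K :=
  -(C.detConst ζ * (ζ ^ (j : ℕ)) ^ (C.n - 1 - k) * ζ ^ (j : ℕ))

theorem coeffConst_ne_zero (hζ : ζ ≠ 0) (j : Fin C.n) (k : ℕ) : C.coeffConst ζ j k ≠ 0 :=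
  neg_ne_zero.2 (mul_ne_zero (mul_ne_zero (detConst_ne_zero hζ) (pow_ne_zero _ (pow_ne_zero _ hζ)))
    (pow_ne_zero _ hζ))

theorem matrixN_apply (hζ : IsPrimitiveRoot ζ C.n) (hr : ∀ i, r i ^ C.n = C.α i) (i j : Fin C.n) :
    C.matrixN ζ r i j = ∑ k ∈ Finset.range C.n, Polynomial.C (Polynomial.C (C.coeffConst ζ j k) *
      aeval C.shift (C.twistedRootPoly ζ r (C.n - 1 - k)) i j) * X ^ k := by
  rw [matrixN_eq hζ hr, Matrix.neg_apply, Matrix.smul_apply, matrixZInv,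
    Matrix.diagonal_map (map_zero _), Matrix.mul_diagonal, Matrix.sum_apply, smul_eq_mul,
    Finset.sum_mul, Finset.mul_sum, ← Finset.sum_neg_distrib]
  refine Finset.sum_congr rfl fun k _ => ?_
  rw [Matrix.smul_apply, Matrix.map_apply, matrixB_pow hζ, matrixZInv, Matrix.diagonal_pow,
    Matrix.mul_diagonal, Pi.pow_apply, smul_eq_mul, coeffConst]
  simp only [C_mul, C_pow, C_neg]
  ring

theorem coeff_matrixN (hζ : IsPrimitiveRoot ζ C.n) (hr : ∀ i, r i ^ C.n = C.α i) (i j : Fin C.n)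
    (k : ℕ) : (C.matrixN ζ r i j).coeff k = if k < C.n then Polynomial.C (C.coeffConst ζ j k) *
      aeval C.shift (C.twistedRootPoly ζ r (C.n - 1 - k)) i j else 0 := by
  rw [matrixN_apply hζ hr, finsetSum_coeff]
  simp only [coeff_C_mul, coeff_X_pow, mul_ite, mul_one, mul_zero]
  rw [Finset.sum_ite_eq]
  simp only [Finset.mem_range]

theorem natDegree_matrixN_lt (hζ : IsPrimitiveRoot ζ C.n) (hr : ∀ i, r i ^ C.n = C.α i)
    (i j : Fin C.n) : (C.matrixN ζ r i j).natDegree < C.n := by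
  have hn := C.two_le_n
  have h : (C.matrixN ζ r i j).natDegree ≤ C.n - 1 :=
    natDegree_le_iff_coeff_eq_zero.2 fun k hk => by rw [coeff_matrixN hζ hr, if_neg (by omega)]
  omega

/-- The coefficient of y^k is a constant times an entry of a polynomial in S of degree d (n-1-k). A
monomial x^a y^k that occurs has n a + j - i ≤ d (n-1-k), so its weight is at most d (n-1) + i - j =
2g + i + (n-1-j). Equality means that the leading coefficient of that polynomial appears in the
entry. -/
theorem exists_isLeading_matrixN (hζ : IsPrimitiveRoot ζ C.n) (hr : ∀ i, r i ^ C.n = C.α i)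
    (i j : Fin C.n) : ∃ a k, C.IsLeading (C.matrixN ζ r i j) a k ∧
      C.n * a + C.d * k = 2 * C.genus + (i + (C.n - 1 - j)) := by
  have hζ0 := hζ.ne_zero (NeZero.ne C.n)
  have hn := C.two_le_n
  have hd := C.two_le_d
  have hj := j.2
  have hg : (2 * C.genus : ℤ) = (C.n - 1) * (C.d - 1) := by
    have := congrArg (Nat.cast (R := ℤ)) C.two_mul_genus
    rw [Nat.cast_mul, Nat.cast_mul, Nat.cast_sub (by omega), Nat.cast_sub (by omega)] at this
    exact_mod_cast this
  have htarget : ((2 * C.genus + (i + (C.n - 1 - j)) : ℕ) : ℤ) = C.d * (C.n - 1) + i - j := by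
    push_cast [show (j : ℕ) ≤ C.n - 1 by omega, show 1 ≤ C.n by omega]
    rw [hg]; ring
  have hbound : ∀ a k, ((C.matrixN ζ r i j).coeff k).coeff a ≠ 0 →
      C.n * a + C.d * k ≤ 2 * C.genus + (i + (C.n - 1 - j)) := by
    intro a k h
    rw [coeff_matrixN hζ hr] at h
    split_ifs at h with hk
    · rw [coeff_C_mul, coeff_aeval_shift] at h
      split_ifs at h with hi
      · have h1 := right_ne_zero_of_mul (right_ne_zero_of_mul h)
        have h2 := le_natDegree_of_ne_zero h1
        rw [natDegree_twistedRootPoly hζ0] at h2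
        zify at htarget ⊢
        rw [htarget]
        have h3 : (C.n * a + j - i : ℤ) ≤ C.d * (C.n - 1 - k) := by
          zify [hi] at h2
          rwa [Nat.cast_sub (by omega), Nat.cast_sub (by omega), Nat.cast_one] at h2
        linarith
      · simp at h
    · simp at h
  -- With m = n - 1 - k, the leading power S^(d m) has a nonzero entry at (i, j) exactly when d m +
  -- i ≡ j modulo n.
  obtain ⟨m, hm, hmod⟩ : ∃ m < C.n, C.d * m + i ≡ j [MOD C.n] := by
    obtain ⟨t, -, ht⟩ := Nat.exists_mul_mod_eq_one_of_coprime C.coprime.symm (by omega)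
    have h1 : C.d * t ≡ 1 [MOD C.n] := by
      rw [Nat.ModEq, ht, Nat.mod_eq_of_lt (by omega)]
    refine ⟨(t * (j + (C.n - i))) % C.n, Nat.mod_lt _ (by omega), ?_⟩
    have hi := i.2
    calc C.d * (t * (j + (C.n - i)) % C.n) + i ≡ C.d * (t * (j + (C.n - i))) + i [MOD C.n] :=
          ((Nat.mod_modEq _ _).mul_left _).add_right _
      _ = (C.d * t) * (j + (C.n - i)) + i := by ring
      _ ≡ 1 * (j + (C.n - i)) + i [MOD C.n] := (h1.mul_right _).add_right _
      _ = j + C.n := by omega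
      _ ≡ j [MOD C.n] := by simp [Nat.ModEq]
  obtain ⟨a, ha⟩ : ∃ a : ℕ, C.n * a + j = C.d * m + i := by
    rcases le_or_gt (j : ℕ) (C.d * m + i) with hle | hgt
    · obtain ⟨a, ha⟩ := (Nat.modEq_iff_dvd' hle).1 hmod.symm
      exact ⟨a, by omega⟩
    · have := hmod.eq_of_lt_of_lt (hgt.trans hj) hj
      omega
  have hk : C.n - 1 - (C.n - 1 - m) = m := by omega
  have hweight : C.n * a + C.d * (C.n - 1 - m) = 2 * C.genus + (i + (C.n - 1 - j)) := by
    zify at htarget ⊢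
    rw [htarget]
    zify at ha
    rw [Nat.cast_sub (by omega), Nat.cast_sub (by omega), Nat.cast_one]
    linarith
  refine ⟨a, C.n - 1 - m, ⟨by omega, ?_, fun a' k' h => hweight ▸ hbound a' k' h⟩, hweight⟩
  rw [coeff_matrixN hζ hr, if_pos (by omega), coeff_C_mul, coeff_aeval_shift, hk]
  have hcoef : (C.twistedRootPoly ζ r m).coeff (C.d * m) ≠ 0 := by
    rw [← natDegree_twistedRootPoly (r := r) hζ0 m, coeff_natDegree, leadingCoeff_ne_zero]
    exact twistedRootPoly_ne_zero hζ0 m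
  refine mul_ne_zero (coeffConst_ne_zero hζ0 _ _) ?_
  rw [if_pos (by omega), show C.n * a + (j : ℕ) - i = C.d * m by omega]
  exact mul_ne_zero (pow_ne_zero _ (pow_ne_zero _ (neg_ne_zero.2 one_ne_zero))) hcoef

theorem entryN_ne_zero (hζ : IsPrimitiveRoot ζ C.n) (hr : ∀ i, r i ^ C.n = C.α i)
    (i j : Fin C.n) : C.entryN ζ r i j ≠ 0 := by
  obtain ⟨a, k, h, -⟩ := C.exists_isLeading_matrixN hζ hr i j
  refine C.toFunctionField_ne_zero (fun h0 => ?_) (natDegree_matrixN_lt hζ hr i j)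
  have := h.coeff_ne_zero
  rw [h0] at this
  simp at this

theorem ord_entryN_infinite (hζ : IsPrimitiveRoot ζ C.n) (hr : ∀ i, r i ^ C.n = C.α i)
    {I : C.Point} (hI : IsInfinite I) (i j : Fin C.n) :
    I.ord (C.entryN ζ r i j) = -(2 * C.genus + (i + (C.n - 1 - j)) : ℕ) := by
  obtain ⟨a, k, h, hw⟩ := C.exists_isLeading_matrixN hζ hr i j
  rw [entryN, h.ord_eq hI (natDegree_matrixN_lt hζ hr i j), hw]

/-! ### Entries of `N` at finite points -/

theorem matrixM_mul_matrixN (hζ : IsPrimitiveRoot ζ C.n) (hr : ∀ i, r i ^ C.n = C.α i) :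
    C.matrixM ζ r * C.matrixN ζ r =
      (Polynomial.C (Polynomial.C (C.detConst ζ)) * C.polynomial) • 1 := by
  rw [matrixN, Matrix.mul_adjugate, det_matrixM hζ hr]

theorem matrixN_mul_matrixM (hζ : IsPrimitiveRoot ζ C.n) (hr : ∀ i, r i ^ C.n = C.α i) :
    C.matrixN ζ r * C.matrixM ζ r =
      (Polynomial.C (Polynomial.C (C.detConst ζ)) * C.polynomial) • 1 := by
  rw [matrixN, Matrix.adjugate_mul, det_matrixM hζ hr]

/-- If N vanished at the point, where M is singular, then M N = c (y^n - rhs) would vanish there to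
second order along every line, contradicting smoothness. -/
theorem exists_matrixN_evalEval_ne_zero (hζ : IsPrimitiveRoot ζ C.n)
    (hr : ∀ i, r i ^ C.n = C.α i) {a b : K} (hab : b ^ C.n = C.rhs.eval a) :
    ∃ i j, (C.matrixN ζ r i j).evalEval a b ≠ 0 := by
  by_contra! hcon
  have hc := C.detConst_ne_zero (hζ.ne_zero (NeZero.ne C.n))
  have key : ∀ (ψ : K[X][X] →+* K[X]) (t : K), (∀ g, eval t (ψ g) = g.evalEval a b) →
      eval t (derivative (ψ (Polynomial.C (Polynomial.C (C.detConst ζ)) * C.polynomial))) = 0 := by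
    intro ψ t hψ
    refine Matrix.derivative_eval_eq_zero_of_mul_eq_smul_one (M := (C.matrixM ζ r).map ψ)
      (N := (C.matrixN ζ r).map ψ) ?_ ?_ ?_
    · rw [← Matrix.map_mul, matrixM_mul_matrixN hζ hr]
      ext1 i j
      rw [Matrix.map_apply, Matrix.smul_apply, Matrix.smul_apply, Matrix.one_apply,
        Matrix.one_apply, smul_eq_mul, smul_eq_mul, map_mul ψ _ (ite _ _ _), apply_ite ψ, map_one,
        map_zero]
    · rw [← RingHom.mapMatrix_apply, ← RingHom.map_det, hψ, det_matrixM hζ hr, evalEval_mul]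
      simp [polynomial, hab, evalEval_C]
    · intro i j
      rw [Matrix.map_apply, hψ, hcon]
  -- On the line y = b = 0 the derivative is a multiple of rhs'(a); if b ≠ 0, on the line x = a it
  -- is a multiple of n b^(n-1).
  by_cases hb : b = 0
  · have h1 := key (evalRingHom (Polynomial.C b)) a fun g => rfl
    subst hb
    rw [zero_pow (NeZero.ne _)] at hab
    refine C.derivative_rhs_eval_ne_zero hab.symm ?_
    simpa [polynomial, hc, zero_pow (NeZero.ne C.n)] using h1
  · have h1 := key (mapRingHom (evalRingHom a)) b fun g => by
      rw [coe_mapRingHom, eval_map, eval₂_evalRingHom]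
    simp [polynomial, hc, derivative_X_pow, C.natCast_ne_zero, hb] at h1

theorem exists_ord_entryN_eq_zero [IsAlgClosed K] (hζ : IsPrimitiveRoot ζ C.n)
    (hr : ∀ i, r i ^ C.n = C.α i) {P : C.Point} (hP : C.x ∈ P.localRing) :
    ∃ i j, P.ord (C.entryN ζ r i j) = 0 := by
  obtain ⟨a, b, hab⟩ := exists_isAffinePoint hP
  obtain ⟨i, j, hij⟩ := C.exists_matrixN_evalEval_ne_zero hζ hr hab.equation
  refine ⟨i, j, ?_⟩
  have := (hab.val_eq_one_iff _).2 hij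
  rw [P.ord_eq_log_val, entryN, this]
  simp

end SuperellipticCurve

namespace Matrix

/-- The adjugate of a singular matrix has rank at most one. -/
theorem adjugate_mul_adjugate_of_det_eq_zero {F m : Type*} [Field F] [Fintype m] [DecidableEq m]
    {M : Matrix m m F} (hM : M.det = 0) {i l : m} (hil : M.adjugate i l ≠ 0) (j k : m) :
    M.adjugate i j * M.adjugate k l = M.adjugate i l * M.adjugate k j := by
  -- A combination of rows i and k of the adjugate, all in the left kernel of M, chosen with l-th
  -- coordinate 0. If it were nonzero, it would also kill M with row l replaced by a basis vector,
  -- and the entry (i, l) of the adjugate would vanish.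
  let w : m → F := M.adjugate k l • M.adjugate i - M.adjugate i l • M.adjugate k
  have hrow : ∀ i, M.adjugate i ᵥ* M = 0 := fun i => by
    have h := congrFun (M.adjugate_mul) i
    rw [hM, zero_smul] at h
    exact h
  have hw : w ᵥ* M = 0 := by
    rw [sub_vecMul, smul_vecMul, smul_vecMul, hrow, hrow, smul_zero, smul_zero, sub_zero]
  have hwl : w l = 0 := by
    simp only [w, Pi.sub_apply, Pi.smul_apply, smul_eq_mul]
    ring
  have hw0 : w = 0 := by
    by_contra h
    refine hil ?_
    rw [adjugate_apply, ← exists_vecMul_eq_zero_iff]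
    refine ⟨w, h, ?_⟩
    rw [← hw]
    ext c
    simp only [vecMul, dotProduct]
    refine Finset.sum_congr rfl fun t _ => ?_
    by_cases ht : t = l
    · rw [ht, hwl, zero_mul, zero_mul]
    · rw [updateRow_ne ht]
  have h := congrFun hw0 j
  simp only [w, Pi.sub_apply, Pi.smul_apply, smul_eq_mul, Pi.zero_apply] at h
  linear_combination h

end Matrix

namespace SuperellipticCurve

variable {K : Type*} [Field K] {C : SuperellipticCurve K} {ζ : K} {r : Fin C.d → K}

/-! ### The automorphism `y ↦ ζ y` -/

theorem zetaPullback_algebraMap (hζ : ζ ^ C.n = 1) (f : C.CoordinateRing) :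
    C.zetaPullback ζ hζ (algebraMap _ _ f) = algebraMap _ C.FunctionField (C.scaleHom ζ hζ f) :=
  IsFractionRing.fieldEquivOfAlgEquiv_algebraMap K C.FunctionField C.FunctionField _ f

theorem zetaPullback_toFunctionField_C (hζ : ζ ^ C.n = 1) (p : K[X]) :
    C.zetaPullback ζ hζ (C.toFunctionField (Polynomial.C p)) =
      C.toFunctionField (Polynomial.C p) := by
  rw [toFunctionField_eq, zetaPullback_algebraMap, AdjoinRoot.mk_C]
  exact congrArg _ ((C.scaleHom ζ hζ).commutes p)

theorem zetaPullback_x (hζ : ζ ^ C.n = 1) : C.zetaPullback ζ hζ C.x = C.x :=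
  zetaPullback_toFunctionField_C hζ X

theorem zetaPullback_y (hζ : ζ ^ C.n = 1) :
    C.zetaPullback ζ hζ C.y = C.toFunctionField (Polynomial.C (Polynomial.C ζ)) * C.y := by
  rw [y, toFunctionField_eq, zetaPullback_algebraMap, AdjoinRoot.mk_X, scaleHom_root, map_mul]
  rfl

theorem zetaPullback_pow_n (hζ : ζ ^ C.n = 1) : C.zetaPullback ζ hζ ^ C.n = 1 := by
  have hpow : ∀ k : ℕ, (C.zetaPullback ζ hζ ^ k) C.y =
      C.toFunctionField (Polynomial.C (Polynomial.C (ζ ^ k))) * C.y := fun k => by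
    induction k with
    | zero => simp
    | succ k ih =>
      rw [pow_succ', AlgEquiv.mul_apply, ih, map_mul, zetaPullback_toFunctionField_C,
        zetaPullback_y, pow_succ, C_mul, C_mul, map_mul, mul_assoc]
  have hpowC : ∀ (k : ℕ) (p : K[X]), (C.zetaPullback ζ hζ ^ k) (C.toFunctionField (Polynomial.C p)) =
      C.toFunctionField (Polynomial.C p) := fun k p => by
    induction k with
    | zero => simp
    | succ k ih => rw [pow_succ', AlgEquiv.mul_apply, ih, zetaPullback_toFunctionField_C]
  have hmk : ∀ f, (C.zetaPullback ζ hζ ^ C.n) (C.toFunctionField f) = C.toFunctionField f := by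
    intro f
    induction f using Polynomial.induction_on' with
    | add p q hp hq => rw [map_add, map_add, hp, hq]
    | monomial k a =>
      rw [← C_mul_X_pow_eq_monomial, map_mul, map_mul, map_pow, map_pow, hpowC]
      congr 2
      exact (hpow C.n).trans (by rw [hζ, C_1, C_1, map_one, one_mul]; rfl)
  ext f
  obtain ⟨a, b, -, rfl⟩ := IsFractionRing.div_surjective (A := C.CoordinateRing) f
  obtain ⟨a, rfl⟩ := AdjoinRoot.mk_surjective a
  obtain ⟨b, rfl⟩ := AdjoinRoot.mk_surjective b
  rw [map_div₀]
  exact congrArg₂ _ (hmk a) (hmk b)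

/-! ### Symmetry of `N` -/

/-- The j-dependence is ζ^(j (n-k)), so the next column gains ζ^(-k), which offsets the factor ζ^k
produced by y^k under the automorphism. -/
theorem coeffConst_next (hζ : IsPrimitiveRoot ζ C.n) {j j' : Fin C.n}
    (hj : (j' : ℕ) = j + 1 ∨ (j' : ℕ) = 0 ∧ (j : ℕ) + 1 = C.n) {k : ℕ} (hk : k < C.n) :
    C.coeffConst ζ j' k * ζ ^ k = C.coeffConst ζ j k := by
  have h1 : ζ ^ (j' : ℕ) = ζ ^ (j : ℕ) * ζ := by
    rw [← pow_succ]
    rcases hj with h | ⟨h, h'⟩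
    · rw [h]
    · rw [h, h', hζ.pow_eq_one, pow_zero]
  have h2 : ζ ^ (C.n - 1 - k) * ζ * ζ ^ k = 1 := by
    rw [← pow_succ, ← pow_add, show C.n - 1 - k + 1 + k = C.n by omega, hζ.pow_eq_one]
  rw [coeffConst, coeffConst, h1, mul_pow]
  linear_combination (-(C.detConst ζ * (ζ ^ (j : ℕ)) ^ (C.n - 1 - k) * ζ ^ (j : ℕ))) * h2

theorem zetaPullback_entryN (hζ : IsPrimitiveRoot ζ C.n) (hr : ∀ i, r i ^ C.n = C.α i)
    {i i' j j' : Fin C.n} (hj : (j' : ℕ) = j + 1 ∨ (j' : ℕ) = 0 ∧ (j : ℕ) + 1 = C.n) {u v : K[X]}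
    (huv : ∀ q : K[X], u * aeval C.shift q i' j' = v * aeval C.shift q i j) :
    C.toFunctionField (Polynomial.C u) * C.zetaPullback ζ hζ.pow_eq_one (C.entryN ζ r i' j') =
      C.toFunctionField (Polynomial.C v) * C.entryN ζ r i j := by
  rw [entryN, entryN, matrixN_apply hζ hr, matrixN_apply hζ hr, map_sum, map_sum, map_sum,
    Finset.mul_sum, Finset.mul_sum]
  refine Finset.sum_congr rfl fun k hk => ?_
  have h1 := zetaPullback_y (C := C) hζ.pow_eq_one
  have h2 := huv (C.twistedRootPoly ζ r (C.n - 1 - k))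
  rw [y] at h1
  rw [map_mul, map_mul, zetaPullback_toFunctionField_C, map_pow, map_pow, h1,
    ← coeffConst_next hζ hj (Finset.mem_range.1 hk)]
  generalize aeval C.shift (C.twistedRootPoly ζ r (C.n - 1 - k)) i' j' = G' at h2 ⊢
  generalize aeval C.shift (C.twistedRootPoly ζ r (C.n - 1 - k)) i j = G at h2 ⊢
  have h3 := congrArg (fun g => C.toFunctionField (Polynomial.C g)) h2
  simp only [map_mul, map_pow] at h3 ⊢
  linear_combination C.toFunctionField (Polynomial.C (Polynomial.C (C.coeffConst ζ j' k))) *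
    C.toFunctionField (Polynomial.C (Polynomial.C ζ)) ^ k * C.toFunctionField X ^ k * h3

theorem shift_mul_aeval_shift (q : K[X]) : C.shift * aeval C.shift q = aeval C.shift q * C.shift := by
  have h := congrArg (aeval C.shift) (mul_comm X q)
  rwa [map_mul, map_mul, aeval_X] at h

end SuperellipticCurve

namespace SuperellipticCurve

variable {K : Type*} [Field K] {C : SuperellipticCurve K} {ζ : K} {r : Fin C.d → K}

/-- Compare the entries (i, j') of S q(S) = q(S) S. The left side is q(S) at (i', j') and the right
side is q(S) at (i, j), each multiplied by ±x if its new index has wrapped to 0. -/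
theorem ord_push_zetaPullback_entryN (hζ : IsPrimitiveRoot ζ C.n) (hr : ∀ i, r i ^ C.n = C.α i)
    {i i' j j' : Fin C.n} (hi : (i' : ℕ) = i + 1 ∨ (i' : ℕ) = 0 ∧ (i : ℕ) + 1 = C.n)
    (hj : (j' : ℕ) = j + 1 ∨ (j' : ℕ) = 0 ∧ (j : ℕ) + 1 = C.n) (Q : C.Point) :
    (if (i' : ℕ) = 0 then Q.ord C.x else 0) +
        (Q.push (C.zetaPullback ζ hζ.pow_eq_one)).ord (C.entryN ζ r i' j') =
      (if (j' : ℕ) = 0 then Q.ord C.x else 0) + Q.ord (C.entryN ζ r i j) := by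
  let w : K[X] := Polynomial.C ((-1) ^ (C.n - 1)) * X
  have hid : C.shift = C.shift.map (RingHom.id K[X]) := by ext1; rfl
  have huv : ∀ q : K[X], (if (i' : ℕ) = 0 then w else 1) * aeval C.shift q i' j' =
      (if (j' : ℕ) = 0 then w else 1) * aeval C.shift q i j := by
    intro q
    have h1 : (C.shift * aeval C.shift q) i j' =
        (if (i' : ℕ) = 0 then w else 1) * aeval C.shift q i' j' := by
      rcases hi with h | ⟨h, h'⟩
      · have h1 := shift_mul_apply_succ (RingHom.id K[X]) (aeval C.shift q) j' h
        rw [← hid] at h1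
        rw [if_neg (by omega), one_mul, h1]
      · have h1 := shift_mul_apply_last (RingHom.id K[X]) (aeval C.shift q) j' h' h
        rw [← hid] at h1
        rw [if_pos h, h1]
        rfl
    have h2 : (aeval C.shift q * C.shift) i j' =
        (if (j' : ℕ) = 0 then w else 1) * aeval C.shift q i j := by
      rcases hj with h | ⟨h, h'⟩
      · have h1 := mul_shift_apply_succ (RingHom.id K[X]) (aeval C.shift q) i h
        rw [← hid] at h1
        rw [if_neg (by omega), one_mul, h1]
      · have h1 := mul_shift_apply_zero (RingHom.id K[X]) (aeval C.shift q) i h h'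
        rw [← hid] at h1
        rw [if_pos h, h1, mul_comm]
        rfl
    rw [← h1, ← h2, shift_mul_aeval_shift]
  have hw : C.toFunctionField (Polynomial.C w) =
      algebraMap K C.FunctionField ((-1) ^ (C.n - 1)) * C.x := by
    rw [C_mul, map_mul, toFunctionField_C_C]
    rfl
  have hsign : algebraMap K C.FunctionField ((-1) ^ (C.n - 1)) ≠ 0 :=
    (_root_.map_ne_zero _).2 (pow_ne_zero _ (neg_ne_zero.2 one_ne_zero))
  have hord : ∀ k : ℕ, C.toFunctionField (Polynomial.C (if k = 0 then w else 1)) ≠ 0 ∧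
      Q.ord (C.toFunctionField (Polynomial.C (if k = 0 then w else 1))) =
        if k = 0 then Q.ord C.x else 0 := by
    intro k
    split_ifs
    · rw [hw, Q.ord_mul hsign C.x_ne_zero, Q.ord_algebraMap, zero_add]
      exact ⟨mul_ne_zero hsign C.x_ne_zero, rfl⟩
    · simp
  have h := congrArg Q.ord (zetaPullback_entryN hζ hr hj huv)
  rwa [Q.ord_mul (hord _).1 ((_root_.map_ne_zero _).2 (entryN_ne_zero hζ hr _ _)),
    Q.ord_mul (hord _).1 (entryN_ne_zero hζ hr _ _), (hord _).2, (hord _).2, ← Place.ord_push] at h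

/-! ### Rank one -/

theorem entryN_mul_entryN (hζ : IsPrimitiveRoot ζ C.n) (hr : ∀ i, r i ^ C.n = C.α i)
    (i j k l : Fin C.n) : C.entryN ζ r i j * C.entryN ζ r k l =
      C.entryN ζ r i l * C.entryN ζ r k j := by
  have hadj : ∀ i j, C.entryN ζ r i j = ((C.matrixM ζ r).map C.toFunctionField).adjugate i j := by
    intro i j
    rw [← RingHom.mapMatrix_apply, ← RingHom.map_adjugate]
    rfl
  have hdet : ((C.matrixM ζ r).map C.toFunctionField).det = 0 := by
    rw [← RingHom.mapMatrix_apply, ← RingHom.map_det, det_matrixM hζ hr, map_mul,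
      (C.toFunctionField_eq_zero_iff _).2 dvd_rfl, mul_zero]
  have hil := entryN_ne_zero hζ hr i l
  simp only [hadj] at hil ⊢
  exact Matrix.adjugate_mul_adjugate_of_det_eq_zero hdet hil j k

/-! ### Vanishing over `x = 0` -/

/-- At x = 0 the corner of S vanishes, so M is upper triangular with diagonal entries ∏ r_i - c
ζ^(-i). -/
theorem matrixM_evalEval (c : K) (i j : Fin C.n) : (C.matrixM ζ r i j).evalEval 0 c =
    (if (i : ℕ) ≤ j then (C.rootPoly r).coeff (j - i) else 0) -
      if i = j then c * ζ⁻¹ ^ (i : ℕ) else 0 := by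
  rw [matrixM, Matrix.sub_apply, Matrix.smul_apply, evalEval_sub, smul_eq_mul, evalEval_mul,
    evalEval_X, matrixA_eq, Matrix.map_apply, evalEval_C, ← coeff_zero_eq_eval_zero,
    coeff_aeval_shift, matrixZ, Matrix.diagonal_apply]
  congr 1
  · simp
  · split_ifs <;> simp [evalEval_C]

theorem coeff_rootPoly_zero : (C.rootPoly r).coeff 0 = ∏ i, r i := by
  rw [rootPoly, coeff_zero_eq_eval_zero, eval_prod]
  simp

theorem sum_matrixM_matrixN_evalEval (hζ : IsPrimitiveRoot ζ C.n) (hr : ∀ i, r i ^ C.n = C.α i)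
    {a c : K} (hac : c ^ C.n = C.rhs.eval a) (i j : Fin C.n) :
    ∑ l, (C.matrixM ζ r i l).evalEval a c * (C.matrixN ζ r l j).evalEval a c = 0 ∧
      ∑ l, (C.matrixN ζ r i l).evalEval a c * (C.matrixM ζ r l j).evalEval a c = 0 := by
  have hpoly : C.polynomial.evalEval a c = 0 := by
    rw [polynomial, evalEval_sub, evalEval_C, evalEval_pow, evalEval_X, hac, sub_self]
  constructor
  · have h := congrArg (evalEval a c) (congrFun (congrFun (matrixM_mul_matrixN hζ hr) i) j)
    rw [Matrix.mul_apply, Matrix.smul_apply, smul_eq_mul, evalEval_mul, evalEval_mul, hpoly,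
      mul_zero, zero_mul, evalEval_finsetSum] at h
    simpa only [evalEval_mul] using h
  · have h := congrArg (evalEval a c) (congrFun (congrFun (matrixN_mul_matrixM hζ hr) i) j)
    rw [Matrix.mul_apply, Matrix.smul_apply, smul_eq_mul, evalEval_mul, evalEval_mul, hpoly,
      mul_zero, zero_mul, evalEval_finsetSum] at h
    simpa only [evalEval_mul] using h

/-- Solve N M = 0 column by column from the left: the diagonal entry c (ζ - ζ^(-j)) is nonzero as
long as j + 1 < n. -/
theorem matrixN_evalEval_eq_zero_of_col (hζ : IsPrimitiveRoot ζ C.n) (hr : ∀ i, r i ^ C.n = C.α i)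
    {c : K} (hc : c ^ C.n = C.rhs.eval 0) (hc0 : c ≠ 0) (hb : ∏ i, r i = ζ * c) (i : Fin C.n) :
    ∀ j : Fin C.n, (j : ℕ) + 1 < C.n → (C.matrixN ζ r i j).evalEval 0 c = 0 := by
  have hζ0 := hζ.ne_zero (NeZero.ne C.n)
  rintro ⟨j, hj⟩ hj1
  induction j using Nat.strong_induction_on with
  | _ j ih =>
    have h := (sum_matrixM_matrixN_evalEval hζ hr hc i ⟨j, hj⟩).2
    rw [Finset.sum_eq_single ⟨j, hj⟩] at h
    · refine (mul_eq_zero.1 h).resolve_right ?_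
      rw [matrixM_evalEval, if_pos le_rfl, if_pos rfl, Nat.sub_self, coeff_rootPoly_zero, hb,
        mul_comm, ← mul_sub]
      refine mul_ne_zero hc0 (sub_ne_zero.2 fun h1 => ?_)
      refine hζ.pow_ne_one_of_pos_of_lt (Nat.succ_ne_zero j) hj1 ?_
      rw [pow_succ]
      exact (congrArg _ (h1.trans (inv_pow _ _))).trans (mul_inv_cancel₀ (pow_ne_zero _ hζ0))
    · intro l _ hl
      rcases lt_or_ge (l : ℕ) j with h1 | h1
      · rw [ih l h1 l.2 (by dsimp only; omega), zero_mul]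
      · rw [matrixM_evalEval, if_neg, if_neg hl, sub_zero, mul_zero]
        intro h2
        exact hl (Fin.ext (le_antisymm h2 h1))
    · simp

/-- The last row of M is zero except for its diagonal entry ∏ r_i - ζ c, so M N = 0 kills the last
row of N. -/
theorem matrixN_evalEval_eq_zero_of_row (hζ : IsPrimitiveRoot ζ C.n) (hr : ∀ i, r i ^ C.n = C.α i)
    {c : K} (hc : c ^ C.n = C.rhs.eval 0) (hb : ∏ i, r i ≠ ζ * c) {i : Fin C.n}
    (hi : (i : ℕ) + 1 = C.n) (j : Fin C.n) : (C.matrixN ζ r i j).evalEval 0 c = 0 := by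
  have h := (sum_matrixM_matrixN_evalEval hζ hr hc i j).1
  have hζ0 := hζ.ne_zero (NeZero.ne C.n)
  rw [Finset.sum_eq_single i] at h
  · refine (mul_eq_zero.1 h).resolve_left ?_
    rw [matrixM_evalEval, if_pos le_rfl, if_pos rfl, Nat.sub_self, coeff_rootPoly_zero]
    have h1 : ζ⁻¹ ^ (i : ℕ) = ζ := by
      rw [inv_pow]
      refine inv_eq_of_mul_eq_one_right ?_
      rw [← pow_succ, hi, hζ.pow_eq_one]
    rw [h1, mul_comm]
    exact sub_ne_zero.2 hb
  · intro l _ hl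
    rw [matrixM_evalEval, if_neg, if_neg (Ne.symm hl), sub_zero, zero_mul]
    intro h'
    exact hl (Fin.ext (by omega))
  · simp

end SuperellipticCurve

/-- Two decompositions `a i + b j` and `a' i + b' j` with minima zero, related by a cyclic shift
that changes the orders by `e` on wrapping around, differ by a constant between `0` and `e`. -/
theorem exists_cyclic_shift_constant {n : ℕ} (hn : 2 ≤ n) {a b a' b' : Fin n → ℤ} {e : ℤ}
    (he : 0 ≤ e) (ha : ∀ i, 0 ≤ a i) (hb : ∀ i, 0 ≤ b i) (hb' : ∀ i, 0 ≤ b' i)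
    (ha0' : ∃ i, a' i = 0) (hb0 : ∃ i, b i = 0) (hb0' : ∃ i, b' i = 0)
    (h : ∀ i i' j j' : Fin n, ((i' : ℕ) = i + 1 ∨ (i' : ℕ) = 0 ∧ (i : ℕ) + 1 = n) →
      ((j' : ℕ) = j + 1 ∨ (j' : ℕ) = 0 ∧ (j : ℕ) + 1 = n) →
      (if (i' : ℕ) = 0 then e else 0) + (a' i' + b' j') =
        (if (j' : ℕ) = 0 then e else 0) + (a i + b j)) :
    ∃ ρ, 0 ≤ ρ ∧ ρ ≤ e ∧ (∀ i i' : Fin n, (i' : ℕ) = i + 1 → a' i' = a i + ρ) ∧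
      (∀ j j' : Fin n, (j' : ℕ) = j + 1 → b' j' + ρ = b j) ∧
      (∀ i i' : Fin n, (i' : ℕ) = 0 → (i : ℕ) + 1 = n → e + a' i' = a i + ρ) ∧
      ((∀ i : Fin n, (i : ℕ) + 1 = n → 0 < a i) → e = 1 → ρ = 0) ∧
      ((∀ i : Fin n, (i : ℕ) + 1 < n → 0 < b i) → 0 < e → 0 < ρ) := by
  have hpred : ∀ j' : Fin n, ∃ j : Fin n,
      (j' : ℕ) = j + 1 ∨ (j' : ℕ) = 0 ∧ (j : ℕ) + 1 = n := by
    intro j'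
    rcases Nat.eq_zero_or_pos (j' : ℕ) with h0 | h0
    · exact ⟨⟨n - 1, by omega⟩, Or.inr ⟨h0, by dsimp only; omega⟩⟩
    · exact ⟨⟨j' - 1, by omega⟩, Or.inl (by dsimp only; omega)⟩
  have hsucc : ∀ j : Fin n, ∃ j' : Fin n,
      (j' : ℕ) = j + 1 ∨ (j' : ℕ) = 0 ∧ (j : ℕ) + 1 = n := by
    intro j
    rcases Nat.lt_or_ge (j + 1 : ℕ) n with h0 | h0
    · exact ⟨⟨j + 1, h0⟩, Or.inl rfl⟩
    · exact ⟨⟨0, by omega⟩, Or.inr ⟨rfl, by omega⟩⟩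
  let o : Fin n := ⟨0, by omega⟩
  let u : Fin n := ⟨1, by omega⟩
  -- The candidate is ρ = a'(1) - a(0), read off from the row step 0 → 1. As the relation is
  -- additive in rows and columns, the same constant serves every step.
  have hB : ∀ j j' : Fin n, ((j' : ℕ) = j + 1 ∨ (j' : ℕ) = 0 ∧ (j : ℕ) + 1 = n) →
      b' j' + (a' u - a o) = (if (j' : ℕ) = 0 then e else 0) + b j := by
    intro j j' hj
    have h1 := h o u j j' (Or.inl rfl) hj
    rw [if_neg (by simp [u])] at h1
    linarith
  have hA : ∀ i i' : Fin n, ((i' : ℕ) = i + 1 ∨ (i' : ℕ) = 0 ∧ (i : ℕ) + 1 = n) →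
      (if (i' : ℕ) = 0 then e else 0) + a' i' = a i + (a' u - a o) := by
    intro i i' hi
    have h1 := h i i' o u hi (Or.inl rfl)
    have h2 := hB o u (Or.inl rfl)
    linarith
  have hif : ∀ k : ℕ, 0 ≤ (if k = 0 then e else 0) ∧ (if k = 0 then e else 0) ≤ e := by
    intro k
    split_ifs <;> simp [he]
  have hρ : 0 ≤ a' u - a o := by
    obtain ⟨j', hj'⟩ := hb0'
    obtain ⟨j, hj⟩ := hpred j'
    linarith [hB j j' hj, hb j, (hif j').1]
  refine ⟨a' u - a o, hρ, ?_, ?_, ?_, ?_, ?_, ?_⟩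
  · obtain ⟨j, hj⟩ := hb0
    obtain ⟨j', hj'⟩ := hsucc j
    linarith [hB j j' hj', hb' j', (hif j').2]
  · intro i i' hi
    have h1 := hA i i' (Or.inl hi)
    rwa [if_neg (by omega), zero_add] at h1
  · intro j j' hj
    have h1 := hB j j' (Or.inl hj)
    rwa [if_neg (by omega), zero_add] at h1
  · intro i i' hi' hi
    have h1 := hA i i' (Or.inr ⟨hi', hi⟩)
    rwa [if_pos hi'] at h1
  -- At a zero of a', either a(i) + ρ = 0 without wrapping, or a(i) + ρ = e = 1 with a(i) > 0; both
  -- force ρ ≤ 0.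
  · intro hlast he1
    obtain ⟨i', hi'⟩ := ha0'
    obtain ⟨i, hi⟩ := hpred i'
    have h1 := hA i i' hi
    rcases hi with hi | ⟨h0, hi⟩
    · rw [if_neg (by omega)] at h1
      linarith [ha i]
    · rw [if_pos h0] at h1
      linarith [hlast i hi]
  -- At a zero of b', ρ is b(j) > 0 without wrapping, and e + b(j) ≥ e > 0 with wrapping.
  · intro hfirst he0
    obtain ⟨j', hj'⟩ := hb0'
    obtain ⟨j, hj⟩ := hpred j'
    have h1 := hB j j' hj
    rcases hj with hj | ⟨h0, hj⟩
    · rw [if_neg (by omega)] at h1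
      linarith [hfirst j (by omega)]
    · rw [if_pos h0] at h1
      linarith [hb j]

namespace SuperellipticCurve

variable {K : Type*} [Field K] {C : SuperellipticCurve K} {ζ : K} {r : Fin C.d → K}

/-! ### Row and column minima -/

section

variable (ζ : K) (r : Fin C.d → K) (Q : C.Point)

/-- The least order of vanishing at `Q` of the entries of the `i`-th row of `N`. -/
def rowOrd (i : Fin C.n) : ℤ :=
  Finset.univ.inf' Finset.univ_nonempty fun j => Q.ord (C.entryN ζ r i j)

/-- The least order of vanishing at `Q` of the entries of the `j`-th column of `N`. -/
def colOrd (j : Fin C.n) : ℤ :=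
  Finset.univ.inf' Finset.univ_nonempty fun i => Q.ord (C.entryN ζ r i j)

end

theorem rowOrd_eq {Q : C.Point} {i : Fin C.n} {m : ℤ} (h : ∀ j, m ≤ Q.ord (C.entryN ζ r i j))
    (h' : ∃ j, m = Q.ord (C.entryN ζ r i j)) : rowOrd ζ r Q i = m := by
  obtain ⟨j, hj⟩ := h'
  exact le_antisymm (hj ▸ Finset.inf'_le _ (Finset.mem_univ j)) (Finset.le_inf' _ _ fun j _ => h j)

theorem colOrd_eq {Q : C.Point} {j : Fin C.n} {m : ℤ} (h : ∀ i, m ≤ Q.ord (C.entryN ζ r i j))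
    (h' : ∃ i, m = Q.ord (C.entryN ζ r i j)) : colOrd ζ r Q j = m := by
  obtain ⟨i, hi⟩ := h'
  exact le_antisymm (hi ▸ Finset.inf'_le _ (Finset.mem_univ i)) (Finset.le_inf' _ _ fun i _ => h i)

theorem ord_entryN_nonneg {Q : C.Point} (hQ : C.x ∈ Q.localRing) (i j : Fin C.n) :
    0 ≤ Q.ord (C.entryN ζ r i j) := by
  by_cases h : C.entryN ζ r i j = 0
  · rw [h, Place.ord_zero]
  · exact (Q.mem_localRing_iff h).1 ((Q.val_le_one_iff).1 (val_toFunctionField_le_one hQ _))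

theorem rowOrd_nonneg {Q : C.Point} (hQ : C.x ∈ Q.localRing) (i : Fin C.n) : 0 ≤ rowOrd ζ r Q i :=
  Finset.le_inf' _ _ fun _ _ => ord_entryN_nonneg hQ _ _

theorem colOrd_nonneg {Q : C.Point} (hQ : C.x ∈ Q.localRing) (j : Fin C.n) : 0 ≤ colOrd ζ r Q j :=
  Finset.le_inf' _ _ fun _ _ => ord_entryN_nonneg hQ _ _

/-- By rank one, N_ij N_(i₀ j₀) = N_(i j₀) N_(i₀ j); taking (i₀, j₀) with N_(i₀ j₀) of order 0
splits the orders into a row part and a column part. -/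
theorem ord_entryN_eq_add [IsAlgClosed K] (hζ : IsPrimitiveRoot ζ C.n) (hr : ∀ i, r i ^ C.n = C.α i) {Q : C.Point}
    (hQ : C.x ∈ Q.localRing) :
    (∀ i j, Q.ord (C.entryN ζ r i j) = rowOrd ζ r Q i + colOrd ζ r Q j) ∧
      (∃ i, rowOrd ζ r Q i = 0) ∧ ∃ j, colOrd ζ r Q j = 0 := by
  obtain ⟨i₀, j₀, h0⟩ := exists_ord_entryN_eq_zero hζ hr hQ
  have hadd : ∀ i j, Q.ord (C.entryN ζ r i j) =
      Q.ord (C.entryN ζ r i j₀) + Q.ord (C.entryN ζ r i₀ j) := by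
    intro i j
    have h := congrArg Q.ord (entryN_mul_entryN hζ hr i j i₀ j₀)
    rw [Q.ord_mul (entryN_ne_zero hζ hr _ _) (entryN_ne_zero hζ hr _ _),
      Q.ord_mul (entryN_ne_zero hζ hr _ _) (entryN_ne_zero hζ hr _ _), h0, add_zero] at h
    exact h
  have hrow : ∀ i, rowOrd ζ r Q i = Q.ord (C.entryN ζ r i j₀) := fun i =>
    rowOrd_eq (fun j => by linarith [hadd i j, ord_entryN_nonneg (ζ := ζ) (r := r) hQ i₀ j])
      ⟨j₀, rfl⟩
  have hcol : ∀ j, colOrd ζ r Q j = Q.ord (C.entryN ζ r i₀ j) := fun j =>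
    colOrd_eq (fun i => by linarith [hadd i j, ord_entryN_nonneg (ζ := ζ) (r := r) hQ i j₀])
      ⟨i₀, rfl⟩
  refine ⟨fun i j => ?_, ⟨i₀, ?_⟩, ⟨j₀, ?_⟩⟩
  · rw [hrow, hcol, hadd]
  · rw [hrow, h0]
  · rw [hcol, h0]

/-! ### The action of `ζ` on points -/

theorem x_mem_push_zetaPullback (hζ : ζ ^ C.n = 1) {Q : C.Point} :
    C.x ∈ (Q.push (C.zetaPullback ζ hζ)).localRing ↔ C.x ∈ Q.localRing := by
  rw [Place.mem_push, zetaPullback_x]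

theorem IsAffinePoint.push_zetaPullback (hζ : ζ ^ C.n = 1) {Q : C.Point} {a c : K}
    (h : IsAffinePoint Q a c) : IsAffinePoint (Q.push (C.zetaPullback ζ hζ)) a (ζ * c) := by
  refine ⟨?_, ?_⟩
  · rw [← Place.val_lt_one_iff, Place.val_push, map_sub, zetaPullback_x, AlgEquiv.commutes,
      Place.val_lt_one_iff]
    exact h.1
  · rw [← Place.val_lt_one_iff, Place.val_push, map_sub, zetaPullback_y, AlgEquiv.commutes,
      toFunctionField_C_C, map_mul, ← mul_sub, map_mul]
    exact mul_lt_of_le_one_of_lt (Q.val_algebraMap_le_one ζ) (Q.val_lt_one_iff.2 h.2)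

theorem IsAffinePoint.coord_unique {Q : C.Point} {a a' b b' : K} (h : IsAffinePoint Q a b)
    (h' : IsAffinePoint Q a' b') : a = a' ∧ b = b' := by
  have hx := (h.val_lt_one_iff (Polynomial.C (X - Polynomial.C a'))).1 (by
    rw [map_sub, map_sub, toFunctionField_C_C, Place.val_lt_one_iff]; exact h'.1)
  have hy := (h.val_lt_one_iff (X - Polynomial.C (Polynomial.C b'))).1 (by
    rw [map_sub, toFunctionField_C_C, Place.val_lt_one_iff]; exact h'.2)
  simp [evalEval_C, sub_eq_zero] at hx hy
  exact ⟨hx, hy⟩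

open Classical in
/-- Moving from one row or column of `N` to the next. -/
theorem rowOrd_colOrd_succ [IsAlgClosed K] (hζ : IsPrimitiveRoot ζ C.n) (hr : ∀ i, r i ^ C.n = C.α i) {P : C.Point}
    (hP : IsAffinePoint P 0 (∏ i, r i)) {Q : C.Point} (hQ : C.x ∈ Q.localRing) :
    (∀ i i' : Fin C.n, (i' : ℕ) = i + 1 →
      rowOrd ζ r (Q.push (C.zetaPullback ζ hζ.pow_eq_one)) i' =
        rowOrd ζ r Q i + if Q.push (C.zetaPullback ζ hζ.pow_eq_one) = P then 1 else 0) ∧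
    ∀ j j' : Fin C.n, (j' : ℕ) = j + 1 →
      colOrd ζ r (Q.push (C.zetaPullback ζ hζ.pow_eq_one)) j' +
        (if Q.push (C.zetaPullback ζ hζ.pow_eq_one) = P then 1 else 0) = colOrd ζ r Q j := by
  set Q' := Q.push (C.zetaPullback ζ hζ.pow_eq_one) with hQ'def
  have hQ' : C.x ∈ Q'.localRing := (x_mem_push_zetaPullback hζ.pow_eq_one).2 hQ
  have hxord : Q'.ord C.x = Q.ord C.x := by rw [hQ'def, Place.ord_push, zetaPullback_x]
  obtain ⟨hadd, ⟨i₀, hi₀⟩, hb0⟩ := ord_entryN_eq_add hζ hr hQ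
  obtain ⟨hadd', ha0', hb0'⟩ := ord_entryN_eq_add hζ hr hQ'
  obtain ⟨ρ, h0, h1, hrow, hcol, hwrap, hlast, hfirst⟩ := exists_cyclic_shift_constant C.two_le_n
    (Q.ord_nonneg hQ) (rowOrd_nonneg hQ) (colOrd_nonneg hQ) (colOrd_nonneg hQ')
    ha0' hb0 hb0' fun i i' j j' hi hj => by
      rw [← hadd, ← hadd']
      exact ord_push_zetaPullback_entryN hζ hr hi hj Q
  suffices hρ : ρ = if Q' = P then 1 else 0 by
    rw [← hρ]
    exact ⟨hrow, hcol⟩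
  have hxP : 0 < P.ord C.x := by
    by_cases hb : ∏ i, r i = 0
    · rw [hb] at hP
      rw [ord_x_of_eq_zero hP]
      exact_mod_cast NeZero.pos C.n
    · rw [ord_x_of_ne_zero hP hb]
      exact one_pos
  -- If x does not vanish at Q then 0 ≤ ρ ≤ v_Q(x) = 0, and ζQ ≠ P because x vanishes at P.
  rcases (Q.ord_nonneg hQ).eq_or_lt with he | he
  · rw [if_neg]
    · linarith
    · intro h
      rw [← h, hxord] at hxP
      linarith
  obtain ⟨a, c, hac⟩ := exists_isAffinePoint hQ
  obtain rfl : a = 0 := by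
    have h2 := (hac.val_lt_one_iff (Polynomial.C X)).1 (by
      rw [Place.val_lt_one_iff]
      exact (Q.mem_nonunits_iff_ord C.x_ne_zero).2 he)
    simpa [evalEval_C] using h2
  have hac' := hac.push_zetaPullback hζ.pow_eq_one
  rw [← hQ'def] at hac'
  have hceq := hac.equation
  have hPeq := hP.equation
  by_cases hb : ∏ i, r i = 0
  · rw [hb] at hP hPeq
    rw [zero_pow (NeZero.ne _)] at hPeq
    obtain rfl : c = 0 := by
      rw [← hPeq] at hceq
      exact pow_eq_zero_iff (NeZero.ne C.n) |>.1 hceq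
    rw [mul_zero] at hac'
    obtain rfl := hac.unique hP
    have hQQ : Q' = Q := hac'.unique hac
    rw [if_pos hQQ]
    rw [hQQ] at hrow hwrap
    have hn := C.two_le_n
    -- Here P = (0, 0) is fixed by ζ and x has order n at it. The row orders form an arithmetic
    -- progression of step ρ, and closing the cycle gives n ρ = n.
    have hlin : ∀ k (hk : k < C.n), rowOrd ζ r Q ⟨k, hk⟩ =
        rowOrd ζ r Q ⟨0, NeZero.pos C.n⟩ + k * ρ := by
      intro k hk
      induction k with
      | zero => simp
      | succ k ih =>
        rw [hrow ⟨k, by omega⟩ ⟨k + 1, hk⟩ rfl, ih]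
        push_cast; ring
    have h2 := hwrap ⟨C.n - 1, by omega⟩ ⟨0, NeZero.pos C.n⟩ rfl (by dsimp only; omega)
    rw [hlin (C.n - 1), ord_x_of_eq_zero hac, Nat.cast_sub (by omega)] at h2
    have h3 : (C.n : ℤ) * (ρ - 1) = 0 := by
      push_cast at h2
      linarith
    rcases mul_eq_zero.1 h3 with h4 | h4
    · omega
    · linarith
  · have hc0 : c ≠ 0 := by
      rintro rfl
      rw [← hPeq, zero_pow (NeZero.ne _)] at hceq
      exact hb (pow_eq_zero_iff (NeZero.ne C.n) |>.1 hceq.symm)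
    have hx1 : Q.ord C.x = 1 := ord_x_of_ne_zero hac hc0
    have hpos : ∀ i j, (C.matrixN ζ r i j).evalEval 0 c = 0 → 0 < Q.ord (C.entryN ζ r i j) := by
      intro i j hij
      rw [← Q.mem_nonunits_iff_ord (entryN_ne_zero hζ hr i j), ← Place.val_lt_one_iff]
      exact (hac.val_lt_one_iff _).2 hij
    -- Now x is a uniformizer at Q, so ρ is 0 or 1. If ζQ = P, all columns but the last vanish at Q,
    -- which forces ρ > 0; otherwise the last row vanishes, which forces ρ = 0.
    by_cases hbc : ∏ i, r i = ζ * c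
    · rw [hbc] at hP
      rw [if_pos (hac'.unique hP)]
      have h2 := hfirst (fun j hj => by
        have h3 := hpos i₀ j (matrixN_evalEval_eq_zero_of_col hζ hr hceq hc0 hbc i₀ j hj)
        rwa [hadd, hi₀, zero_add] at h3) he
      linarith
    · rw [if_neg]
      · refine hlast (fun i hi => ?_) hx1
        obtain ⟨j, hj⟩ := hb0
        have h3 := hpos i j (matrixN_evalEval_eq_zero_of_row hζ hr hceq hbc hi j)
        rwa [hadd, hj, add_zero] at h3
      · intro h
        rw [h] at hac'
        exact hbc (hP.coord_unique hac').2

end SuperellipticCurve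

namespace SuperellipticCurve

variable {K : Type*} [Field K] {C : SuperellipticCurve K} {ζ : K} {r : Fin C.d → K}

/-! ### The divisors of the first row and of the last column -/

/-- On the curve N M = M N = 0, that is N A = y N Z and A N = y Z N, with A over K[x] and Z
invertible and constant. Thus rows and columns of N span y-stable K[x]-modules, i.e. ideals. -/
theorem root_mul_mk_matrixN (hζ : IsPrimitiveRoot ζ C.n) (hr : ∀ i, r i ^ C.n = C.α i)
    (i j : Fin C.n) :
    AdjoinRoot.root C.polynomial * AdjoinRoot.mk C.polynomial (C.matrixN ζ r i j) ∈
        Submodule.span K[X] (Set.range fun l => AdjoinRoot.mk C.polynomial (C.matrixN ζ r i l)) ∧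
      AdjoinRoot.root C.polynomial * AdjoinRoot.mk C.polynomial (C.matrixN ζ r i j) ∈
        Submodule.span K[X] (Set.range fun l => AdjoinRoot.mk C.polynomial (C.matrixN ζ r l j)) := by
  have hζ0 := hζ.ne_zero (NeZero.ne C.n)
  have hA : ∀ k l, ∃ p, Polynomial.C p = C.matrixM ζ r k l +
      if k = l then X * Polynomial.C (Polynomial.C (ζ⁻¹ ^ (k : ℕ))) else 0 := by
    intro k l
    refine ⟨C.polyA r ((C.d : ℤ) + (k : ℕ) - (l : ℕ)), ?_⟩
    rw [matrixM, Matrix.sub_apply, Matrix.smul_apply, matrixZ, Matrix.diagonal_apply, smul_eq_mul,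
      mul_ite, mul_zero, sub_add_cancel]
    rfl
  choose p hp using hA
  have hNM := fun k l => congrFun (congrFun (matrixN_mul_matrixM hζ hr) k) l
  have hMN := fun k l => congrFun (congrFun (matrixM_mul_matrixN hζ hr) k) l
  simp only [Matrix.mul_apply, Matrix.smul_apply, Matrix.one_apply, smul_eq_mul] at hNM hMN
  generalize C.matrixN ζ r = N at hNM hMN ⊢
  generalize C.matrixM ζ r = M at hNM hMN hp
  have hinv : ∀ k : ℕ, Polynomial.C (Polynomial.C (ζ ^ k)) *
      Polynomial.C (Polynomial.C (ζ⁻¹ ^ k)) = (1 : K[X][X]) := by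
    intro k
    rw [← C_mul, ← C_mul, ← mul_pow, mul_inv_cancel₀ hζ0, one_pow, C_1, C_1]
  have hmem : ∀ (v : Fin C.n → K[X][X]) (c : K[X]) (p : Fin C.n → K[X]) (g e : K[X][X]),
      X * g = Polynomial.C c * ∑ l, Polynomial.C (p l) * v l - C.polynomial * e →
      AdjoinRoot.root C.polynomial * AdjoinRoot.mk C.polynomial g ∈
        Submodule.span K[X] (Set.range fun l => AdjoinRoot.mk C.polynomial (v l)) := by
    intro v c p g e h
    have hs : ∀ (q : K[X]) (f : K[X][X]), AdjoinRoot.mk C.polynomial (Polynomial.C q * f) =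
        q • AdjoinRoot.mk C.polynomial f := by
      intro q f
      rw [map_mul, AdjoinRoot.mk_C, Algebra.smul_def]
      rfl
    have h1 := congrArg (AdjoinRoot.mk C.polynomial) h
    rw [map_mul, AdjoinRoot.mk_X, map_sub, map_mul _ C.polynomial, AdjoinRoot.mk_self, zero_mul,
      sub_zero, hs, map_sum] at h1
    rw [h1]
    refine Submodule.smul_mem _ c (Submodule.sum_mem _ fun l _ => ?_)
    rw [hs]
    exact Submodule.smul_mem _ (p l) (Submodule.subset_span ⟨l, rfl⟩)
  constructor
  · refine hmem _ (ζ ^ (j : ℕ) |> Polynomial.C) (fun l => p l j) _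
      (if i = j then Polynomial.C (Polynomial.C (ζ ^ (j : ℕ) * C.detConst ζ)) else 0) ?_
    have h1 : ∑ l, Polynomial.C (p l j) * N i l =
        ∑ l, N i l * M l j +
          N i j * (X * Polynomial.C (Polynomial.C (ζ⁻¹ ^ (j : ℕ)))) := by
      simp only [hp, add_mul, Finset.sum_add_distrib]
      congr 1
      · exact Finset.sum_congr rfl fun l _ => mul_comm _ _
      · rw [Finset.sum_eq_single j (fun l _ hl => by rw [if_neg hl, zero_mul]) (by simp), if_pos rfl,
          mul_comm]
    rw [h1, hNM]
    have h2 := hinv j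
    split_ifs
    · simp only [C_mul, mul_one] at h2 ⊢
      linear_combination (-(X * N i j)) * h2
    · linear_combination (-(X * N i j)) * h2
  · refine hmem _ (ζ ^ (i : ℕ) |> Polynomial.C) (fun l => p i l) _
      (if i = j then Polynomial.C (Polynomial.C (ζ ^ (i : ℕ) * C.detConst ζ)) else 0) ?_
    have h1 : ∑ l, Polynomial.C (p i l) * N l j =
        ∑ l, M i l * N l j +
          (X * Polynomial.C (Polynomial.C (ζ⁻¹ ^ (i : ℕ)))) * N i j := by
      simp only [hp, add_mul, Finset.sum_add_distrib]
      congr 1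
      rw [Finset.sum_eq_single i (fun l _ hl => by rw [if_neg hl.symm, zero_mul]) (by simp),
        if_pos rfl]
    rw [h1, hMN]
    have h2 := hinv i
    split_ifs
    · simp only [C_mul, mul_one] at h2 ⊢
      linear_combination (-(X * N i j)) * h2
    · linear_combination (-(X * N i j)) * h2

variable [IsAlgClosed K]

/-- In row 0 the pole orders are 2g + (n-1-j), so each of 2g, …, 2g+n-1 occurs once, in reversed
order. -/
theorem exists_divisor_rowOrd (hζ : IsPrimitiveRoot ζ C.n) (hr : ∀ i, r i ^ C.n = C.α i)
    {I : C.Point} (hI : IsInfinite I) {i : Fin C.n} (hi : (i : ℕ) = 0) :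
    ∃ D : C.Div, 0 ≤ D ∧ CurveDivisor.deg D = C.genus ∧ D I = 0 ∧
      ∀ Q, C.x ∈ Q.localRing → D Q = rowOrd ζ r Q i := by
  obtain ⟨D, h0, hdeg, hDI, hD⟩ := exists_divisor_of_generators hI
    (fun j => AdjoinRoot.mk C.polynomial (C.matrixN ζ r i j)) Fin.revPerm
    (fun j h => entryN_ne_zero hζ hr i j (by rw [entryN, toFunctionField_eq, h, map_zero]))
    (fun j => by
      refine (ord_entryN_infinite hζ hr hI i j).trans ?_
      rw [hi, zero_add, Fin.revPerm_apply, Fin.val_rev, Nat.sub_sub, add_comm 1])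
    (fun j => (root_mul_mk_matrixN hζ hr i j).1)
  exact ⟨D, h0, hdeg, hDI, fun Q hQ => (rowOrd_eq (hD Q hQ).1 (hD Q hQ).2).symm⟩

/-- In the last column the pole orders are 2g + i. The first row and the last column are the only
lines of N with the pole orders needed for degree g. -/
theorem exists_divisor_colOrd (hζ : IsPrimitiveRoot ζ C.n) (hr : ∀ i, r i ^ C.n = C.α i)
    {I : C.Point} (hI : IsInfinite I) {j : Fin C.n} (hj : (j : ℕ) + 1 = C.n) :
    ∃ D : C.Div, 0 ≤ D ∧ CurveDivisor.deg D = C.genus ∧ D I = 0 ∧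
      ∀ Q, C.x ∈ Q.localRing → D Q = colOrd ζ r Q j := by
  obtain ⟨D, h0, hdeg, hDI, hD⟩ := exists_divisor_of_generators hI
    (fun i => AdjoinRoot.mk C.polynomial (C.matrixN ζ r i j)) (Equiv.refl _)
    (fun i h => entryN_ne_zero hζ hr i j (by rw [entryN, toFunctionField_eq, h, map_zero]))
    (fun i => by
      refine (ord_entryN_infinite hζ hr hI i j).trans ?_
      rw [show C.n - 1 - (j : ℕ) = 0 by omega, add_zero, Equiv.refl_apply])
    (fun i => (root_mul_mk_matrixN hζ hr i j).2)
  exact ⟨D, h0, hdeg, hDI, fun Q hQ => (colOrd_eq (hD Q hQ).1 (hD Q hQ).2).symm⟩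

end SuperellipticCurve

/-- Separates the points ζ^k P with k < 0, which come from the columns, from those with k ≥ 0, which
come from the rows. -/
theorem sum_Icc_eq_sum_range_add_sum_range {G : Type*} [AddCommMonoid G] (f : ℤ → G) (m i : ℕ) :
    ∑ k ∈ Finset.Icc (-(m : ℤ)) ((i : ℤ) - 1), f k =
      ∑ k ∈ Finset.range m, f (-((k : ℤ) + 1)) + ∑ k ∈ Finset.range i, f k := by
  induction m with
  | zero =>
    rw [Finset.sum_range_zero, zero_add]
    refine (Finset.sum_bij (fun (k : ℕ) _ => (k : ℤ)) ?_ ?_ ?_ ?_).symm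
    · intro k hk
      rw [Finset.mem_range] at hk
      rw [Finset.mem_Icc]
      omega
    · intro k _ l _ h
      exact_mod_cast h
    · intro k hk
      rw [Finset.mem_Icc] at hk
      exact ⟨k.toNat, by rw [Finset.mem_range]; omega, by omega⟩
    · intros; rfl
  | succ m ih =>
    rw [Finset.sum_range_succ, add_right_comm, ← ih]
    have h : Finset.Icc (-((m + 1 : ℕ) : ℤ)) ((i : ℤ) - 1) =
        insert (-((m : ℤ) + 1)) (Finset.Icc (-(m : ℤ)) ((i : ℤ) - 1)) := by
      ext k
      simp only [Finset.mem_insert, Finset.mem_Icc]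
      omega
    rw [h, Finset.sum_insert (by simp), add_comm]

/-! ### The divisors of all entries -/

namespace SuperellipticCurve

variable {K : Type*} [Field K] {C : SuperellipticCurve K} {ζ : K} {r : Fin C.d → K}

theorem zetaPullback_zpow_x (hζ : ζ ^ C.n = 1) (k : ℤ) : (C.zetaPullback ζ hζ ^ k) C.x = C.x := by
  have h : C.zetaPullback ζ hζ ∈ MulAction.stabilizer (C.FunctionField ≃ₐ[K] C.FunctionField) C.x :=
    zetaPullback_x hζ
  exact Subgroup.zpow_mem _ h k

theorem x_mem_zetaPoint (hζ : ζ ^ C.n = 1) (k : ℤ) {Q : C.Point} :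
    C.x ∈ (zetaPoint ζ hζ k Q).localRing ↔ C.x ∈ Q.localRing := by
  rw [zetaPoint, Place.mem_push, zetaPullback_zpow_x]

theorem zetaPoint_zero (hζ : ζ ^ C.n = 1) (Q : C.Point) : zetaPoint ζ hζ 0 Q = Q := by
  rw [zetaPoint, zpow_zero, Place.push_one]

theorem zetaPoint_one (hζ : ζ ^ C.n = 1) (Q : C.Point) :
    zetaPoint ζ hζ 1 Q = Q.push (C.zetaPullback ζ hζ) := by
  rw [zetaPoint, zpow_one]

theorem zetaPoint_zetaPoint (hζ : ζ ^ C.n = 1) (k l : ℤ) (Q : C.Point) :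
    zetaPoint ζ hζ k (zetaPoint ζ hζ l Q) = zetaPoint ζ hζ (k + l) Q := by
  rw [zetaPoint, zetaPoint, ← Place.push_mul, ← zpow_add, add_comm, zetaPoint]

theorem zetaPoint_eq_iff (hζ : ζ ^ C.n = 1) (k l : ℤ) (P Q : C.Point) :
    zetaPoint ζ hζ k P = zetaPoint ζ hζ l Q ↔ zetaPoint ζ hζ (k - l) P = Q := by
  constructor
  · intro h
    rw [sub_eq_neg_add, ← zetaPoint_zetaPoint, h, zetaPoint_zetaPoint, neg_add_cancel,
      zetaPoint_zero]
  · rintro rfl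
    rw [zetaPoint_zetaPoint, add_sub_cancel]

theorem zetaPoint_add_n (hζ : ζ ^ C.n = 1) (k : ℤ) (Q : C.Point) :
    zetaPoint ζ hζ (k + C.n) Q = zetaPoint ζ hζ k Q := by
  rw [zetaPoint, zpow_add, zpow_natCast, zetaPullback_pow_n, mul_one, zetaPoint]

theorem zetaDiv_apply (hζ : ζ ^ C.n = 1) (k : ℤ) (X : C.Div) (Q : C.Point) :
    zetaDiv ζ hζ k X Q = X (zetaPoint ζ hζ (-k) Q) := by
  rw [zetaDiv, CurveDivisor.push_apply, ← zpow_neg, zetaPoint]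

theorem IsInfinite.zetaPoint_eq {I : C.Point} (hI : IsInfinite I) (hζ : ζ ^ C.n = 1) (k : ℤ) :
    zetaPoint ζ hζ k I = I :=
  IsInfinite.unique (fun h => hI ((x_mem_zetaPoint hζ k).1 h)) hI

-- Iteration of the row step backwards along Q, ζ⁻¹Q, …; a unit is gained each time the orbit meets
-- P.
open Classical in
theorem rowOrd_eq_add_sum [IsAlgClosed K] (hζ : IsPrimitiveRoot ζ C.n)
    (hr : ∀ i, r i ^ C.n = C.α i) {P : C.Point} (hP : IsAffinePoint P 0 (∏ i, r i)) {D : C.Div}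
    (hD : ∀ Q, C.x ∈ Q.localRing → D Q = rowOrd ζ r Q 0) (i : ℕ) (hi : i < C.n) :
    ∀ {Q : C.Point}, C.x ∈ Q.localRing → rowOrd ζ r Q ⟨i, hi⟩ =
      D (zetaPoint ζ hζ.pow_eq_one (-i) Q) +
        ∑ k ∈ Finset.range i, if zetaPoint ζ hζ.pow_eq_one k P = Q then 1 else 0 := by
  induction i with
  | zero =>
    intro Q hQ
    rw [Nat.cast_zero, neg_zero, zetaPoint_zero, hD Q hQ, Finset.sum_range_zero, add_zero]
    rfl
  | succ i ih =>
    intro Q hQ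
    have hQ' := (x_mem_zetaPoint hζ.pow_eq_one (-1)).2 hQ
    have h := (rowOrd_colOrd_succ hζ hr hP hQ').1 ⟨i, by omega⟩ ⟨i + 1, hi⟩ rfl
    rw [← zetaPoint_one, zetaPoint_zetaPoint, add_neg_cancel, zetaPoint_zero,
      ih (by omega) hQ', zetaPoint_zetaPoint] at h
    rw [h, Finset.sum_range_succ', ← add_assoc, Nat.cast_zero, zetaPoint_zero]
    simp only [zetaPoint_eq_iff, sub_neg_eq_add, Nat.cast_add, Nat.cast_one, neg_add, eq_comm]

-- The column step lowers the order at P when the index increases, so here the iteration starts from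
-- the last column and m counts the distance to it.
open Classical in
theorem colOrd_eq_add_sum [IsAlgClosed K] (hζ : IsPrimitiveRoot ζ C.n)
    (hr : ∀ i, r i ^ C.n = C.α i) {P : C.Point} (hP : IsAffinePoint P 0 (∏ i, r i)) {D : C.Div}
    {l : Fin C.n} (hl : (l : ℕ) + 1 = C.n)
    (hD : ∀ Q, C.x ∈ Q.localRing → D Q = colOrd ζ r Q l) (m : ℕ) :
    ∀ {j : Fin C.n}, (j : ℕ) + m + 1 = C.n → ∀ {Q : C.Point}, C.x ∈ Q.localRing →
      colOrd ζ r Q j = D (zetaPoint ζ hζ.pow_eq_one m Q) +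
        ∑ k ∈ Finset.range m, if zetaPoint ζ hζ.pow_eq_one (-(k + 1)) P = Q then 1 else 0 := by
  induction m with
  | zero =>
    intro j hj Q hQ
    obtain rfl : j = l := Fin.ext (by omega)
    rw [Nat.cast_zero, zetaPoint_zero, hD Q hQ, Finset.sum_range_zero, add_zero]
  | succ m ih =>
    intro j hj Q hQ
    have hQ' := (x_mem_zetaPoint hζ.pow_eq_one 1).2 hQ
    have h := (rowOrd_colOrd_succ hζ hr hP hQ).2 j ⟨j + 1, by omega⟩ rfl
    rw [← zetaPoint_one, ih (by dsimp only; omega) hQ', zetaPoint_zetaPoint] at h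
    rw [← h, Finset.sum_range_succ', ← add_assoc, Nat.cast_zero, zero_add]
    have h1 : ∀ (k : ℤ), (zetaPoint ζ hζ.pow_eq_one k P = zetaPoint ζ hζ.pow_eq_one 1 Q) =
        (zetaPoint ζ hζ.pow_eq_one (k - 1) P = Q) :=
      fun k => propext (zetaPoint_eq_iff hζ.pow_eq_one k 1 P Q)
    have h2 : (zetaPoint ζ hζ.pow_eq_one 1 Q = P) = (zetaPoint ζ hζ.pow_eq_one (-1) P = Q) := by
      have h3 := zetaPoint_eq_iff hζ.pow_eq_one 0 1 P Q
      rw [zetaPoint_zero, zero_sub] at h3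
      rw [← h3]
      exact propext eq_comm
    simp only [h1, h2, neg_add', Nat.cast_add, Nat.cast_one]

/-- The divisors of all entries of `N`. -/
theorem exists_divisors_entryN [IsAlgClosed K] (hζ : IsPrimitiveRoot ζ C.n)
    (hr : ∀ i, r i ^ C.n = C.α i) {I P : C.Point} (hI : IsInfinite I)
    (hP : IsAffinePoint P 0 (∏ i, r i)) :
    ∃ D E : C.Div, (0 ≤ D ∧ CurveDivisor.deg D = C.genus ∧ D I = 0 ∧
        ∀ Q, C.x ∈ Q.localRing → D Q = rowOrd ζ r Q 0) ∧
      (0 ≤ E ∧ CurveDivisor.deg E = C.genus) ∧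
      (∀ i j, (zetaDiv ζ hζ.pow_eq_one (i : ℕ) D + zetaDiv ζ hζ.pow_eq_one (j : ℕ) E +
        ∑ k ∈ Finset.Icc (((j : ℕ) : ℤ) + 1 - C.n) (((i : ℕ) : ℤ) - 1),
          Finsupp.single (zetaPoint ζ hζ.pow_eq_one k P) 1 : C.Div) I = 0) ∧
      ∀ (i j : Fin C.n) (Q : C.Point), C.x ∈ Q.localRing → Q.ord (C.entryN ζ r i j) =
        (zetaDiv ζ hζ.pow_eq_one (i : ℕ) D + zetaDiv ζ hζ.pow_eq_one (j : ℕ) E +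
        ∑ k ∈ Finset.Icc (((j : ℕ) : ℤ) + 1 - C.n) (((i : ℕ) : ℤ) - 1),
          Finsupp.single (zetaPoint ζ hζ.pow_eq_one k P) 1 : C.Div) Q := by
  classical
  have hn := C.two_le_n
  obtain ⟨D, hD0, hDdeg, hDI, hD⟩ := exists_divisor_rowOrd hζ hr hI (i := 0) rfl
  let l : Fin C.n := ⟨C.n - 1, by omega⟩
  have hl : (l : ℕ) + 1 = C.n := by dsimp only [l]; omega
  obtain ⟨E, hE0, hEdeg, hEI, hE⟩ := exists_divisor_colOrd hζ hr hI hl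
  -- Column j at Q is the last column at ζ^(n-1-j) Q = ζ^(-1-j) Q, so its divisor is ζ^(j+1) applied
  -- to that of the last column; normalizing to ζ^j E puts one ζ into E.
  refine ⟨D, zetaDiv ζ hζ.pow_eq_one 1 E, ⟨hD0, hDdeg, hDI, hD⟩, ⟨?_, ?_⟩, ?_, ?_⟩
  · intro Q
    rw [zetaDiv_apply]
    exact hE0 _
  · rw [zetaDiv, CurveDivisor.deg_push, hEdeg]
  · intro i j
    rw [Finsupp.add_apply, Finsupp.add_apply, zetaDiv_apply, zetaDiv_apply, zetaDiv_apply,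
      hI.zetaPoint_eq, hI.zetaPoint_eq, hI.zetaPoint_eq, hDI, hEI, Finsupp.finsetSum_apply,
      add_zero, zero_add]
    refine Finset.sum_eq_zero fun k _ => Finsupp.single_eq_of_ne ?_
    rintro h
    rw [h] at hI
    exact hI ((x_mem_zetaPoint hζ.pow_eq_one k).2 hP.x_mem)
  · intro i j Q hQ
    have hj := j.2
    rw [(ord_entryN_eq_add hζ hr hQ).1, rowOrd_eq_add_sum hζ hr hP hD i i.2 hQ,
      colOrd_eq_add_sum hζ hr hP hl hE (C.n - 1 - j) (by omega) hQ, Finsupp.add_apply,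
      Finsupp.add_apply, zetaDiv_apply, zetaDiv_apply, zetaDiv_apply, zetaPoint_zetaPoint,
      show ((j : ℕ) : ℤ) + 1 - C.n = -((C.n - 1 - j : ℕ) : ℤ) by omega,
      sum_Icc_eq_sum_range_add_sum_range, Finsupp.add_apply, Finsupp.finsetSum_apply,
      Finsupp.finsetSum_apply,
      show ((C.n - 1 - j : ℕ) : ℤ) = -1 + -((j : ℕ) : ℤ) + C.n by omega, zetaPoint_add_n]
    simp only [Finsupp.single_apply]
    ring

/-- For arbitrary n-th roots the product differs from b by an n-th root of unity, which can be
absorbed into one of them; if the product is 0 then b = 0 already. -/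
theorem exists_pow_eq_and_prod_eq [IsAlgClosed K] {b : K}
    (hb : b ^ C.n = ∏ i, C.α i) : ∃ r : Fin C.d → K, (∀ i, r i ^ C.n = C.α i) ∧ ∏ i, r i = b := by
  choose t ht using fun i => IsAlgClosed.exists_pow_nat_eq (C.α i) (NeZero.pos C.n)
  have hpow : (∏ i, t i) ^ C.n = b ^ C.n := by
    rw [hb, ← Finset.prod_pow]
    exact Finset.prod_congr rfl fun i _ => ht i
  by_cases h0 : ∏ i, t i = 0
  · refine ⟨t, ht, ?_⟩
    rw [h0, zero_pow (NeZero.ne _)] at hpow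
    rw [h0, (pow_eq_zero_iff (NeZero.ne C.n)).1 hpow.symm]
  · let i₀ : Fin C.d := ⟨0, by have := C.two_le_d; omega⟩
    refine ⟨fun i => (if i = i₀ then b / ∏ i, t i else 1) * t i, fun i => ?_, ?_⟩
    · rw [mul_pow, ht]
      split_ifs
      · rw [div_pow, hpow, div_self, one_mul]
        rw [← hpow]
        exact pow_ne_zero _ h0
      · rw [one_pow, one_mul]
    · rw [Finset.prod_mul_distrib, Finset.prod_ite_eq' Finset.univ i₀,
        if_pos (Finset.mem_univ _), div_mul_cancel₀ _ h0]

theorem eval_zero_rhs : C.rhs.eval 0 = ∏ i, C.α i := by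
  rw [rhs, eval_prod]
  simp

end SuperellipticCurve

end

/-! ### The main theorem -/

open CurveDivisor SuperellipticCurve in
theorem mainTheorem1 {K : Type*} [Field K] [IsAlgClosed K] (C : SuperellipticCurve K)
    (ζ : K) (hζ : IsPrimitiveRoot ζ C.n) (b : K) (hb : b ^ C.n = ∏ i, C.α i) :
    (∃! I : C.Point, IsInfinite I) ∧
    (∃! P : C.Point, IsAffinePoint P 0 b) ∧
    (∃ r : Fin C.d → K, (∀ i, r i ^ C.n = C.α i) ∧ ∏ i, r i = b) ∧
    ∀ (I P : C.Point) (r : Fin C.d → K), IsInfinite I → IsAffinePoint P 0 b →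
      (∀ i, r i ^ C.n = C.α i) → ∏ i, r i = b →
      (∀ i j, C.entryN ζ r i j ≠ 0) ∧
      ∃ D E : C.Div,
        IsGCD (fun j => divisor₀ (C.entryN ζ r 0 j)) D ∧
        0 ≤ D ∧ deg D = C.genus ∧
        LinEquiv (D - zetaDiv ζ hζ.pow_eq_one 1 D) (Finsupp.single P 1 - Finsupp.single I 1) ∧
        0 ≤ E ∧ deg E = C.genus ∧
        ∀ i j : Fin C.n,
          divisor₀ (C.entryN ζ r i j) =
            ⇑((zetaDiv ζ hζ.pow_eq_one (i : ℕ) D + zetaDiv ζ hζ.pow_eq_one (j : ℕ) E +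
              ∑ k ∈ Finset.Icc (((j : ℕ) : ℤ) + 1 - C.n) (((i : ℕ) : ℤ) - 1),
                Finsupp.single (zetaPoint ζ hζ.pow_eq_one k P) 1 : C.Div)) ∧
          divisor (C.entryN ζ r i j) =
            ⇑((zetaDiv ζ hζ.pow_eq_one (i : ℕ) D + zetaDiv ζ hζ.pow_eq_one (j : ℕ) E +
              ∑ k ∈ Finset.Icc (((j : ℕ) : ℤ) + 1 - C.n) (((i : ℕ) : ℤ) - 1),
                Finsupp.single (zetaPoint ζ hζ.pow_eq_one k P) 1 -
              Finsupp.single I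
                (2 * (C.genus : ℤ) + ((i : ℕ) : ℤ) + ((C.n : ℤ) - 1 - ((j : ℕ) : ℤ))) : C.Div)) := by
  classical
  refine ⟨?_, ?_, exists_pow_eq_and_prod_eq hb, ?_⟩
  · obtain ⟨I, hI⟩ := C.exists_isInfinite
    exact ⟨I, hI, fun J hJ => hJ.unique hI⟩
  · exact existsUnique_isAffinePoint (by rw [hb, eval_zero_rhs])
  rintro I P r hI hP hr rfl
  have hne := entryN_ne_zero hζ hr
  refine ⟨hne, ?_⟩
  obtain ⟨D, E, ⟨hD0, hDdeg, hDI, hD⟩, ⟨hE0, hEdeg⟩, hinf, hfin⟩ :=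
    exists_divisors_entryN hζ hr hI hP
  have hordI := ord_entryN_infinite hζ hr hI
  have hplace : ∀ Q : C.Point, C.x ∈ Q.localRing ∧ Q ≠ I ∨ Q = I := fun Q => by
    by_cases hQ : C.x ∈ Q.localRing
    · exact Or.inl ⟨hQ, fun h => hI (h ▸ hQ)⟩
    · exact Or.inr (IsInfinite.unique hQ hI)
  have hdiv₀ : ∀ i j, divisor₀ (C.entryN ζ r i j) =
      ⇑((zetaDiv ζ hζ.pow_eq_one (i : ℕ) D + zetaDiv ζ hζ.pow_eq_one (j : ℕ) E +
        ∑ k ∈ Finset.Icc (((j : ℕ) : ℤ) + 1 - C.n) (((i : ℕ) : ℤ) - 1),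
          Finsupp.single (zetaPoint ζ hζ.pow_eq_one k P) 1 : C.Div)) := by
    intro i j
    funext Q
    rw [divisor₀]
    rcases hplace Q with ⟨hQ, -⟩ | rfl
    · rw [if_pos (ord_entryN_nonneg hQ i j), hfin i j Q hQ]
    -- At infinity the order is at most 0, so the effective part vanishes there, as do D, E and the
    -- points ζ^k P.
    · rw [hinf, hordI]
      split_ifs <;> omega
  have hdiv : ∀ i j, divisor (C.entryN ζ r i j) =
      ⇑((zetaDiv ζ hζ.pow_eq_one (i : ℕ) D + zetaDiv ζ hζ.pow_eq_one (j : ℕ) E +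
        ∑ k ∈ Finset.Icc (((j : ℕ) : ℤ) + 1 - C.n) (((i : ℕ) : ℤ) - 1),
          Finsupp.single (zetaPoint ζ hζ.pow_eq_one k P) 1 -
        Finsupp.single I
          (2 * (C.genus : ℤ) + ((i : ℕ) : ℤ) + ((C.n : ℤ) - 1 - ((j : ℕ) : ℤ))) : C.Div)) := by
    intro i j
    funext Q
    rw [divisor, Finsupp.sub_apply]
    rcases hplace Q with ⟨hQ, hQI⟩ | rfl
    · rw [Finsupp.single_eq_of_ne hQI, sub_zero, hfin i j Q hQ]
    · rw [hinf, hordI, Finsupp.single_eq_same]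
      have := j.2
      omega
  refine ⟨D, E, ⟨fun j Q => ?_, fun B hB Q => ?_⟩, hD0, hDdeg, ?_, hE0, hEdeg,
    fun i j => ⟨hdiv₀ i j, hdiv i j⟩⟩
  · change D Q ≤ divisor₀ (C.entryN ζ r 0 j) Q
    rcases hplace Q with ⟨hQ, -⟩ | rfl
    · rw [divisor₀, if_pos (ord_entryN_nonneg hQ 0 j), hD Q hQ]
      exact Finset.inf'_le _ (Finset.mem_univ j)
    · rw [hdiv₀, hinf, hDI]
  · have hBQ : ∀ j, B Q ≤ divisor₀ (C.entryN ζ r 0 j) Q := fun j => hB j Q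
    rcases hplace Q with ⟨hQ, -⟩ | rfl
    · rw [hD Q hQ]
      refine Finset.le_inf' _ _ fun j _ => (hBQ j).trans ?_
      rw [divisor₀, if_pos (ord_entryN_nonneg hQ 0 j)]
    · refine (hBQ 0).trans ?_
      rw [hdiv₀, hinf, hDI]
  · have hn := C.two_le_n
    let u : Fin C.n := ⟨1, by omega⟩
    -- In the quotient of the first two entries of column 0 the part from E and the common points
    -- ζ^k P cancel. What remains is D - ζD, the extra point P (k = 0) of the denominator and its
    -- extra pole at infinity.
    refine ⟨C.entryN ζ r 0 0 / C.entryN ζ r u 0, div_ne_zero (hne _ _) (hne _ _), ?_⟩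
    funext Q
    have h0 := congrFun (hdiv 0 0) Q
    have h1 := congrFun (hdiv u 0) Q
    have hu : ((u : ℕ) : ℤ) = 1 := rfl
    have hz : (((0 : Fin C.n) : ℕ) : ℤ) = 0 := rfl
    have hIcc : Finset.Icc (0 + 1 - (C.n : ℤ)) (1 - 1) =
        insert 0 (Finset.Icc (0 + 1 - (C.n : ℤ)) (0 - 1)) := by
      ext k
      simp only [Finset.mem_insert, Finset.mem_Icc]
      omega
    rw [hu, hz, hIcc, Finset.sum_insert (by simp), zetaPoint_zero] at h1
    rw [hz] at h0
    have hD0 : zetaDiv ζ hζ.pow_eq_one 0 D = D := by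
      ext Q
      rw [zetaDiv_apply, neg_zero, zetaPoint_zero]
    rw [hD0] at h0
    have hord : divisor (C.entryN ζ r 0 0 / C.entryN ζ r u 0) Q =
        divisor (C.entryN ζ r 0 0) Q - divisor (C.entryN ζ r u 0) Q := by
      simp only [divisor]
      rw [div_eq_mul_inv, Q.ord_mul (hne _ _) (inv_ne_zero (hne _ _)), Q.ord_inv, sub_eq_add_neg]
    rw [hord, h0, h1]
    have hI2 : ∀ s : ℤ, (Finsupp.single I s : C.Div) Q = s * (Finsupp.single I 1 : C.Div) Q := by
      intro s
      rw [Finsupp.single_apply, Finsupp.single_apply]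
      split_ifs <;> simp
    simp only [Finsupp.sub_apply, Finsupp.add_apply]
    rw [hI2 (2 * _ + 0 + _), hI2 (2 * _ + 1 + _)]
    ring
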